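/- Work in Linear Abadi--Plotkin Logic (LAPL) over $\mathrm{PILL}_Y$, the polymorphic dual intuitionistic/linear lambda calculus with type formers $\alpha, I, \sigma\otimes\tau, \sigma\multimap\tau, {!}\sigma, \prod\alpha.\sigma$ and fixed point combinator $Y$, over an arbitrary polymorphic signature (type constants of given arities and term constants of closed type). Write $\sigma\to\tau={!}\sigma\multimap\tau$. Assume the extensionality schemes $(\forall x:\sigma.\ t\,x=_\tau u\,x)\supset t=_{\sigma\multimap\tau}u$ and $(\forall\alpha.\ t\,\alpha=_\tau u\,\alpha)\supset t=_{\prod\alpha.\tau}u$, and the identity extension schema $\forall\vec\alpha.\ \sigma[\mathrm{eq}_{\vec\alpha}]\equiv \mathrm{eq}_{\sigma(\vec\alpha)}$ for all types $\sigma$ (further non-logical assumptions may be present). For a kind context $\Xi$ let $\mathrm{LinType}_\Xi$ be the category whose objects are the types $\Xi\vdash\sigma:\mathrm{Type}$ and whose morphisms $\sigma\to\tau$ are the closed terms $\Xi\mid-;-\vdash f:\sigma\multimap\tau$ modulo provability of the internal equality $f=_{\sigma\multimap\tau}g$ under these assumptions, with composition $g\circ f=\lambda^\circ x.\,g(f\,x)$.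 Let $\alpha\vdash\sigma(\alpha)$ be an inductively constructed type (built from type variables and closed types by the type formers $I,\otimes,\multimap,{!},\prod$) in which $\alpha$ has no negative occurrence. Let $M_\sigma:\prod\alpha,\beta.(\alpha\multimap\beta)\to\sigma(\alpha)\multimap\sigma(\beta)$ be the term defined by the usual structural recursion on $\sigma$ (precomposition and postcomposition for $\multimap$, componentwise for $\otimes$, pointwise for ${!}$ and $\prod$, the identity on closed types and bound type variables), and write $\sigma(f)=M_\sigma\,\tau\,\tau'\,{!}f$ for $f:\tau\multimap\tau'$. Put $$\mu\alpha.\sigma(\alpha)=\textstyle\prod\alpha.(\sigma(\alpha)\multimap\alpha)\to\alpha,$$ $$\mathit{fold}=\Lambda\alpha.\lambda f:\sigma(\alpha)\multimap\alpha.\lambda^\circ u:\mu\alpha.\sigma(\alpha).\ u\,\alpha\,{!}f,$$ $$\mathit{in}=\lambda^\circ z:\sigma(\mu\alpha.\sigma(\alpha)).\Lambda\alpha.\lambda f:\sigma(\alpha)\multimap\alpha.\ f\,(\sigma(\mathit{fold}\,\alpha\,{!}f)\,z).$$ Then for every kind context $\Xi$: (1) $\tau\mapsto\sigma(\tau)$,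 $[f]\mapsto[\sigma(f)]$ is an endofunctor of $\mathrm{LinType}_\Xi$, and $(\mu\alpha.\sigma(\alpha),[\mathit{in}])$ is an initial algebra for it. (2) For every algebra $\Xi\mid-;-\vdash f:\sigma(\tau)\multimap\tau$, the term $\mathit{fold}\,\tau\,{!}f$ is a map of algebras from $\mathit{in}$ to $f$, i.e. $(\mathit{fold}\,\tau\,{!}f)\circ\mathit{in}=f\circ\sigma(\mathit{fold}\,\tau\,{!}f)$ is provable; and if $\Xi\mid-;-\vdash h:\mu\alpha.\sigma(\alpha)\multimap\tau$ is any map of algebras from $\mathit{in}$ to $f$, i.e. $h\circ\mathit{in}=f\circ\sigma(h)$ is provable, then $h=_{\mu\alpha.\sigma(\alpha)\multimap\tau}\mathit{fold}\,\tau\,{!}f$ is provable. -/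

import Mathlib

universe u v

namespace LAPL

/-! ## Signatures and types -/

/-- Type constants with their arities. -/
structure TySig where
  Con : Type u
  arity : Con → ℕ

/-- `Ty K n` is the set of types `α₁, …, αₙ ⊢ σ : Type`.  Type variables are de Bruijn indices. -/
inductive Ty (K : TySig.{u}) : ℕ → Type u
  | var {n : ℕ} (i : Fin n) : Ty K n
  | con {n : ℕ} (c : K.Con) (args : Fin (K.arity c) → Ty K n) : Ty K n
  | one {n : ℕ} : Ty K n
  | tensor {n : ℕ} (σ τ : Ty K n) : Ty K n
  | lolli {n : ℕ} (σ τ : Ty K n) : Ty K n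
  | bang {n : ℕ} (σ : Ty K n) : Ty K n
  | pi {n : ℕ} (σ : Ty K (n + 1)) : Ty K n

/-- The lift of a renaming of type variables under a binder. -/
def liftRen {n m : ℕ} (f : Fin n → Fin m) : Fin (n + 1) → Fin (m + 1) :=
  Fin.cases 0 (fun i => (f i).succ)

/-- Renaming of type variables. -/
def Ty.ren {K : TySig.{u}} : {n m : ℕ} → (Fin n → Fin m) → Ty K n → Ty K m
  | _, _, f, .var i => .var (f i)
  | _, _, f, .con c a => .con c (fun j => (a j).ren f)
  | _, _, _, .one => .one
  | _, _, f, .tensor σ τ => .tensor (σ.ren f) (τ.ren f)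
  | _, _, f, .lolli σ τ => .lolli (σ.ren f) (τ.ren f)
  | _, _, f, .bang σ => .bang (σ.ren f)
  | _, _, f, .pi σ => .pi (σ.ren (liftRen f))

/-- Weakening by one type variable. -/
def Ty.wk {K : TySig.{u}} {n : ℕ} (σ : Ty K n) : Ty K (n + 1) := σ.ren Fin.succ

/-- A closed type, regarded as a type in an arbitrary kind context. -/
def Ty.close {K : TySig.{u}} {n : ℕ} (σ : Ty K 0) : Ty K n := σ.ren Fin.elim0

/-- The lift of a type substitution under a binder. -/
def liftTy {K : TySig.{u}} {n m : ℕ} (s : Fin n → Ty K m) : Fin (n + 1) → Ty K (m + 1) :=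
  Fin.cases (.var 0) (fun i => (s i).wk)

/-- Simultaneous (capture avoiding) substitution of types for type variables. -/
def Ty.sub {K : TySig.{u}} : {n m : ℕ} → (Fin n → Ty K m) → Ty K n → Ty K m
  | _, _, s, .var i => s i
  | _, _, s, .con c a => .con c (fun j => (a j).sub s)
  | _, _, _, .one => .one
  | _, _, s, .tensor σ τ => .tensor (σ.sub s) (τ.sub s)
  | _, _, s, .lolli σ τ => .lolli (σ.sub s) (τ.sub s)
  | _, _, s, .bang σ => .bang (σ.sub s)
  | _, _, s, .pi σ => .pi (σ.sub (liftTy s))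

/-- The substitution `[τ/α]` for the most recent type variable. -/
def instTy {K : TySig.{u}} {n : ℕ} (τ : Ty K n) : Fin (n + 1) → Ty K n :=
  Fin.cases τ Ty.var

/-- Intuitionistic function space `σ → τ = !σ ⊸ τ`. -/
def Ty.arr {K : TySig.{u}} {n : ℕ} (σ τ : Ty K n) : Ty K n := .lolli (.bang σ) τ

/-- A polymorphic signature: type constants, and term constants with closed types. -/
structure Sig extends TySig.{u} where
  TmCon : Type v
  tmTy : TmCon → Ty toTySig 0

/-- The types over the signature `S` in a kind context with `n` variables. -/
abbrev Sig.Ty (S : Sig.{u, v}) (n : ℕ) : Type u := LAPL.Ty S.toTySig n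

/-! ## Terms -/

/-- Raw terms with `n` type variables.  Term variables, both intuitionistic and linear ones, are
de Bruijn indices in a common context. In `letT σ τ s t`, i.e. `let x:σ ⊗ y:τ be s in t`, the
variable `y` has index `0` and `x` has index `1` in `t`. -/
inductive Tm (S : Sig.{u, v}) : ℕ → Type (max u v)
  | var {n : ℕ} (i : ℕ) : Tm S n
  | con {n : ℕ} (c : S.TmCon) : Tm S n
  | star {n : ℕ} : Tm S n
  | Y {n : ℕ} : Tm S n
  | lam {n : ℕ} (σ : S.Ty n) (t : Tm S n) : Tm S n
  | app {n : ℕ} (t u : Tm S n) : Tm S n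
  | tensor {n : ℕ} (t u : Tm S n) : Tm S n
  | bang {n : ℕ} (t : Tm S n) : Tm S n
  | tlam {n : ℕ} (t : Tm S (n + 1)) : Tm S n
  | tapp {n : ℕ} (t : Tm S n) (σ : S.Ty n) : Tm S n
  | letT {n : ℕ} (σ τ : S.Ty n) (s t : Tm S n) : Tm S n
  | letB {n : ℕ} (σ : S.Ty n) (s t : Tm S n) : Tm S n
  | letS {n : ℕ} (s t : Tm S n) : Tm S n

/-- The lift of a renaming of term (or relation) variables under a binder. -/
def liftIdx (r : ℕ → ℕ) : ℕ → ℕ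
  | 0 => 0
  | i + 1 => r i + 1

/-- Renaming of type variables (by `f`) and term variables (by `r`). -/
def Tm.ren {S : Sig.{u, v}} : {n m : ℕ} → (Fin n → Fin m) → (ℕ → ℕ) → Tm S n → Tm S m
  | _, _, _, r, .var i => .var (r i)
  | _, _, _, _, .con c => .con c
  | _, _, _, _, .star => .star
  | _, _, _, _, .Y => .Y
  | _, _, f, r, .lam σ t => .lam (σ.ren f) (t.ren f (liftIdx r))
  | _, _, f, r, .app t u => .app (t.ren f r) (u.ren f r)
  | _, _, f, r, .tensor t u => .tensor (t.ren f r) (u.ren f r)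
  | _, _, f, r, .bang t => .bang (t.ren f r)
  | _, _, f, r, .tlam t => .tlam (t.ren (liftRen f) r)
  | _, _, f, r, .tapp t σ => .tapp (t.ren f r) (σ.ren f)
  | _, _, f, r, .letT σ τ s t =>
      .letT (σ.ren f) (τ.ren f) (s.ren f r) (t.ren f (liftIdx (liftIdx r)))
  | _, _, f, r, .letB σ s t => .letB (σ.ren f) (s.ren f r) (t.ren f (liftIdx r))
  | _, _, f, r, .letS s t => .letS (s.ren f r) (t.ren f r)

/-- Weakening by `k` term variables. -/
def Tm.up {S : Sig.{u, v}} {n : ℕ} (k : ℕ) (t : Tm S n) : Tm S n := t.ren id (· + k)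

/-- Weakening by one type variable. -/
def Tm.tup {S : Sig.{u, v}} {n : ℕ} (t : Tm S n) : Tm S (n + 1) := t.ren Fin.succ id

/-- The lift of a term substitution under a binder for a term variable. -/
def liftTm {S : Sig.{u, v}} {n : ℕ} (s : ℕ → Tm S n) : ℕ → Tm S n
  | 0 => .var 0
  | i + 1 => (s i).up 1

/-- Simultaneous substitution of types (by `a`) and terms (by `s`). -/
def Tm.sub {S : Sig.{u, v}} : {n m : ℕ} → (Fin n → S.Ty m) → (ℕ → Tm S m) → Tm S n → Tm S m
  | _, _, _, s, .var i => s i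
  | _, _, _, _, .con c => .con c
  | _, _, _, _, .star => .star
  | _, _, _, _, .Y => .Y
  | _, _, a, s, .lam σ t => .lam (σ.sub a) (t.sub a (liftTm s))
  | _, _, a, s, .app t u => .app (t.sub a s) (u.sub a s)
  | _, _, a, s, .tensor t u => .tensor (t.sub a s) (u.sub a s)
  | _, _, a, s, .bang t => .bang (t.sub a s)
  | _, _, a, s, .tlam t => .tlam (t.sub (liftTy a) (fun i => (s i).tup))
  | _, _, a, s, .tapp t σ => .tapp (t.sub a s) (σ.sub a)
  | _, _, a, s, .letT σ τ p t =>
      .letT (σ.sub a) (τ.sub a) (p.sub a s) (t.sub a (liftTm (liftTm s)))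
  | _, _, a, s, .letB σ p t => .letB (σ.sub a) (p.sub a s) (t.sub a (liftTm s))
  | _, _, a, s, .letS p t => .letS (p.sub a s) (t.sub a s)

/-- The substitution `[u/x]` for the most recent term variable. -/
def inst1 {S : Sig.{u, v}} {n : ℕ} (u : Tm S n) : ℕ → Tm S n
  | 0 => u
  | i + 1 => .var i

/-- The substitution `[s, u / x, y]` where `x` has index `1` and `y` has index `0`. -/
def inst2 {S : Sig.{u, v}} {n : ℕ} (s u : Tm S n) : ℕ → Tm S n
  | 0 => u
  | 1 => s
  | i + 2 => .var i

/-- An entry of a term context: an intuitionistic variable, a linear variable, or a position whose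
variable does not belong to the context (used to keep the indices fixed when the linear part of a
context is split). -/
inductive Entry (S : Sig.{u, v}) (n : ℕ) : Type u
  | int (σ : S.Ty n)
  | lin (σ : S.Ty n)
  | off

/-- Renaming of the type variables of an entry. -/
def Entry.ren {S : Sig.{u, v}} {n m : ℕ} (f : Fin n → Fin m) : Entry S n → Entry S m
  | .int σ => .int (σ.ren f)
  | .lin σ => .lin (σ.ren f)
  | .off => .off

/-- A context `Γ; Δ`, with the variables of `Γ` and of `Δ` interleaved; the most recent variable
comes first. -/
abbrev Ctx (S : Sig.{u, v}) (n : ℕ) : Type u := List (Entry S n)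

/-- The context `Γ; -`. -/
def intCtx {S : Sig.{u, v}} {n : ℕ} (Γ : List (S.Ty n)) : Ctx S n := Γ.map Entry.int

/-- The linear part of the context is empty. -/
def NoLin {S : Sig.{u, v}} {n : ℕ} (G : Ctx S n) : Prop := ∀ σ, Entry.lin σ ∉ G

/-- `Split G G₁ G₂`: `G = Γ; Δ, Δ'`, `G₁ = Γ; Δ` and `G₂ = Γ; Δ'` with `Δ`, `Δ'` disjoint. -/
inductive Split {S : Sig.{u, v}} {n : ℕ} : Ctx S n → Ctx S n → Ctx S n → Prop
  | nil : Split [] [] []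
  | int {G G₁ G₂ : Ctx S n} (σ : S.Ty n) :
      Split G G₁ G₂ → Split (.int σ :: G) (.int σ :: G₁) (.int σ :: G₂)
  | left {G G₁ G₂ : Ctx S n} (σ : S.Ty n) :
      Split G G₁ G₂ → Split (.lin σ :: G) (.lin σ :: G₁) (.off :: G₂)
  | right {G G₁ G₂ : Ctx S n} (σ : S.Ty n) :
      Split G G₁ G₂ → Split (.lin σ :: G) (.off :: G₁) (.lin σ :: G₂)
  | off {G G₁ G₂ : Ctx S n} :
      Split G G₁ G₂ → Split (.off :: G) (.off :: G₁) (.off :: G₂)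

/-- The type `∏α. (α → α) → α` of the fixed point combinator. -/
def tyY {K : TySig.{u}} {n : ℕ} : Ty K n := .pi (.arr (.arr (.var 0) (.var 0)) (.var 0))

/-- The typing judgement `Ξ | Γ; Δ ⊢ t : τ`. -/
inductive HasType {S : Sig.{u, v}} : {n : ℕ} → Ctx S n → Tm S n → S.Ty n → Prop
  | star {n : ℕ} {G : Ctx S n} : NoLin G → HasType G .star .one
  | Y {n : ℕ} {G : Ctx S n} : NoLin G → HasType G .Y tyY
  | con {n : ℕ} {G : Ctx S n} (c : S.TmCon) : NoLin G → HasType G (.con c) (S.tmTy c).close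
  | ivar {n : ℕ} {G : Ctx S n} {i : ℕ} {σ : S.Ty n} :
      NoLin G → G[i]? = some (.int σ) → HasType G (.var i) σ
  | lvar {n : ℕ} {G : Ctx S n} {i : ℕ} {σ : S.Ty n} :
      G[i]? = some (.lin σ) → NoLin (G.set i .off) → HasType G (.var i) σ
  | app {n : ℕ} {G G₁ G₂ : Ctx S n} {t u : Tm S n} {σ τ : S.Ty n} : Split G G₁ G₂ →
      HasType G₁ t (.lolli σ τ) → HasType G₂ u σ → HasType G (.app t u) τ
  | lam {n : ℕ} {G : Ctx S n} {t : Tm S n} {σ τ : S.Ty n} :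
      HasType (.lin σ :: G) t τ → HasType G (.lam σ t) (.lolli σ τ)
  | tensor {n : ℕ} {G G₁ G₂ : Ctx S n} {t u : Tm S n} {σ τ : S.Ty n} : Split G G₁ G₂ →
      HasType G₁ t σ → HasType G₂ u τ → HasType G (.tensor t u) (.tensor σ τ)
  | bang {n : ℕ} {G : Ctx S n} {t : Tm S n} {σ : S.Ty n} :
      NoLin G → HasType G t σ → HasType G (.bang t) (.bang σ)
  | tlam {n : ℕ} {G : Ctx S n} {t : Tm S (n + 1)} {σ : S.Ty (n + 1)} :
      HasType (G.map (Entry.ren Fin.succ)) t σ → HasType G (.tlam t) (.pi σ)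
  | tapp {n : ℕ} {G : Ctx S n} {t : Tm S n} {σ : S.Ty (n + 1)} (τ : S.Ty n) :
      HasType G t (.pi σ) → HasType G (.tapp t τ) (σ.sub (instTy τ))
  | letT {n : ℕ} {G G₁ G₂ : Ctx S n} {s t : Tm S n} {σ σ' τ : S.Ty n} : Split G G₁ G₂ →
      HasType G₁ s (.tensor σ σ') → HasType (.lin σ' :: .lin σ :: G₂) t τ →
      HasType G (.letT σ σ' s t) τ
  | letB {n : ℕ} {G G₁ G₂ : Ctx S n} {s t : Tm S n} {σ τ : S.Ty n} : Split G G₁ G₂ →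
      HasType G₁ s (.bang σ) → HasType (.int σ :: G₂) t τ → HasType G (.letB σ s t) τ
  | letS {n : ℕ} {G G₁ G₂ : Ctx S n} {s t : Tm S n} {σ : S.Ty n} : Split G G₁ G₂ →
      HasType G₁ s .one → HasType G₂ t σ → HasType G (.letS s t) σ

/-- Composition `g ∘ f = λ°x:σ. g (f x)`. -/
def Tm.comp {S : Sig.{u, v}} {n : ℕ} (σ : S.Ty n) (g f : Tm S n) : Tm S n :=
  .lam σ (.app (g.up 1) (.app (f.up 1) (.var 0)))

/-- The identity `λ°x:σ. x`. -/
def Tm.idt {S : Sig.{u, v}} {n : ℕ} (σ : S.Ty n) : Tm S n := .lam σ (.var 0)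

/-- Intuitionistic abstraction `λx:σ. t = λ°y:!σ. let !x be y in t`, with `y` fresh. -/
def Tm.ilam {S : Sig.{u, v}} {n : ℕ} (σ : S.Ty n) (t : Tm S n) : Tm S n :=
  .lam (.bang σ) (.letB σ (.var 0) (t.ren id (liftIdx (· + 1))))

/-! ## External equality -/

/-- Linear contexts `C[-]` (terms with one hole, the hole not below a `!`): `LCx S n m` has `n` type
variables outside and `m` type variables at the hole. -/
inductive LCx (S : Sig.{u, v}) : ℕ → ℕ → Type (max u v)
  | hole {n : ℕ} : LCx S n n
  | letS₁ {n m : ℕ} (C : LCx S n m) (t : Tm S n) : LCx S n m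
  | letS₂ {n m : ℕ} (t : Tm S n) (C : LCx S n m) : LCx S n m
  | tensor₁ {n m : ℕ} (C : LCx S n m) (t : Tm S n) : LCx S n m
  | tensor₂ {n m : ℕ} (t : Tm S n) (C : LCx S n m) : LCx S n m
  | letT₁ {n m : ℕ} (σ τ : S.Ty n) (C : LCx S n m) (t : Tm S n) : LCx S n m
  | letT₂ {n m : ℕ} (σ τ : S.Ty n) (t : Tm S n) (C : LCx S n m) : LCx S n m
  | lam {n m : ℕ} (σ : S.Ty n) (C : LCx S n m) : LCx S n m
  | app₁ {n m : ℕ} (C : LCx S n m) (t : Tm S n) : LCx S n m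
  | app₂ {n m : ℕ} (t : Tm S n) (C : LCx S n m) : LCx S n m
  | letB₁ {n m : ℕ} (σ : S.Ty n) (C : LCx S n m) (t : Tm S n) : LCx S n m
  | letB₂ {n m : ℕ} (σ : S.Ty n) (t : Tm S n) (C : LCx S n m) : LCx S n m
  | tlam {n m : ℕ} (C : LCx S (n + 1) m) : LCx S n m
  | tapp {n m : ℕ} (C : LCx S n m) (σ : S.Ty n) : LCx S n m

/-- `C[u]`, where `u` may use the variables that `C` binds at the hole. -/
def LCx.plug {S : Sig.{u, v}} : {n m : ℕ} → LCx S n m → Tm S m → Tm S n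
  | _, _, .hole, u => u
  | _, _, .letS₁ C t, u => .letS (C.plug u) t
  | _, _, .letS₂ t C, u => .letS t (C.plug u)
  | _, _, .tensor₁ C t, u => .tensor (C.plug u) t
  | _, _, .tensor₂ t C, u => .tensor t (C.plug u)
  | _, _, .letT₁ σ τ C t, u => .letT σ τ (C.plug u) t
  | _, _, .letT₂ σ τ t C, u => .letT σ τ t (C.plug u)
  | _, _, .lam σ C, u => .lam σ (C.plug u)
  | _, _, .app₁ C t, u => .app (C.plug u) t
  | _, _, .app₂ t C, u => .app t (C.plug u)
  | _, _, .letB₁ σ C t, u => .letB σ (C.plug u) t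
  | _, _, .letB₂ σ t C, u => .letB σ t (C.plug u)
  | _, _, .tlam C, u => .tlam (C.plug u)
  | _, _, .tapp C σ, u => .tapp (C.plug u) σ

/-- The number of term variables bound at the hole. -/
def LCx.depth {S : Sig.{u, v}} : {n m : ℕ} → LCx S n m → ℕ
  | _, _, .hole => 0
  | _, _, .letS₁ C _ => C.depth
  | _, _, .letS₂ _ C => C.depth
  | _, _, .tensor₁ C _ => C.depth
  | _, _, .tensor₂ _ C => C.depth
  | _, _, .letT₁ _ _ C _ => C.depth
  | _, _, .letT₂ _ _ _ C => C.depth + 2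
  | _, _, .lam _ C => C.depth + 1
  | _, _, .app₁ C _ => C.depth
  | _, _, .app₂ _ C => C.depth
  | _, _, .letB₁ _ C _ => C.depth
  | _, _, .letB₂ _ _ C => C.depth + 1
  | _, _, .tlam C => C.depth
  | _, _, .tapp C _ => C.depth

/-- The renaming of the outer type variables into the type variables at the hole. -/
def LCx.tyIn {S : Sig.{u, v}} : {n m : ℕ} → LCx S n m → Fin n → Fin m
  | _, _, .hole => id
  | _, _, .letS₁ C _ => C.tyIn
  | _, _, .letS₂ _ C => C.tyIn
  | _, _, .tensor₁ C _ => C.tyIn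
  | _, _, .tensor₂ _ C => C.tyIn
  | _, _, .letT₁ _ _ C _ => C.tyIn
  | _, _, .letT₂ _ _ _ C => C.tyIn
  | _, _, .lam _ C => C.tyIn
  | _, _, .app₁ C _ => C.tyIn
  | _, _, .app₂ _ C => C.tyIn
  | _, _, .letB₁ _ C _ => C.tyIn
  | _, _, .letB₂ _ _ C => C.tyIn
  | _, _, .tlam C => fun i => C.tyIn i.succ
  | _, _, .tapp C _ => C.tyIn

/-- Renaming of the free term variables of a linear context. -/
def LCx.ren {S : Sig.{u, v}} : {n m : ℕ} → (ℕ → ℕ) → LCx S n m → LCx S n m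
  | _, _, _, .hole => .hole
  | _, _, r, .letS₁ C t => .letS₁ (C.ren r) (t.ren id r)
  | _, _, r, .letS₂ t C => .letS₂ (t.ren id r) (C.ren r)
  | _, _, r, .tensor₁ C t => .tensor₁ (C.ren r) (t.ren id r)
  | _, _, r, .tensor₂ t C => .tensor₂ (t.ren id r) (C.ren r)
  | _, _, r, .letT₁ σ τ C t => .letT₁ σ τ (C.ren r) (t.ren id (liftIdx (liftIdx r)))
  | _, _, r, .letT₂ σ τ t C => .letT₂ σ τ (t.ren id r) (C.ren (liftIdx (liftIdx r)))
  | _, _, r, .lam σ C => .lam σ (C.ren (liftIdx r))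
  | _, _, r, .app₁ C t => .app₁ (C.ren r) (t.ren id r)
  | _, _, r, .app₂ t C => .app₂ (t.ren id r) (C.ren r)
  | _, _, r, .letB₁ σ C t => .letB₁ σ (C.ren r) (t.ren id (liftIdx r))
  | _, _, r, .letB₂ σ t C => .letB₂ σ (t.ren id r) (C.ren (liftIdx r))
  | _, _, r, .tlam C => .tlam (C.ren r)
  | _, _, r, .tapp C σ => .tapp (C.ren r) σ

/-- A term from outside, weakened to a term at the hole. -/
def LCx.inside {S : Sig.{u, v}} {n m : ℕ} (C : LCx S n m) (t : Tm S n) : Tm S m :=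
  t.ren C.tyIn (· + C.depth)

/-- The exchange of a block of `k` innermost variables with the next `d` variables. -/
def exch (k d i : ℕ) : ℕ :=
  if i < k then i + d else if i < k + d then i - k else i

/-- External equality `Ξ | Γ; Δ ⊢ t = u : τ`.  Closure under contexts is expressed by
one congruence rule for each term constructor.  In the commuting conversions, `u` is the term at the
hole with the variables of the pattern innermost; on the left hand side these are bound outside of
`C`, whence the exchange of variables. -/
inductive ExtEq {S : Sig.{u, v}} :
    {n : ℕ} → Ctx S n → Tm S n → Tm S n → S.Ty n → Prop
  | refl {n : ℕ} {G : Ctx S n} {t : Tm S n} {τ : S.Ty n} : HasType G t τ → ExtEq G t t τ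
  | symm {n : ℕ} {G : Ctx S n} {t u : Tm S n} {τ : S.Ty n} : ExtEq G t u τ → ExtEq G u t τ
  | trans {n : ℕ} {G : Ctx S n} {t u w : Tm S n} {τ : S.Ty n} :
      ExtEq G t u τ → ExtEq G u w τ → ExtEq G t w τ
  -- beta and eta rules
  | beta {n : ℕ} {G : Ctx S n} {σ : S.Ty n} {t u : Tm S n} {τ : S.Ty n} :
      HasType G (.app (.lam σ t) u) τ → ExtEq G (.app (.lam σ t) u) (t.sub .var (inst1 u)) τ
  | tbeta {n : ℕ} {G : Ctx S n} {t : Tm S (n + 1)} {σ : S.Ty n} {τ : S.Ty n} :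
      HasType G (.tapp (.tlam t) σ) τ →
      ExtEq G (.tapp (.tlam t) σ) (t.sub (instTy σ) .var) τ
  | eta {n : ℕ} {G : Ctx S n} {σ τ : S.Ty n} {t : Tm S n} :
      HasType G t (.lolli σ τ) → ExtEq G (.lam σ (.app (t.up 1) (.var 0))) t (.lolli σ τ)
  | teta {n : ℕ} {G : Ctx S n} {σ : S.Ty (n + 1)} {t : Tm S n} :
      HasType G t (.pi σ) → ExtEq G (.tlam (.tapp t.tup (.var 0))) t (.pi σ)
  | betaS {n : ℕ} {G : Ctx S n} {t : Tm S n} {τ : S.Ty n} :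
      HasType G (.letS .star t) τ → ExtEq G (.letS .star t) t τ
  | etaS {n : ℕ} {G : Ctx S n} {t : Tm S n} :
      HasType G t .one → ExtEq G (.letS t .star) t .one
  | betaT {n : ℕ} {G : Ctx S n} {σ σ' τ : S.Ty n} {s u t : Tm S n} :
      HasType G (.letT σ σ' (.tensor s u) t) τ →
      ExtEq G (.letT σ σ' (.tensor s u) t) (t.sub .var (inst2 s u)) τ
  | etaT {n : ℕ} {G : Ctx S n} {σ σ' : S.Ty n} {t : Tm S n} :
      HasType G t (.tensor σ σ') →
      ExtEq G (.letT σ σ' t (.tensor (.var 1) (.var 0))) t (.tensor σ σ')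
  | betaB {n : ℕ} {G : Ctx S n} {σ τ : S.Ty n} {u t : Tm S n} :
      HasType G (.letB σ (.bang u) t) τ →
      ExtEq G (.letB σ (.bang u) t) (t.sub .var (inst1 u)) τ
  | etaB {n : ℕ} {G : Ctx S n} {σ : S.Ty n} {t : Tm S n} :
      HasType G t (.bang σ) → ExtEq G (.letB σ t (.bang (.var 0))) t (.bang σ)
  -- closure under contexts
  | lam {n : ℕ} {G : Ctx S n} {t t' : Tm S n} {σ τ : S.Ty n} :
      ExtEq (.lin σ :: G) t t' τ → ExtEq G (.lam σ t) (.lam σ t') (.lolli σ τ)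
  | app {n : ℕ} {G G₁ G₂ : Ctx S n} {t t' u u' : Tm S n} {σ τ : S.Ty n} : Split G G₁ G₂ →
      ExtEq G₁ t t' (.lolli σ τ) → ExtEq G₂ u u' σ → ExtEq G (.app t u) (.app t' u') τ
  | tensor {n : ℕ} {G G₁ G₂ : Ctx S n} {t t' u u' : Tm S n} {σ τ : S.Ty n} : Split G G₁ G₂ →
      ExtEq G₁ t t' σ → ExtEq G₂ u u' τ →
      ExtEq G (.tensor t u) (.tensor t' u') (.tensor σ τ)
  | bang {n : ℕ} {G : Ctx S n} {t t' : Tm S n} {σ : S.Ty n} :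
      NoLin G → ExtEq G t t' σ → ExtEq G (.bang t) (.bang t') (.bang σ)
  | tlam {n : ℕ} {G : Ctx S n} {t t' : Tm S (n + 1)} {σ : S.Ty (n + 1)} :
      ExtEq (G.map (Entry.ren Fin.succ)) t t' σ → ExtEq G (.tlam t) (.tlam t') (.pi σ)
  | tapp {n : ℕ} {G : Ctx S n} {t t' : Tm S n} {σ : S.Ty (n + 1)} (τ : S.Ty n) :
      ExtEq G t t' (.pi σ) → ExtEq G (.tapp t τ) (.tapp t' τ) (σ.sub (instTy τ))
  | letT {n : ℕ} {G G₁ G₂ : Ctx S n} {s s' t t' : Tm S n} {σ σ' τ : S.Ty n} : Split G G₁ G₂ →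
      ExtEq G₁ s s' (.tensor σ σ') → ExtEq (.lin σ' :: .lin σ :: G₂) t t' τ →
      ExtEq G (.letT σ σ' s t) (.letT σ σ' s' t') τ
  | letB {n : ℕ} {G G₁ G₂ : Ctx S n} {s s' t t' : Tm S n} {σ τ : S.Ty n} : Split G G₁ G₂ →
      ExtEq G₁ s s' (.bang σ) → ExtEq (.int σ :: G₂) t t' τ →
      ExtEq G (.letB σ s t) (.letB σ s' t') τ
  | letS {n : ℕ} {G G₁ G₂ : Ctx S n} {s s' t t' : Tm S n} {σ : S.Ty n} : Split G G₁ G₂ →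
      ExtEq G₁ s s' .one → ExtEq G₂ t t' σ → ExtEq G (.letS s t) (.letS s' t') σ
  -- commuting conversions
  | commS {n m : ℕ} {G : Ctx S n} {C : LCx S n m} {t : Tm S n} {u : Tm S m} {τ : S.Ty n} :
      HasType G (.letS t (C.plug u)) τ →
      ExtEq G (.letS t (C.plug u)) (C.plug (.letS (C.inside t) u)) τ
  | commT {n m : ℕ} {G : Ctx S n} {C : LCx S n m} {σ σ' : S.Ty n} {t : Tm S n} {u : Tm S m}
      {τ : S.Ty n} :
      HasType G (.letT σ σ' t ((C.ren (· + 2)).plug (u.ren id (exch 2 C.depth)))) τ →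
      ExtEq G (.letT σ σ' t ((C.ren (· + 2)).plug (u.ren id (exch 2 C.depth))))
        (C.plug (.letT (σ.ren C.tyIn) (σ'.ren C.tyIn) (C.inside t) u)) τ
  | commB {n m : ℕ} {G : Ctx S n} {C : LCx S n m} {σ : S.Ty n} {t : Tm S n} {u : Tm S m}
      {τ : S.Ty n} :
      HasType G (.letB σ t ((C.ren (· + 1)).plug (u.ren id (exch 1 C.depth)))) τ →
      ExtEq G (.letB σ t ((C.ren (· + 1)).plug (u.ren id (exch 1 C.depth))))
        (C.plug (.letB (σ.ren C.tyIn) (C.inside t) u)) τ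
  -- the fixed point combinator
  | fix {n : ℕ} {G : Ctx S n} {σ : S.Ty n} {f : Tm S n} :
      NoLin G → HasType G f (.lolli (.bang σ) σ) →
      ExtEq G (.app f (.bang (.app (.tapp .Y σ) (.bang f)))) (.app (.tapp .Y σ) (.bang f)) σ

/-! ## Propositions and definable relations -/

mutual
/-- Raw propositions with `n` type variables.  Term variables and relation variables are de Bruijn
indices; the flag of a relation quantifier tells whether it ranges over admissible relations. -/
inductive Fm (S : Sig.{u, v}) : ℕ → Type (max u v)
  | eq {n : ℕ} (σ : S.Ty n) (t u : Tm S n) : Fm S n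
  | rel {n : ℕ} (ρ : RelE S n) (t u : Tm S n) : Fm S n
  | imp {n : ℕ} (φ ψ : Fm S n) : Fm S n
  | bot {n : ℕ} : Fm S n
  | top {n : ℕ} : Fm S n
  | and {n : ℕ} (φ ψ : Fm S n) : Fm S n
  | or {n : ℕ} (φ ψ : Fm S n) : Fm S n
  | allT {n : ℕ} (φ : Fm S (n + 1)) : Fm S n
  | allX {n : ℕ} (σ : S.Ty n) (φ : Fm S n) : Fm S n
  | allR {n : ℕ} (adm : Bool) (σ τ : S.Ty n) (φ : Fm S n) : Fm S n
  | exT {n : ℕ} (φ : Fm S (n + 1)) : Fm S n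
  | exX {n : ℕ} (σ : S.Ty n) (φ : Fm S n) : Fm S n
  | exR {n : ℕ} (adm : Bool) (σ τ : S.Ty n) (φ : Fm S n) : Fm S n
/-- Raw definable relations: relation variables, `(x:σ, y:τ). φ` (where `x` has index `1` and `y` has
index `0`), and the relational interpretation `σ[ρ₁, …, ρₖ]` of a type `α₁, …, αₖ ⊢ σ`. -/
inductive RelE (S : Sig.{u, v}) : ℕ → Type (max u v)
  | rvar {n : ℕ} (i : ℕ) : RelE S n
  | abs {n : ℕ} (σ τ : S.Ty n) (φ : Fm S n) : RelE S n
  | interp {n : ℕ} (k : ℕ) (σ : S.Ty k) (ρ : Fin k → RelE S n) : RelE S n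
end

mutual
/-- Renaming of type variables, term variables and relation variables in a proposition. -/
def Fm.ren {S : Sig.{u, v}} :
    {n m : ℕ} → (Fin n → Fin m) → (ℕ → ℕ) → (ℕ → ℕ) → Fm S n → Fm S m
  | _, _, f, r, _, .eq σ t u => .eq (σ.ren f) (t.ren f r) (u.ren f r)
  | _, _, f, r, q, .rel ρ t u => .rel (ρ.ren f r q) (t.ren f r) (u.ren f r)
  | _, _, f, r, q, .imp φ ψ => .imp (φ.ren f r q) (ψ.ren f r q)
  | _, _, _, _, _, .bot => .bot
  | _, _, _, _, _, .top => .top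
  | _, _, f, r, q, .and φ ψ => .and (φ.ren f r q) (ψ.ren f r q)
  | _, _, f, r, q, .or φ ψ => .or (φ.ren f r q) (ψ.ren f r q)
  | _, _, f, r, q, .allT φ => .allT (φ.ren (liftRen f) r q)
  | _, _, f, r, q, .allX σ φ => .allX (σ.ren f) (φ.ren f (liftIdx r) q)
  | _, _, f, r, q, .allR b σ τ φ => .allR b (σ.ren f) (τ.ren f) (φ.ren f r (liftIdx q))
  | _, _, f, r, q, .exT φ => .exT (φ.ren (liftRen f) r q)
  | _, _, f, r, q, .exX σ φ => .exX (σ.ren f) (φ.ren f (liftIdx r) q)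
  | _, _, f, r, q, .exR b σ τ φ => .exR b (σ.ren f) (τ.ren f) (φ.ren f r (liftIdx q))
/-- Renaming in a definable relation. -/
def RelE.ren {S : Sig.{u, v}} :
    {n m : ℕ} → (Fin n → Fin m) → (ℕ → ℕ) → (ℕ → ℕ) → RelE S n → RelE S m
  | _, _, _, _, q, .rvar i => .rvar (q i)
  | _, _, f, r, q, .abs σ τ φ =>
      .abs (σ.ren f) (τ.ren f) (φ.ren f (liftIdx (liftIdx r)) q)
  | _, _, f, r, q, .interp k σ ρ => .interp k σ (fun i => (ρ i).ren f r q)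
end

/-- Weakening by `k` term variables. -/
def RelE.up {S : Sig.{u, v}} {n : ℕ} (k : ℕ) (ρ : RelE S n) : RelE S n := ρ.ren id (· + k) id

/-- Weakening of a proposition by `k` term variables. -/
def Fm.up {S : Sig.{u, v}} {n : ℕ} (k : ℕ) (φ : Fm S n) : Fm S n := φ.ren id (· + k) id

/-- Weakening by one type variable. -/
def RelE.tup {S : Sig.{u, v}} {n : ℕ} (ρ : RelE S n) : RelE S (n + 1) := ρ.ren Fin.succ id id

/-- Weakening of a proposition by one type variable. -/
def Fm.tup {S : Sig.{u, v}} {n : ℕ} (φ : Fm S n) : Fm S (n + 1) := φ.ren Fin.succ id id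

/-- Weakening by one relation variable. -/
def RelE.rup {S : Sig.{u, v}} {n : ℕ} (ρ : RelE S n) : RelE S n := ρ.ren id id (· + 1)

/-- Weakening of a proposition by one relation variable. -/
def Fm.rup {S : Sig.{u, v}} {n : ℕ} (φ : Fm S n) : Fm S n := φ.ren id id (· + 1)

/-- The lift of a substitution for relation variables under a binder. -/
def liftRel {S : Sig.{u, v}} {n : ℕ} (s : ℕ → RelE S n) : ℕ → RelE S n
  | 0 => .rvar 0
  | i + 1 => (s i).rup

mutual
/-- Simultaneous substitution of types (by `a`), terms (by `s`) and definable relations (by `q`). -/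
def Fm.sub {S : Sig.{u, v}} :
    {n m : ℕ} → (Fin n → S.Ty m) → (ℕ → Tm S m) → (ℕ → RelE S m) → Fm S n → Fm S m
  | _, _, a, s, _, .eq σ t u => .eq (σ.sub a) (t.sub a s) (u.sub a s)
  | _, _, a, s, q, .rel ρ t u => .rel (ρ.sub a s q) (t.sub a s) (u.sub a s)
  | _, _, a, s, q, .imp φ ψ => .imp (φ.sub a s q) (ψ.sub a s q)
  | _, _, _, _, _, .bot => .bot
  | _, _, _, _, _, .top => .top
  | _, _, a, s, q, .and φ ψ => .and (φ.sub a s q) (ψ.sub a s q)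
  | _, _, a, s, q, .or φ ψ => .or (φ.sub a s q) (ψ.sub a s q)
  | _, _, a, s, q, .allT φ =>
      .allT (φ.sub (liftTy a) (fun i => (s i).tup) (fun i => (q i).tup))
  | _, _, a, s, q, .allX σ φ => .allX (σ.sub a) (φ.sub a (liftTm s) (fun i => (q i).up 1))
  | _, _, a, s, q, .allR b σ τ φ => .allR b (σ.sub a) (τ.sub a) (φ.sub a s (liftRel q))
  | _, _, a, s, q, .exT φ =>
      .exT (φ.sub (liftTy a) (fun i => (s i).tup) (fun i => (q i).tup))
  | _, _, a, s, q, .exX σ φ => .exX (σ.sub a) (φ.sub a (liftTm s) (fun i => (q i).up 1))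
  | _, _, a, s, q, .exR b σ τ φ => .exR b (σ.sub a) (τ.sub a) (φ.sub a s (liftRel q))
/-- Simultaneous substitution in a definable relation. -/
def RelE.sub {S : Sig.{u, v}} :
    {n m : ℕ} → (Fin n → S.Ty m) → (ℕ → Tm S m) → (ℕ → RelE S m) → RelE S n → RelE S m
  | _, _, _, _, q, .rvar i => q i
  | _, _, a, s, q, .abs σ τ φ =>
      .abs (σ.sub a) (τ.sub a) (φ.sub a (liftTm (liftTm s)) (fun i => (q i).up 2))
  | _, _, a, s, q, .interp k σ ρ => .interp k σ (fun i => (ρ i).sub a s q)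
end

/-- Biimplication. -/
def Fm.iff {S : Sig.{u, v}} {n : ℕ} (φ ψ : Fm S n) : Fm S n := .and (.imp φ ψ) (.imp ψ φ)

/-- `ρ ≡ ρ'`, for relations between `σ` and `τ`. -/
def Fm.equiv {S : Sig.{u, v}} {n : ℕ} (σ τ : S.Ty n) (ρ ρ' : RelE S n) : Fm S n :=
  .allX σ (.allX τ (.iff (.rel (ρ.up 2) (.var 1) (.var 0)) (.rel (ρ'.up 2) (.var 1) (.var 0))))

/-- Quantification over all type variables. -/
def Fm.allTys {S : Sig.{u, v}} : (k : ℕ) → Fm S k → Fm S 0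
  | 0, φ => φ
  | k + 1, φ => Fm.allTys k (.allT φ)

/-! ## Constructions on definable relations -/

/-- The graph `⟨f⟩` of `f : σ ⊸ τ`. -/
def RelE.graph {S : Sig.{u, v}} {n : ℕ} (σ τ : S.Ty n) (f : Tm S n) : RelE S n :=
  .abs σ τ (.eq τ (.app (f.up 2) (.var 1)) (.var 0))

/-- The relation `eq_σ`, the graph of the identity. -/
def RelE.eqr {S : Sig.{u, v}} {n : ℕ} (σ : S.Ty n) : RelE S n := .graph σ σ (.idt σ)

/-- The reindexing `(f, g)^* ρ`, for `f` with domain `σ` and `g` with domain `τ`. -/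
def RelE.pull {S : Sig.{u, v}} {n : ℕ} (σ τ : S.Ty n) (f g : Tm S n) (ρ : RelE S n) : RelE S n :=
  .abs σ τ (.rel (ρ.up 2) (.app (f.up 2) (.var 1)) (.app (g.up 2) (.var 0)))

/-- `ρ ⊸ ρ'`, for `ρ` between `σ` and `τ` and `ρ'` between `σ'` and `τ'`. -/
def RelE.lolli {S : Sig.{u, v}} {n : ℕ} (σ τ σ' τ' : S.Ty n) (ρ ρ' : RelE S n) : RelE S n :=
  .abs (.lolli σ σ') (.lolli τ τ') (.allX σ (.allX τ (.imp
    (.rel (ρ.up 4) (.var 1) (.var 0))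
    (.rel (ρ'.up 4) (.app (.var 3) (.var 1)) (.app (.var 2) (.var 0))))))

/-- `ρ → ρ'`, for `ρ` between `σ` and `τ` and `ρ'` between `σ'` and `τ'`. -/
def RelE.arr {S : Sig.{u, v}} {n : ℕ} (σ τ σ' τ' : S.Ty n) (ρ ρ' : RelE S n) : RelE S n :=
  .abs (.arr σ σ') (.arr τ τ') (.allX σ (.allX τ (.imp
    (.rel (ρ.up 4) (.var 1) (.var 0))
    (.rel (ρ'.up 4) (.app (.var 3) (.bang (.var 1))) (.app (.var 2) (.bang (.var 0)))))))

/-- `∀(α, β, R : Adm(α, β)). ρ`.  Here `σ` depends on `α`, `τ` depends on `β`, and `ρ` depends on `α`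
(type variable `1`), `β` (type variable `0`) and `R` (relation variable `0`). -/
def RelE.all {S : Sig.{u, v}} {n : ℕ} (σ τ : S.Ty (n + 1)) (ρ : RelE S (n + 2)) : RelE S n :=
  .abs (.pi σ) (.pi τ) (.allT (.allT (.allR true (.var 1) (.var 0)
    (.rel (ρ.up 2) (.tapp (.var 1) (.var 1)) (.tapp (.var 0) (.var 0))))))

/-- A relation weakened by the variables `α, β, R`. -/
def RelE.wk3 {S : Sig.{u, v}} {n : ℕ} (ρ : RelE S n) : RelE S (n + 2) :=
  ρ.ren (fun i => i.succ.succ) id (· + 1)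

/-- The map `σ ⊗ σ' ⊸ ∏α. (σ ⊸ σ' ⊸ α) ⊸ α`. -/
def tensorMap {S : Sig.{u, v}} {n : ℕ} (σ σ' : S.Ty n) : Tm S n :=
  .lam (.tensor σ σ') (.letT σ σ' (.var 0) (.tlam
    (.lam (.lolli σ.wk (.lolli σ'.wk (.var 0)))
      (.app (.app (.var 0) (.var 2)) (.var 1)))))

/-- `ρ ⊗ ρ'`, for `ρ` between `σ` and `τ` and `ρ'` between `σ'` and `τ'`. -/
def RelE.tensor {S : Sig.{u, v}} {n : ℕ} (σ τ σ' τ' : S.Ty n) (ρ ρ' : RelE S n) : RelE S n :=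
  .pull (.tensor σ σ') (.tensor τ τ') (tensorMap σ σ') (tensorMap τ τ')
    (.all (.lolli (.lolli σ.wk (.lolli σ'.wk (.var 0))) (.var 0))
      (.lolli (.lolli τ.wk (.lolli τ'.wk (.var 0))) (.var 0))
      (.lolli
        (.lolli σ.wk.wk (.lolli σ'.wk.wk (.var 1))) (.lolli τ.wk.wk (.lolli τ'.wk.wk (.var 0)))
        (.var 1) (.var 0)
        (.lolli σ.wk.wk τ.wk.wk (.lolli σ'.wk.wk (.var 1)) (.lolli τ'.wk.wk (.var 0)) ρ.wk3
          (.lolli σ'.wk.wk τ'.wk.wk (.var 1) (.var 0) ρ'.wk3 (.rvar 0)))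
        (.rvar 0)))

/-- The map `I ⊸ ∏α. α ⊸ α`. -/
def oneMap {S : Sig.{u, v}} {n : ℕ} : Tm S n :=
  .lam .one (.letS (.var 0) (.tlam (.lam (.var 0) (.var 0))))

/-- The relation `I_Rel` on `I`. -/
def RelE.one {S : Sig.{u, v}} {n : ℕ} : RelE S n :=
  .pull .one .one oneMap oneMap
    (.all (.lolli (.var 0) (.var 0)) (.lolli (.var 0) (.var 0))
      (.lolli (.var 1) (.var 0) (.var 1) (.var 0) (.rvar 0) (.rvar 0)))

/-- The map `!σ ⊸ ∏α. (σ → α) ⊸ α`. -/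
def bangMap {S : Sig.{u, v}} {n : ℕ} (σ : S.Ty n) : Tm S n :=
  .lam (.bang σ) (.tlam (.lam (.arr σ.wk (.var 0)) (.app (.var 0) (.var 1))))

/-- `!ρ`, for `ρ` between `σ` and `τ`. -/
def RelE.bang {S : Sig.{u, v}} {n : ℕ} (σ τ : S.Ty n) (ρ : RelE S n) : RelE S n :=
  .pull (.bang σ) (.bang τ) (bangMap σ) (bangMap τ)
    (.all (.lolli (.arr σ.wk (.var 0)) (.var 0)) (.lolli (.arr τ.wk (.var 0)) (.var 0))
      (.lolli (.arr σ.wk.wk (.var 1)) (.arr τ.wk.wk (.var 0)) (.var 1) (.var 0)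
        (.arr σ.wk.wk τ.wk.wk (.var 1) (.var 0) ρ.wk3 (.rvar 0))
        (.rvar 0)))

/-! ## The logic -/

/-- A declaration `R : Rel(σ, τ)` (`adm = false`) or `S : Adm(σ, τ)` (`adm = true`) of a
relation variable. -/
structure RDecl (S : Sig.{u, v}) (n : ℕ) where
  adm : Bool
  dom : S.Ty n
  cod : S.Ty n

/-- Weakening by one type variable. -/
def RDecl.wk {S : Sig.{u, v}} {n : ℕ} (d : RDecl S n) : RDecl S (n + 1) :=
  ⟨d.adm, d.dom.wk, d.cod.wk⟩

/-- A proposition in context `Ξ | Γ | Θ`. -/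
structure FmCtx (S : Sig.{u, v}) where
  n : ℕ
  vars : List (S.Ty n)
  rels : List (RDecl S n)
  fm : Fm S n

/-- A collection of non-logical assumptions (an axiom scheme, for instance): propositions in
context. -/
abbrev Theory (S : Sig.{u, v}) := Set (FmCtx S)

mutual
/-- The judgements `Ξ | Γ | Θ ⊢ ρ : Rel(σ, τ)` (flag `false`) and `Ξ | Γ | Θ ⊢ ρ : Adm(σ, τ)`
(flag `true`). -/
inductive IsRel {S : Sig.{u, v}} (T : Theory S) : Bool → {n : ℕ} → List (S.Ty n) →
    List (RDecl S n) → RelE S n → S.Ty n → S.Ty n → Prop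
  | rvar {n : ℕ} {Γ : List (S.Ty n)} {Θ : List (RDecl S n)} {i : ℕ} {b : Bool} {σ τ : S.Ty n} :
      Θ[i]? = some ⟨b, σ, τ⟩ → IsRel T b Γ Θ (.rvar i) σ τ
  | abs {n : ℕ} {Γ : List (S.Ty n)} {Θ : List (RDecl S n)} {σ τ : S.Ty n} {φ : Fm S n} :
      IsFm T (τ :: σ :: Γ) Θ φ → IsRel T false Γ Θ (.abs σ τ φ) σ τ
  | ofAdm {n : ℕ} {Γ : List (S.Ty n)} {Θ : List (RDecl S n)} {ρ : RelE S n} {σ τ : S.Ty n} :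
      IsRel T true Γ Θ ρ σ τ → IsRel T false Γ Θ ρ σ τ
  | eqr {n : ℕ} {Γ : List (S.Ty n)} {Θ : List (RDecl S n)} (σ : S.Ty n) :
      IsRel T true Γ Θ (.eqr σ) σ σ
  | pull {n : ℕ} {Γ : List (S.Ty n)} {Θ : List (RDecl S n)} {ρ : RelE S n} {σ τ σ' τ' : S.Ty n}
      {t u : Tm S n} : IsRel T true Γ Θ ρ σ τ →
      HasType (intCtx Γ) t (.lolli σ' σ) → HasType (intCtx Γ) u (.lolli τ' τ) →
      IsRel T true Γ Θ (.pull σ' τ' t u ρ) σ' τ'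
  | and {n : ℕ} {Γ : List (S.Ty n)} {Θ : List (RDecl S n)} {ρ ρ' : RelE S n} {σ τ : S.Ty n} :
      IsRel T true Γ Θ ρ σ τ → IsRel T true Γ Θ ρ' σ τ →
      IsRel T true Γ Θ (.abs σ τ (.and (.rel (ρ.up 2) (.var 1) (.var 0))
        (.rel (ρ'.up 2) (.var 1) (.var 0)))) σ τ
  | op {n : ℕ} {Γ : List (S.Ty n)} {Θ : List (RDecl S n)} {ρ : RelE S n} {σ τ : S.Ty n} :
      IsRel T true Γ Θ ρ σ τ →
      IsRel T true Γ Θ (.abs τ σ (.rel (ρ.up 2) (.var 0) (.var 1))) τ σ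
  | top {n : ℕ} {Γ : List (S.Ty n)} {Θ : List (RDecl S n)} (σ τ : S.Ty n) :
      IsRel T true Γ Θ (.abs σ τ .top) σ τ
  | imp {n : ℕ} {Γ : List (S.Ty n)} {Θ : List (RDecl S n)} {ρ : RelE S n} {σ τ : S.Ty n}
      {φ : Fm S n} : IsRel T true Γ Θ ρ σ τ → IsFm T Γ Θ φ →
      IsRel T true Γ Θ (.abs σ τ (.imp (φ.up 2) (.rel (ρ.up 2) (.var 1) (.var 0)))) σ τ
  | allT {n : ℕ} {Γ : List (S.Ty n)} {Θ : List (RDecl S n)} {ρ : RelE S (n + 1)} {σ τ : S.Ty n} :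
      IsRel T true (Γ.map Ty.wk) (Θ.map RDecl.wk) ρ σ.wk τ.wk →
      IsRel T true Γ Θ (.abs σ τ (.allT (.rel (ρ.up 2) (.var 1) (.var 0)))) σ τ
  | allX {n : ℕ} {Γ : List (S.Ty n)} {Θ : List (RDecl S n)} {ρ : RelE S n} {σ τ ω : S.Ty n} :
      IsRel T true (ω :: Γ) Θ ρ σ τ →
      IsRel T true Γ Θ (.abs σ τ (.allX ω
        (.rel (ρ.ren id (liftIdx (· + 2)) id) (.var 2) (.var 1)))) σ τ
  | allR {n : ℕ} {Γ : List (S.Ty n)} {Θ : List (RDecl S n)} {ρ : RelE S n} {σ τ ω ω' : S.Ty n}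
      {b : Bool} : IsRel T true Γ (⟨b, ω, ω'⟩ :: Θ) ρ σ τ →
      IsRel T true Γ Θ (.abs σ τ (.allR b ω ω' (.rel (ρ.up 2) (.var 1) (.var 0)))) σ τ
  | congr {n : ℕ} {Γ : List (S.Ty n)} {Θ : List (RDecl S n)} {ρ ρ' : RelE S n} {σ τ : S.Ty n} :
      IsRel T true Γ Θ ρ σ τ → IsRel T false Γ Θ ρ' σ τ →
      Proves T Γ Θ [] (.equiv σ τ ρ ρ') → IsRel T true Γ Θ ρ' σ τ
  | interp {n : ℕ} {Γ : List (S.Ty n)} {Θ : List (RDecl S n)} {k : ℕ} (σ : S.Ty k)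
      {ρ : Fin k → RelE S n} {τ τ' : Fin k → S.Ty n} :
      (∀ i, IsRel T true Γ Θ (ρ i) (τ i) (τ' i)) →
      IsRel T true Γ Θ (.interp k σ ρ) (σ.sub τ) (σ.sub τ')

/-- The judgement `Ξ | Γ | Θ ⊢ φ : Prop`. -/
inductive IsFm {S : Sig.{u, v}} (T : Theory S) :
    {n : ℕ} → List (S.Ty n) → List (RDecl S n) → Fm S n → Prop
  | eq {n : ℕ} {Γ : List (S.Ty n)} {Θ : List (RDecl S n)} {σ : S.Ty n} {t u : Tm S n} :
      HasType (intCtx Γ) t σ → HasType (intCtx Γ) u σ → IsFm T Γ Θ (.eq σ t u)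
  | rel {n : ℕ} {Γ : List (S.Ty n)} {Θ : List (RDecl S n)} {ρ : RelE S n} {σ τ : S.Ty n}
      {t u : Tm S n} : IsRel T false Γ Θ ρ σ τ →
      HasType (intCtx Γ) t σ → HasType (intCtx Γ) u τ → IsFm T Γ Θ (.rel ρ t u)
  | imp {n : ℕ} {Γ : List (S.Ty n)} {Θ : List (RDecl S n)} {φ ψ : Fm S n} :
      IsFm T Γ Θ φ → IsFm T Γ Θ ψ → IsFm T Γ Θ (.imp φ ψ)
  | bot {n : ℕ} {Γ : List (S.Ty n)} {Θ : List (RDecl S n)} : IsFm T Γ Θ .bot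
  | top {n : ℕ} {Γ : List (S.Ty n)} {Θ : List (RDecl S n)} : IsFm T Γ Θ .top
  | and {n : ℕ} {Γ : List (S.Ty n)} {Θ : List (RDecl S n)} {φ ψ : Fm S n} :
      IsFm T Γ Θ φ → IsFm T Γ Θ ψ → IsFm T Γ Θ (.and φ ψ)
  | or {n : ℕ} {Γ : List (S.Ty n)} {Θ : List (RDecl S n)} {φ ψ : Fm S n} :
      IsFm T Γ Θ φ → IsFm T Γ Θ ψ → IsFm T Γ Θ (.or φ ψ)
  | allT {n : ℕ} {Γ : List (S.Ty n)} {Θ : List (RDecl S n)} {φ : Fm S (n + 1)} :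
      IsFm T (Γ.map Ty.wk) (Θ.map RDecl.wk) φ → IsFm T Γ Θ (.allT φ)
  | allX {n : ℕ} {Γ : List (S.Ty n)} {Θ : List (RDecl S n)} {σ : S.Ty n} {φ : Fm S n} :
      IsFm T (σ :: Γ) Θ φ → IsFm T Γ Θ (.allX σ φ)
  | allR {n : ℕ} {Γ : List (S.Ty n)} {Θ : List (RDecl S n)} {b : Bool} {σ τ : S.Ty n}
      {φ : Fm S n} : IsFm T Γ (⟨b, σ, τ⟩ :: Θ) φ → IsFm T Γ Θ (.allR b σ τ φ)
  | exT {n : ℕ} {Γ : List (S.Ty n)} {Θ : List (RDecl S n)} {φ : Fm S (n + 1)} :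
      IsFm T (Γ.map Ty.wk) (Θ.map RDecl.wk) φ → IsFm T Γ Θ (.exT φ)
  | exX {n : ℕ} {Γ : List (S.Ty n)} {Θ : List (RDecl S n)} {σ : S.Ty n} {φ : Fm S n} :
      IsFm T (σ :: Γ) Θ φ → IsFm T Γ Θ (.exX σ φ)
  | exR {n : ℕ} {Γ : List (S.Ty n)} {Θ : List (RDecl S n)} {b : Bool} {σ τ : S.Ty n}
      {φ : Fm S n} : IsFm T Γ (⟨b, σ, τ⟩ :: Θ) φ → IsFm T Γ Θ (.exR b σ τ φ)

/-- The judgement `Ξ | Γ | Θ | Φ ⊢ ψ`, in the logic extended by the assumptions in `T`. -/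
inductive Proves {S : Sig.{u, v}} (T : Theory S) : {n : ℕ} → List (S.Ty n) →
    List (RDecl S n) → List (Fm S n) → Fm S n → Prop
  -- the non-logical assumptions
  | ax {n : ℕ} {Γ : List (S.Ty n)} {Θ : List (RDecl S n)} {φ : Fm S n} :
      (⟨n, Γ, Θ, φ⟩ : FmCtx S) ∈ T → IsFm T Γ Θ φ → Proves T Γ Θ [] φ
  -- predicate logic
  | hyp {n : ℕ} {Γ : List (S.Ty n)} {Θ : List (RDecl S n)} {Φ : List (Fm S n)} {ψ : Fm S n} :
      (∀ χ ∈ Φ, IsFm T Γ Θ χ) → ψ ∈ Φ → Proves T Γ Θ Φ ψ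
  | weak {n : ℕ} {Γ : List (S.Ty n)} {Θ : List (RDecl S n)} {Φ Φ' : List (Fm S n)} {ψ : Fm S n} :
      Φ ⊆ Φ' → (∀ χ ∈ Φ', IsFm T Γ Θ χ) → Proves T Γ Θ Φ ψ → Proves T Γ Θ Φ' ψ
  | topI {n : ℕ} {Γ : List (S.Ty n)} {Θ : List (RDecl S n)} : Proves T Γ Θ [] .top
  | botE {n : ℕ} {Γ : List (S.Ty n)} {Θ : List (RDecl S n)} {Φ : List (Fm S n)} {ψ : Fm S n} :
      Proves T Γ Θ Φ .bot → IsFm T Γ Θ ψ → Proves T Γ Θ Φ ψ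
  | andI {n : ℕ} {Γ : List (S.Ty n)} {Θ : List (RDecl S n)} {Φ : List (Fm S n)} {φ ψ : Fm S n} :
      Proves T Γ Θ Φ φ → Proves T Γ Θ Φ ψ → Proves T Γ Θ Φ (.and φ ψ)
  | andE₁ {n : ℕ} {Γ : List (S.Ty n)} {Θ : List (RDecl S n)} {Φ : List (Fm S n)} {φ ψ : Fm S n} :
      Proves T Γ Θ Φ (.and φ ψ) → Proves T Γ Θ Φ φ
  | andE₂ {n : ℕ} {Γ : List (S.Ty n)} {Θ : List (RDecl S n)} {Φ : List (Fm S n)} {φ ψ : Fm S n} :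
      Proves T Γ Θ Φ (.and φ ψ) → Proves T Γ Θ Φ ψ
  | orI₁ {n : ℕ} {Γ : List (S.Ty n)} {Θ : List (RDecl S n)} {Φ : List (Fm S n)} {φ ψ : Fm S n} :
      Proves T Γ Θ Φ φ → IsFm T Γ Θ ψ → Proves T Γ Θ Φ (.or φ ψ)
  | orI₂ {n : ℕ} {Γ : List (S.Ty n)} {Θ : List (RDecl S n)} {Φ : List (Fm S n)} {φ ψ : Fm S n} :
      IsFm T Γ Θ φ → Proves T Γ Θ Φ ψ → Proves T Γ Θ Φ (.or φ ψ)
  | orE {n : ℕ} {Γ : List (S.Ty n)} {Θ : List (RDecl S n)} {Φ : List (Fm S n)}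
      {φ ψ χ : Fm S n} : Proves T Γ Θ Φ (.or φ ψ) → Proves T Γ Θ (φ :: Φ) χ →
      Proves T Γ Θ (ψ :: Φ) χ → Proves T Γ Θ Φ χ
  | impI {n : ℕ} {Γ : List (S.Ty n)} {Θ : List (RDecl S n)} {Φ : List (Fm S n)} {φ ψ : Fm S n} :
      Proves T Γ Θ (φ :: Φ) ψ → Proves T Γ Θ Φ (.imp φ ψ)
  | impE {n : ℕ} {Γ : List (S.Ty n)} {Θ : List (RDecl S n)} {Φ : List (Fm S n)} {φ ψ : Fm S n} :
      Proves T Γ Θ Φ (.imp φ ψ) → Proves T Γ Θ Φ φ → Proves T Γ Θ Φ ψ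
  | allTI {n : ℕ} {Γ : List (S.Ty n)} {Θ : List (RDecl S n)} {Φ : List (Fm S n)}
      {ψ : Fm S (n + 1)} : (∀ χ ∈ Φ, IsFm T Γ Θ χ) →
      Proves T (Γ.map Ty.wk) (Θ.map RDecl.wk) (Φ.map Fm.tup) ψ → Proves T Γ Θ Φ (.allT ψ)
  | allTE {n : ℕ} {Γ : List (S.Ty n)} {Θ : List (RDecl S n)} {Φ : List (Fm S n)}
      {ψ : Fm S (n + 1)} : Proves T Γ Θ Φ (.allT ψ) →
      Proves T (Γ.map Ty.wk) (Θ.map RDecl.wk) (Φ.map Fm.tup) ψ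
  | allXI {n : ℕ} {Γ : List (S.Ty n)} {Θ : List (RDecl S n)} {Φ : List (Fm S n)} {σ : S.Ty n}
      {ψ : Fm S n} : (∀ χ ∈ Φ, IsFm T Γ Θ χ) →
      Proves T (σ :: Γ) Θ (Φ.map (Fm.up 1)) ψ → Proves T Γ Θ Φ (.allX σ ψ)
  | allXE {n : ℕ} {Γ : List (S.Ty n)} {Θ : List (RDecl S n)} {Φ : List (Fm S n)} {σ : S.Ty n}
      {ψ : Fm S n} : Proves T Γ Θ Φ (.allX σ ψ) → Proves T (σ :: Γ) Θ (Φ.map (Fm.up 1)) ψ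
  | allRI {n : ℕ} {Γ : List (S.Ty n)} {Θ : List (RDecl S n)} {Φ : List (Fm S n)} {b : Bool}
      {σ τ : S.Ty n} {ψ : Fm S n} : (∀ χ ∈ Φ, IsFm T Γ Θ χ) →
      Proves T Γ (⟨b, σ, τ⟩ :: Θ) (Φ.map Fm.rup) ψ → Proves T Γ Θ Φ (.allR b σ τ ψ)
  | allRE {n : ℕ} {Γ : List (S.Ty n)} {Θ : List (RDecl S n)} {Φ : List (Fm S n)} {b : Bool}
      {σ τ : S.Ty n} {ψ : Fm S n} : Proves T Γ Θ Φ (.allR b σ τ ψ) →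
      Proves T Γ (⟨b, σ, τ⟩ :: Θ) (Φ.map Fm.rup) ψ
  | exTE {n : ℕ} {Γ : List (S.Ty n)} {Θ : List (RDecl S n)} {Φ : List (Fm S n)}
      {φ : Fm S (n + 1)} {ψ : Fm S n} : (∀ χ ∈ Φ, IsFm T Γ Θ χ) → IsFm T Γ Θ ψ →
      Proves T (Γ.map Ty.wk) (Θ.map RDecl.wk) (φ :: Φ.map Fm.tup) ψ.tup →
      Proves T Γ Θ (.exT φ :: Φ) ψ
  | exTI {n : ℕ} {Γ : List (S.Ty n)} {Θ : List (RDecl S n)} {Φ : List (Fm S n)}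
      {φ : Fm S (n + 1)} {ψ : Fm S n} : Proves T Γ Θ (.exT φ :: Φ) ψ →
      Proves T (Γ.map Ty.wk) (Θ.map RDecl.wk) (φ :: Φ.map Fm.tup) ψ.tup
  | exXE {n : ℕ} {Γ : List (S.Ty n)} {Θ : List (RDecl S n)} {Φ : List (Fm S n)} {σ : S.Ty n}
      {φ ψ : Fm S n} : (∀ χ ∈ Φ, IsFm T Γ Θ χ) → IsFm T Γ Θ ψ →
      Proves T (σ :: Γ) Θ (φ :: Φ.map (Fm.up 1)) (ψ.up 1) → Proves T Γ Θ (.exX σ φ :: Φ) ψ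
  | exXI {n : ℕ} {Γ : List (S.Ty n)} {Θ : List (RDecl S n)} {Φ : List (Fm S n)} {σ : S.Ty n}
      {φ ψ : Fm S n} : Proves T Γ Θ (.exX σ φ :: Φ) ψ →
      Proves T (σ :: Γ) Θ (φ :: Φ.map (Fm.up 1)) (ψ.up 1)
  | exRE {n : ℕ} {Γ : List (S.Ty n)} {Θ : List (RDecl S n)} {Φ : List (Fm S n)} {b : Bool}
      {σ τ : S.Ty n} {φ ψ : Fm S n} : (∀ χ ∈ Φ, IsFm T Γ Θ χ) → IsFm T Γ Θ ψ →
      Proves T Γ (⟨b, σ, τ⟩ :: Θ) (φ :: Φ.map Fm.rup) ψ.rup →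
      Proves T Γ Θ (.exR b σ τ φ :: Φ) ψ
  | exRI {n : ℕ} {Γ : List (S.Ty n)} {Θ : List (RDecl S n)} {Φ : List (Fm S n)} {b : Bool}
      {σ τ : S.Ty n} {φ ψ : Fm S n} : Proves T Γ Θ (.exR b σ τ φ :: Φ) ψ →
      Proves T Γ (⟨b, σ, τ⟩ :: Θ) (φ :: Φ.map Fm.rup) ψ.rup
  /-- Simultaneous substitution of types, terms, relations for relation variables, and
  admissible relations for admissible relation variables.  It combines the four single
  substitution rules with weakening and permutation of the contexts. -/
  | sub {n m : ℕ} {Γ : List (S.Ty n)} {Θ : List (RDecl S n)} {Φ : List (Fm S n)} {ψ : Fm S n}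
      {Γ' : List (S.Ty m)} {Θ' : List (RDecl S m)}
      (a : Fin n → S.Ty m) (s : ℕ → Tm S m) (q : ℕ → RelE S m) :
      (∀ i σ, Γ[i]? = some σ → HasType (intCtx Γ') (s i) (σ.sub a)) →
      (∀ i b σ τ, Θ[i]? = some ⟨b, σ, τ⟩ → IsRel T b Γ' Θ' (q i) (σ.sub a) (τ.sub a)) →
      Proves T Γ Θ Φ ψ → Proves T Γ' Θ' (Φ.map (Fm.sub a s q)) (ψ.sub a s q)
  -- internal equality, with the substitution axiom in instantiated form
  | exteq {n : ℕ} {Γ : List (S.Ty n)} {Θ : List (RDecl S n)} {σ : S.Ty n} {t u : Tm S n} :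
      HasType (intCtx Γ) t σ → HasType (intCtx Γ) u σ → ExtEq (intCtx Γ) t u σ →
      Proves T Γ Θ [] (.eq σ t u)
  | eqSymm {n : ℕ} {Γ : List (S.Ty n)} {Θ : List (RDecl S n)} {Φ : List (Fm S n)} {σ : S.Ty n}
      {t u : Tm S n} : Proves T Γ Θ Φ (.eq σ t u) → Proves T Γ Θ Φ (.eq σ u t)
  | eqTrans {n : ℕ} {Γ : List (S.Ty n)} {Θ : List (RDecl S n)} {Φ : List (Fm S n)} {σ : S.Ty n}
      {t u w : Tm S n} : Proves T Γ Θ Φ (.eq σ t u) → Proves T Γ Θ Φ (.eq σ u w) →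
      Proves T Γ Θ Φ (.eq σ t w)
  | eqSubst {n : ℕ} {Γ : List (S.Ty n)} {Θ : List (RDecl S n)} {Φ : List (Fm S n)}
      {ρ : RelE S n} {σ τ : S.Ty n} {t t' u u' : Tm S n} : IsRel T false Γ Θ ρ σ τ →
      Proves T Γ Θ Φ (.rel ρ t u) → Proves T Γ Θ Φ (.eq σ t t') → Proves T Γ Θ Φ (.eq τ u u') →
      Proves T Γ Θ Φ (.rel ρ t' u')
  -- the relational interpretation of types
  | interpVar {n : ℕ} {Γ : List (S.Ty n)} {Θ : List (RDecl S n)} {k : ℕ} {ρ : Fin k → RelE S n}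
      {τ τ' : Fin k → S.Ty n} (i : Fin k) : (∀ i, IsRel T true Γ Θ (ρ i) (τ i) (τ' i)) →
      Proves T Γ Θ [] (.equiv (τ i) (τ' i) (.interp k (.var i) ρ) (ρ i))
  | interpLolli {n : ℕ} {Γ : List (S.Ty n)} {Θ : List (RDecl S n)} {k : ℕ} {ρ : Fin k → RelE S n}
      {τ τ' : Fin k → S.Ty n} (σ σ' : S.Ty k) : (∀ i, IsRel T true Γ Θ (ρ i) (τ i) (τ' i)) →
      Proves T Γ Θ [] (.equiv ((Ty.lolli σ σ').sub τ) ((Ty.lolli σ σ').sub τ')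
        (.interp k (.lolli σ σ') ρ)
        (.lolli (σ.sub τ) (σ.sub τ') (σ'.sub τ) (σ'.sub τ') (.interp k σ ρ) (.interp k σ' ρ)))
  | interpTensor {n : ℕ} {Γ : List (S.Ty n)} {Θ : List (RDecl S n)} {k : ℕ}
      {ρ : Fin k → RelE S n} {τ τ' : Fin k → S.Ty n} (σ σ' : S.Ty k) :
      (∀ i, IsRel T true Γ Θ (ρ i) (τ i) (τ' i)) →
      Proves T Γ Θ [] (.equiv ((Ty.tensor σ σ').sub τ) ((Ty.tensor σ σ').sub τ')
        (.interp k (.tensor σ σ') ρ)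
        (.tensor (σ.sub τ) (σ.sub τ') (σ'.sub τ) (σ'.sub τ') (.interp k σ ρ) (.interp k σ' ρ)))
  | interpOne {n : ℕ} {Γ : List (S.Ty n)} {Θ : List (RDecl S n)} {k : ℕ} {ρ : Fin k → RelE S n}
      {τ τ' : Fin k → S.Ty n} : (∀ i, IsRel T true Γ Θ (ρ i) (τ i) (τ' i)) →
      Proves T Γ Θ [] (.equiv .one .one (.interp k .one ρ) .one)
  | interpPi {n : ℕ} {Γ : List (S.Ty n)} {Θ : List (RDecl S n)} {k : ℕ} {ρ : Fin k → RelE S n}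
      {τ τ' : Fin k → S.Ty n} (σ : S.Ty (k + 1)) : (∀ i, IsRel T true Γ Θ (ρ i) (τ i) (τ' i)) →
      Proves T Γ Θ [] (.equiv ((Ty.pi σ).sub τ) ((Ty.pi σ).sub τ') (.interp k (.pi σ) ρ)
        (.all (σ.sub (liftTy τ)) (σ.sub (liftTy τ'))
          (.interp (k + 1) σ (Fin.cases (.rvar 0) (fun i => (ρ i).wk3)))))
  | interpBang {n : ℕ} {Γ : List (S.Ty n)} {Θ : List (RDecl S n)} {k : ℕ} {ρ : Fin k → RelE S n}
      {τ τ' : Fin k → S.Ty n} (σ : S.Ty k) : (∀ i, IsRel T true Γ Θ (ρ i) (τ i) (τ' i)) →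
      Proves T Γ Θ [] (.equiv ((Ty.bang σ).sub τ) ((Ty.bang σ).sub τ') (.interp k (.bang σ) ρ)
        (.bang (σ.sub τ) (σ.sub τ') (.interp k σ ρ)))
  /-- The relation `σ[ρ₁/α₁, …, ρₖ/αₖ]` depends neither on the order of the variables nor on
  variables that do not occur in `σ`: with named variables, the two sides denote the same
  relation. -/
  | interpRen {n : ℕ} {Γ : List (S.Ty n)} {Θ : List (RDecl S n)} {k l : ℕ} {ρ : Fin l → RelE S n}
      {τ τ' : Fin l → S.Ty n} (f : Fin k → Fin l) (σ : S.Ty k) : Function.Injective f →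
      (∀ i, IsRel T true Γ Θ (ρ i) (τ i) (τ' i)) →
      Proves T Γ Θ [] (.equiv ((σ.ren f).sub τ) ((σ.ren f).sub τ') (.interp l (σ.ren f) ρ)
        (.interp k σ (fun i => ρ (f i))))
  | defrel {n : ℕ} {Γ : List (S.Ty n)} {Θ : List (RDecl S n)} {σ τ : S.Ty n} {φ : Fm S n}
      {t u : Tm S n} : IsFm T (τ :: σ :: Γ) Θ φ →
      HasType (intCtx Γ) t σ → HasType (intCtx Γ) u τ →
      Proves T Γ Θ [] (.iff (.rel (.abs σ τ φ) t u) (φ.sub .var (inst2 t u) .rvar))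
  | fix {n : ℕ} {Γ : List (S.Ty n)} {Θ : List (RDecl S n)} :
      Proves T Γ Θ [] (.rel (.interp 0 tyY Fin.elim0) .Y .Y)
end

/-- The two extensionality schemes. -/
inductive ExtInst (S : Sig.{u, v}) : FmCtx S → Prop
  | fn {n : ℕ} {Γ : List (S.Ty n)} {Θ : List (RDecl S n)} {σ τ : S.Ty n} {t u : Tm S n} :
      HasType (intCtx Γ) t (.lolli σ τ) → HasType (intCtx Γ) u (.lolli σ τ) →
      ExtInst S ⟨n, Γ, Θ, .imp
        (.allX σ (.eq τ (.app (t.up 1) (.var 0)) (.app (u.up 1) (.var 0))))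
        (.eq (.lolli σ τ) t u)⟩
  | ty {n : ℕ} {Γ : List (S.Ty n)} {Θ : List (RDecl S n)} {τ : S.Ty (n + 1)} {t u : Tm S n} :
      HasType (intCtx Γ) t (.pi τ) → HasType (intCtx Γ) u (.pi τ) →
      ExtInst S ⟨n, Γ, Θ, .imp
        (.allT (.eq τ (.tapp t.tup (.var 0)) (.tapp u.tup (.var 0))))
        (.eq (.pi τ) t u)⟩

/-- The extensionality schemes, as a set of assumptions. -/
def extensionality (S : Sig.{u, v}) : Theory S := {χ | ExtInst S χ}

/-- The identity extension schema `∀α₁ … αₖ. σ[eq_α₁, …, eq_αₖ] ≡ eq_σ`, for all types `σ`. -/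
def identityExtension (S : Sig.{u, v}) : Theory S :=
  {χ | ∃ (k : ℕ) (σ : S.Ty k), χ = ⟨0, [], [], Fm.allTys k
    (.equiv σ σ (.interp k σ (fun i => .eqr (.var i))) (.eqr σ))⟩}

/-! ## Types as functors -/

/-- Inductively constructed types: built from type variables and closed types by the type
constructors of the calculus (but not by type constants applied to open types). -/
inductive IndConstr {K : TySig.{u}} : {n : ℕ} → Ty K n → Prop
  | var {n : ℕ} (i : Fin n) : IndConstr (.var i)
  | closed {n : ℕ} (σ : Ty K 0) : IndConstr (σ.close : Ty K n)
  | one {n : ℕ} : IndConstr (.one : Ty K n)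
  | tensor {n : ℕ} {σ τ : Ty K n} : IndConstr σ → IndConstr τ → IndConstr (.tensor σ τ)
  | lolli {n : ℕ} {σ τ : Ty K n} : IndConstr σ → IndConstr τ → IndConstr (.lolli σ τ)
  | bang {n : ℕ} {σ : Ty K n} : IndConstr σ → IndConstr (.bang σ)
  | pi {n : ℕ} {σ : Ty K (n + 1)} : IndConstr σ → IndConstr (.pi σ)

/-- `σ.Occ p i`: the variable `i` has a positive (`p = true`) or a negative (`p = false`) occurrence
in `σ`. -/
def Ty.Occ {K : TySig.{u}} : {n : ℕ} → Ty K n → Bool → Fin n → Prop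
  | _, .var j, p, i => p = true ∧ i = j
  | _, .con _ a, p, i => ∃ j, (a j).Occ p i
  | _, .one, _, _ => False
  | _, .tensor σ τ, p, i => σ.Occ p i ∨ τ.Occ p i
  | _, .lolli σ τ, p, i => σ.Occ (!p) i ∨ τ.Occ p i
  | _, .bang σ, p, i => σ.Occ p i
  | _, .pi σ, p, i => σ.Occ p i.succ

/-- The action of `σ` on maps: a term of type `σ(s) ⊸ σ(s')`, if `c i : s i ⊸ s' i` for variables `i`
that occur only positively in `σ`, and `c i : s' i ⊸ s i` for variables that occur only negatively.
Bound type variables and closed types are acted on by the identity. -/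
def act {S : Sig.{u, v}} : {k n : ℕ} → S.Ty k → (s s' : Fin k → S.Ty n) → (Fin k → Tm S n) → Tm S n
  | _, _, .var i, _, _, c => c i
  | _, _, .con d a, s, _, _ => .idt ((Ty.con d a).sub s)
  | _, _, .one, _, _, _ => .idt .one
  | _, _, .tensor σ τ, s, s', c =>
      .lam (.tensor (σ.sub s) (τ.sub s)) (.letT (σ.sub s) (τ.sub s) (.var 0)
        (.tensor (.app (act σ s s' (fun i => (c i).up 3)) (.var 1))
          (.app (act τ s s' (fun i => (c i).up 3)) (.var 0))))
  | _, _, .lolli σ τ, s, s', c =>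
      .lam (.lolli (σ.sub s) (τ.sub s)) (.comp (σ.sub s') (act τ s s' (fun i => (c i).up 1))
        (.comp (σ.sub s') (.var 0) (act σ s' s (fun i => (c i).up 1))))
  | _, _, .bang σ, s, s', c =>
      .lam (.bang (σ.sub s)) (.letB (σ.sub s) (.var 0)
        (.bang (.app (act σ s s' (fun i => (c i).up 2)) (.var 0))))
  | _, _, .pi σ, s, s', c =>
      .lam (.pi (σ.sub (liftTy s))) (.tlam
        (.app (act σ (liftTy s) (liftTy s')
          (Fin.cases (.idt (.var 0)) (fun i => ((c i).up 1).tup))) (.tapp (.var 0) (.var 0))))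

/-- The type `σ(τ)`, for `α ⊢ σ`. -/
def Ty.at {K : TySig.{u}} {n : ℕ} (σ : Ty K 1) (τ : Ty K n) : Ty K n := σ.sub (fun _ => τ)

/-- The term `M_σ : ∏α, β. (α ⊸ β) → σ(α) ⊸ σ(β)`, where `α ⊢ σ` and `α` occurs only positively. -/
def functorTm {S : Sig.{u, v}} {n : ℕ} (σ : S.Ty 1) : Tm S n :=
  .tlam (.tlam (.ilam (.lolli (.var 1) (.var 0))
    (act σ (fun _ => .var 1) (fun _ => .var 0) (fun _ => .var 0))))

/-- The term `σ(f) = M_σ τ τ' !f : σ(τ) ⊸ σ(τ')`, for `f : τ ⊸ τ'`. -/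
def mapTm {S : Sig.{u, v}} {n : ℕ} (σ : S.Ty 1) (τ τ' : S.Ty n) (f : Tm S n) : Tm S n :=
  .app (.tapp (.tapp (functorTm σ) τ) τ') (.bang f)

/-- The closed type `μα. σ(α) = ∏α. (σ(α) ⊸ α) → α`. -/
def mu {K : TySig.{u}} {n : ℕ} (σ : Ty K 1) : Ty K n :=
  .pi (.arr (.lolli (σ.at (.var 0)) (.var 0)) (.var 0))

/-- `fold = Λα. λf:σ(α) ⊸ α. λ°u:μα.σ(α). u α !f`. -/
def foldTm {S : Sig.{u, v}} {n : ℕ} (σ : S.Ty 1) : Tm S n :=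
  .tlam (.ilam (.lolli (σ.at (.var 0)) (.var 0))
    (.lam (mu σ) (.app (.tapp (.var 0) (.var 0)) (.bang (.var 1)))))

/-- The term `fold τ !f`. -/
def foldAt {S : Sig.{u, v}} {n : ℕ} (σ : S.Ty 1) (τ : S.Ty n) (f : Tm S n) : Tm S n :=
  .app (.tapp (foldTm σ) τ) (.bang f)

/-- `in = λ°z:σ(μα.σ(α)). Λα. λf:σ(α) ⊸ α. f (σ(fold α !f) z)`. -/
def inTm {S : Sig.{u, v}} {n : ℕ} (σ : S.Ty 1) : Tm S n :=
  .lam (σ.at (mu σ)) (.tlam (.ilam (.lolli (σ.at (.var 0)) (.var 0))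
    (.app (.var 0) (.app (mapTm σ (mu σ) (.var 0) (foldAt σ (.var 0) (.var 0))) (.var 1)))))

/-! ## Facts about renaming, substitution and typing -/

section Facts

theorem liftRen_id {n : ℕ} : liftRen (id : Fin n → Fin n) = id := by
  funext i; refine Fin.cases rfl (fun _ => rfl) i

theorem Ty.ren_id {K : TySig.{u}} : {n : ℕ} → (σ : Ty K n) → σ.ren id = σ
  | _, .var _ => rfl
  | _, .con _ a => by simp only [Ty.ren, Ty.ren_id (a _)]
  | _, .one => rfl
  | _, .tensor σ τ => by simp only [Ty.ren, σ.ren_id, τ.ren_id]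
  | _, .lolli σ τ => by simp only [Ty.ren, σ.ren_id, τ.ren_id]
  | _, .bang σ => by simp only [Ty.ren, σ.ren_id]
  | _, .pi σ => by simp only [Ty.ren, liftRen_id, σ.ren_id]

theorem liftTy_var {K : TySig.{u}} {n : ℕ} :
    liftTy (Ty.var : Fin n → Ty K n) = Ty.var := by
  funext i; refine Fin.cases rfl (fun _ => rfl) i

theorem Ty.sub_var {K : TySig.{u}} : {n : ℕ} → (σ : Ty K n) → σ.sub Ty.var = σ
  | _, .var _ => rfl
  | _, .con _ a => by simp only [Ty.sub, Ty.sub_var (a _)]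
  | _, .one => rfl
  | _, .tensor σ τ => by simp only [Ty.sub, σ.sub_var, τ.sub_var]
  | _, .lolli σ τ => by simp only [Ty.sub, σ.sub_var, τ.sub_var]
  | _, .bang σ => by simp only [Ty.sub, σ.sub_var]
  | _, .pi σ => by simp only [Ty.sub, liftTy_var, σ.sub_var]

theorem liftRen_comp {n m l : ℕ} (f : Fin n → Fin m) (g : Fin m → Fin l) (i : Fin (n + 1)) :
    liftRen g (liftRen f i) = liftRen (fun j => g (f j)) i :=
  Fin.cases rfl (fun _ => rfl) i

theorem Ty.ren_ren {K : TySig.{u}} : {n m l : ℕ} → (f : Fin n → Fin m) → (g : Fin m → Fin l) →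
    (σ : Ty K n) → (σ.ren f).ren g = σ.ren (fun i => g (f i))
  | _, _, _, _, _, .var _ => rfl
  | _, _, _, f, g, .con _ a => by simp only [Ty.ren, Ty.ren_ren f g (a _)]
  | _, _, _, _, _, .one => rfl
  | _, _, _, f, g, .tensor σ τ => by simp only [Ty.ren, σ.ren_ren f g, τ.ren_ren f g]
  | _, _, _, f, g, .lolli σ τ => by simp only [Ty.ren, σ.ren_ren f g, τ.ren_ren f g]
  | _, _, _, f, g, .bang σ => by simp only [Ty.ren, σ.ren_ren f g]
  | _, _, _, f, g, .pi σ => by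
      simp only [Ty.ren, σ.ren_ren (liftRen f) (liftRen g), liftRen_comp]

theorem Ty.sub_ren {K : TySig.{u}} : {n m l : ℕ} → (f : Fin n → Fin m) → (s : Fin m → Ty K l) →
    (σ : Ty K n) → (σ.ren f).sub s = σ.sub (fun i => s (f i))
  | _, _, _, _, _, .var _ => rfl
  | _, _, _, f, s, .con _ a => by simp only [Ty.ren, Ty.sub, Ty.sub_ren f s (a _)]
  | _, _, _, _, _, .one => rfl
  | _, _, _, f, s, .tensor σ τ => by simp only [Ty.ren, Ty.sub, σ.sub_ren f s, τ.sub_ren f s]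
  | _, _, _, f, s, .lolli σ τ => by simp only [Ty.ren, Ty.sub, σ.sub_ren f s, τ.sub_ren f s]
  | _, _, _, f, s, .bang σ => by simp only [Ty.ren, Ty.sub, σ.sub_ren f s]
  | _, _, _, f, s, .pi σ => by
      simp only [Ty.ren, Ty.sub, σ.sub_ren (liftRen f) (liftTy s)]
      congr 2; funext i; exact Fin.cases rfl (fun _ => rfl) i

theorem Ty.ren_sub {K : TySig.{u}} : {n m l : ℕ} → (s : Fin n → Ty K m) → (g : Fin m → Fin l) →
    (σ : Ty K n) → (σ.sub s).ren g = σ.sub (fun i => (s i).ren g)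
  | _, _, _, _, _, .var _ => rfl
  | _, _, _, s, g, .con _ a => by simp only [Ty.ren, Ty.sub, Ty.ren_sub s g (a _)]
  | _, _, _, _, _, .one => rfl
  | _, _, _, s, g, .tensor σ τ => by simp only [Ty.ren, Ty.sub, σ.ren_sub s g, τ.ren_sub s g]
  | _, _, _, s, g, .lolli σ τ => by simp only [Ty.ren, Ty.sub, σ.ren_sub s g, τ.ren_sub s g]
  | _, _, _, s, g, .bang σ => by simp only [Ty.ren, Ty.sub, σ.ren_sub s g]
  | _, _, _, s, g, .pi σ => by
      simp only [Ty.ren, Ty.sub, σ.ren_sub (liftTy s) (liftRen g)]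
      congr 2; funext i; refine Fin.cases rfl (fun j => ?_) i
      simp only [liftTy, Fin.cases_succ, Ty.wk, Ty.ren_ren, liftRen]

theorem Ty.sub_sub {K : TySig.{u}} : {n m l : ℕ} → (s : Fin n → Ty K m) → (t : Fin m → Ty K l) →
    (σ : Ty K n) → (σ.sub s).sub t = σ.sub (fun i => (s i).sub t)
  | _, _, _, _, _, .var _ => rfl
  | _, _, _, s, t, .con _ a => by simp only [Ty.sub, Ty.sub_sub s t (a _)]
  | _, _, _, _, _, .one => rfl
  | _, _, _, s, t, .tensor σ τ => by simp only [Ty.sub, σ.sub_sub s t, τ.sub_sub s t]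
  | _, _, _, s, t, .lolli σ τ => by simp only [Ty.sub, σ.sub_sub s t, τ.sub_sub s t]
  | _, _, _, s, t, .bang σ => by simp only [Ty.sub, σ.sub_sub s t]
  | _, _, _, s, t, .pi σ => by
      simp only [Ty.sub, σ.sub_sub (liftTy s) (liftTy t)]
      congr 2; funext i; refine Fin.cases rfl (fun j => ?_) i
      simp only [liftTy, Fin.cases_succ, Ty.wk, Ty.sub_ren, Ty.ren_sub]

theorem Ty.at_sub {K : TySig.{u}} {n m : ℕ} (σ : Ty K 1) (τ : Ty K n) (s : Fin n → Ty K m) :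
    (σ.at τ).sub s = σ.at (τ.sub s) := Ty.sub_sub _ _ _

theorem Ty.at_ren {K : TySig.{u}} {n m : ℕ} (σ : Ty K 1) (τ : Ty K n) (f : Fin n → Fin m) :
    (σ.at τ).ren f = σ.at (τ.ren f) := Ty.ren_sub _ _ _

theorem mu_sub {K : TySig.{u}} {n m : ℕ} (σ : Ty K 1) (s : Fin n → Ty K m) :
    (mu σ : Ty K n).sub s = mu σ := by
  simp only [mu, Ty.sub, Ty.arr, Ty.at_sub]; rfl

theorem mu_ren {K : TySig.{u}} {n m : ℕ} (σ : Ty K 1) (f : Fin n → Fin m) :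
    (mu σ : Ty K n).ren f = mu σ := by
  simp only [mu, Ty.ren, Ty.arr, Ty.at_ren]; rfl

theorem liftIdx_lt {r : ℕ → ℕ} {k : ℕ} (h : ∀ i < k, r i = i) : ∀ i < k + 1, liftIdx r i = i
  | 0, _ => rfl
  | i + 1, hi => by simp [liftIdx, h i (by omega)]

variable {S : Sig.{u, v}}

theorem liftTm_lt {n : ℕ} {s s' : ℕ → Tm S n} {k : ℕ} (h : ∀ i < k, s i = s' i) :
    ∀ i < k + 1, liftTm s i = liftTm s' i
  | 0, _ => rfl
  | i + 1, hi => by simp [liftTm, h i (by omega)]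

theorem liftTm_var {n : ℕ} : liftTm (Tm.var : ℕ → Tm S n) = Tm.var := by
  funext i; cases i <;> rfl

theorem Tm.sub_var : {n : ℕ} → (t : Tm S n) → t.sub Ty.var Tm.var = t
  | _, .var _ => rfl
  | _, .con _ => rfl
  | _, .star => rfl
  | _, .Y => rfl
  | _, .lam _ t => by simp only [Tm.sub, Ty.sub_var, liftTm_var, t.sub_var]
  | _, .app t u => by simp only [Tm.sub, t.sub_var, u.sub_var]
  | _, .tensor t u => by simp only [Tm.sub, t.sub_var, u.sub_var]
  | _, .bang t => by simp only [Tm.sub, t.sub_var]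
  | n, .tlam t => by
      have h : (fun i => (Tm.var i : Tm S n).tup) = Tm.var := rfl
      simp only [Tm.sub, liftTy_var, h, t.sub_var]
  | _, .tapp t _ => by simp only [Tm.sub, Ty.sub_var, t.sub_var]
  | _, .letT _ _ t u => by simp only [Tm.sub, Ty.sub_var, liftTm_var, t.sub_var, u.sub_var]
  | _, .letB _ t u => by simp only [Tm.sub, Ty.sub_var, liftTm_var, t.sub_var, u.sub_var]
  | _, .letS t u => by simp only [Tm.sub, t.sub_var, u.sub_var]

theorem Split.length_left {n : ℕ} {G G₁ G₂ : Ctx S n} (h : Split G G₁ G₂) :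
    G₁.length = G.length := by
  induction h <;> simp_all

theorem Split.length_right {n : ℕ} {G G₁ G₂ : Ctx S n} (h : Split G G₁ G₂) :
    G₂.length = G.length := by
  induction h <;> simp_all

theorem HasType.ren_eq {n : ℕ} {G : Ctx S n} {t : Tm S n} {τ : S.Ty n} (h : HasType G t τ) :
    ∀ r : ℕ → ℕ, (∀ i < G.length, r i = i) → t.ren id r = t := by
  induction h with
  | star | Y | con => intros; rfl
  | ivar _ hi => intro r hr; simp only [Tm.ren]; rw [hr _ (List.getElem?_eq_some_iff.1 hi).1]
  | lvar hi _ => intro r hr; simp only [Tm.ren]; rw [hr _ (List.getElem?_eq_some_iff.1 hi).1]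
  | app hs _ _ h1 h2 | tensor hs _ _ h1 h2 | letS hs _ _ h1 h2 =>
    intro r hr
    simp only [Tm.ren]; rw [h1 r (by rwa [hs.length_left]), h2 r (by rwa [hs.length_right])]
  | lam _ ih => intro r hr; simp only [Tm.ren, Ty.ren_id]; rw [ih _ (liftIdx_lt hr)]
  | bang _ _ ih => intro r hr; simp only [Tm.ren]; rw [ih r hr]
  | tlam _ ih => intro r hr; simp only [Tm.ren, liftRen_id]; rw [ih r (by simpa using hr)]
  | tapp τ _ ih => intro r hr; simp only [Tm.ren, Ty.ren_id]; rw [ih r hr]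
  | letT hs _ _ h1 h2 =>
    intro r hr
    simp only [Tm.ren, Ty.ren_id]
    rw [h1 r (by rwa [hs.length_left]),
      h2 _ (liftIdx_lt (liftIdx_lt (by rwa [hs.length_right])))]
  | letB hs _ _ h1 h2 =>
    intro r hr
    simp only [Tm.ren, Ty.ren_id]
    rw [h1 r (by rwa [hs.length_left]), h2 _ (liftIdx_lt (by rwa [hs.length_right]))]

theorem HasType.sub_congr {n : ℕ} {G : Ctx S n} {t : Tm S n} {τ : S.Ty n} (h : HasType G t τ) :
    ∀ {m : ℕ} (a : Fin n → S.Ty m) (s s' : ℕ → Tm S m), (∀ i < G.length, s i = s' i) →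
      t.sub a s = t.sub a s' := by
  induction h with
  | star | Y | con => intros; rfl
  | ivar _ hi => intro m a r r' hr; exact hr _ (List.getElem?_eq_some_iff.1 hi).1
  | lvar hi _ => intro m a r r' hr; exact hr _ (List.getElem?_eq_some_iff.1 hi).1
  | app hs _ _ h1 h2 | tensor hs _ _ h1 h2 | letS hs _ _ h1 h2 =>
    intro m a r r' hr
    simp only [Tm.sub]
    rw [h1 a r r' (by rwa [hs.length_left]), h2 a r r' (by rwa [hs.length_right])]
  | lam _ ih => intro m a r r' hr; simp only [Tm.sub]; rw [ih a _ _ (liftTm_lt hr)]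
  | bang _ _ ih => intro m a r r' hr; simp only [Tm.sub]; rw [ih a r r' hr]
  | tlam _ ih =>
    intro m a r r' hr; simp only [Tm.sub]
    rw [ih (liftTy a) (fun i => (r i).tup) (fun i => (r' i).tup)
      (fun i hi => by rw [hr i (by simpa using hi)])]
  | tapp τ _ ih => intro m a r r' hr; simp only [Tm.sub]; rw [ih a r r' hr]
  | letT hs _ _ h1 h2 =>
    intro m a r r' hr
    simp only [Tm.sub]
    rw [h1 a r r' (by rwa [hs.length_left]),
      h2 a _ _ (liftTm_lt (liftTm_lt (by rwa [hs.length_right])))]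
  | letB hs _ _ h1 h2 =>
    intro m a r r' hr
    simp only [Tm.sub]
    rw [h1 a r r' (by rwa [hs.length_left]), h2 a _ _ (liftTm_lt (by rwa [hs.length_right]))]

/-- Closed terms are not changed by weakening. -/
theorem HasType.up_eq {n : ℕ} {t : Tm S n} {τ : S.Ty n} (h : HasType [] t τ) (k : ℕ) :
    t.up k = t := h.ren_eq _ (by simp)

/-- Closed terms are not changed by substitution for term variables. -/
theorem HasType.sub_eq {n : ℕ} {t : Tm S n} {τ : S.Ty n} (h : HasType [] t τ) (s : ℕ → Tm S n) :
    t.sub .var s = t := by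
  rw [h.sub_congr .var s .var (by simp), t.sub_var]

theorem Split.append {n : ℕ} {H : Ctx S n} (hH : NoLin H) {G G₁ G₂ : Ctx S n}
    (h : Split G G₁ G₂) : Split (G ++ H) (G₁ ++ H) (G₂ ++ H) := by
  induction h with
  | nil =>
    induction H with
    | nil => exact .nil
    | cons e H ih =>
      have := ih (fun σ h => hH σ (List.mem_cons_of_mem _ h))
      cases e with
      | int σ => exact .int σ this
      | lin σ => exact absurd (List.mem_cons_self) (hH σ)
      | off => exact .off this
  | int σ _ ih => exact .int σ ih
  | left σ _ ih => exact .left σ ih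
  | right σ _ ih => exact .right σ ih
  | off _ ih => exact .off ih

theorem NoLin.append {n : ℕ} {G H : Ctx S n} (hG : NoLin G) (hH : NoLin H) : NoLin (G ++ H) := by
  intro σ h; rcases List.mem_append.1 h with h | h
  exacts [hG σ h, hH σ h]

theorem NoLin.map {n m : ℕ} {G : Ctx S n} (hG : NoLin G) (f : Fin n → Fin m) :
    NoLin (G.map (Entry.ren f)) := by
  intro σ h
  obtain ⟨e, he, h⟩ := List.mem_map.1 h
  cases e with
  | int _ => cases h
  | off => cases h
  | lin τ => exact hG τ he

theorem HasType.append {n : ℕ} {G : Ctx S n} {t : Tm S n} {τ : S.Ty n} (h : HasType G t τ) :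
    ∀ {H : Ctx S n}, NoLin H → HasType (G ++ H) t τ := by
  induction h with
  | star h => intro H hH; exact .star (h.append hH)
  | Y h => intro H hH; exact .Y (h.append hH)
  | con c h => intro H hH; exact .con c (h.append hH)
  | ivar h hi =>
    intro H hH
    exact .ivar (h.append hH) (by
      rw [List.getElem?_append_left (List.getElem?_eq_some_iff.1 hi).1]; exact hi)
  | lvar hi h =>
    intro H hH
    refine .lvar (by
      rw [List.getElem?_append_left (List.getElem?_eq_some_iff.1 hi).1]; exact hi) ?_
    rw [List.set_append_left _ _ (List.getElem?_eq_some_iff.1 hi).1]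
    exact h.append hH
  | app hs _ _ h1 h2 => intro H hH; exact .app (hs.append hH) (h1 hH) (h2 hH)
  | tensor hs _ _ h1 h2 => intro H hH; exact .tensor (hs.append hH) (h1 hH) (h2 hH)
  | letS hs _ _ h1 h2 => intro H hH; exact .letS (hs.append hH) (h1 hH) (h2 hH)
  | lam _ ih => intro H hH; exact .lam (ih hH)
  | bang h _ ih => intro H hH; exact .bang (h.append hH) (ih hH)
  | tlam _ ih =>
    intro H hH; refine .tlam ?_
    rw [List.map_append]; exact ih (hH.map _)
  | tapp τ _ ih => intro H hH; exact .tapp τ (ih hH)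
  | letT hs _ _ h1 h2 => intro H hH; exact .letT (hs.append hH) (h1 hH) (h2 hH)
  | letB hs _ _ h1 h2 => intro H hH; exact .letB (hs.append hH) (h1 hH) (h2 hH)

theorem HasType.closed {n : ℕ} {t : Tm S n} {τ : S.Ty n} (h : HasType [] t τ) {H : Ctx S n}
    (hH : NoLin H) : HasType H t τ := h.append hH

/-- The renaming that makes room for a new variable at position `k`. -/
def insIdx : ℕ → ℕ → ℕ
  | 0 => (· + 1)
  | k + 1 => liftIdx (insIdx k)

theorem insIdx_eq (k i : ℕ) : insIdx k i = if i < k then i else i + 1 := by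
  induction k generalizing i with
  | zero => simp [insIdx]
  | succ k ih =>
    cases i with
    | zero => simp [insIdx, liftIdx]
    | succ i => simp only [insIdx, liftIdx, ih]; split_ifs <;> omega

theorem insIdx_get {α : Type*} {A B : List α} {e : α} {i : ℕ} :
    (A ++ e :: B)[insIdx A.length i]? = (A ++ B)[i]? := by
  rw [insIdx_eq]
  split_ifs with h
  · rw [List.getElem?_append_left h, List.getElem?_append_left h]
  · rw [List.getElem?_append_right (by omega), List.getElem?_append_right (by omega)]
    rw [show i + 1 - A.length = (i - A.length) + 1 by omega, List.getElem?_cons_succ]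

theorem noLin_iff {n : ℕ} {G : Ctx S n} : NoLin G ↔ ∀ (i : ℕ) (σ : S.Ty n),
    G[i]? ≠ some (.lin σ) := by
  constructor
  · intro h i σ hi; exact h σ (List.mem_iff_getElem?.2 ⟨i, hi⟩)
  · intro h σ hm
    obtain ⟨i, hi⟩ := List.mem_iff_getElem?.1 hm
    exact h i σ hi

theorem NoLin.insert {n : ℕ} {A B : Ctx S n} {e : Entry S n} (he : ∀ σ, e ≠ .lin σ)
    (h : NoLin (A ++ B)) : NoLin (A ++ e :: B) := by
  intro σ hm
  simp only [List.mem_append, List.mem_cons] at hm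
  rcases hm with hm | hm | hm
  · exact h σ (List.mem_append_left _ hm)
  · exact he σ hm.symm
  · exact h σ (List.mem_append_right _ hm)

theorem Split.insert {n : ℕ} {e : Entry S n} (he : ∀ σ, e ≠ .lin σ) {B : Ctx S n} :
    ∀ {A G₁ G₂ : Ctx S n}, Split (A ++ B) G₁ G₂ → ∃ A₁ B₁ A₂ B₂ : Ctx S n,
      G₁ = A₁ ++ B₁ ∧ G₂ = A₂ ++ B₂ ∧ A₁.length = A.length ∧ A₂.length = A.length ∧
      Split (A ++ e :: B) (A₁ ++ e :: B₁) (A₂ ++ e :: B₂)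
  | [], G₁, G₂, h => by
    refine ⟨[], G₁, [], G₂, rfl, rfl, rfl, rfl, ?_⟩
    cases e with
    | int σ => exact .int σ h
    | lin σ => exact absurd rfl (he σ)
    | off => exact .off h
  | a :: A, G₁, G₂, h => by
    simp only [List.cons_append] at h
    cases h with
    | int σ h =>
      obtain ⟨A₁, B₁, A₂, B₂, rfl, rfl, h1, h2, h3⟩ := Split.insert he h
      exact ⟨.int σ :: A₁, B₁, .int σ :: A₂, B₂, rfl, rfl, by simp [h1], by simp [h2], .int σ h3⟩
    | left σ h =>
      obtain ⟨A₁, B₁, A₂, B₂, rfl, rfl, h1, h2, h3⟩ := Split.insert he h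
      exact ⟨.lin σ :: A₁, B₁, .off :: A₂, B₂, rfl, rfl, by simp [h1], by simp [h2], .left σ h3⟩
    | right σ h =>
      obtain ⟨A₁, B₁, A₂, B₂, rfl, rfl, h1, h2, h3⟩ := Split.insert he h
      exact ⟨.off :: A₁, B₁, .lin σ :: A₂, B₂, rfl, rfl, by simp [h1], by simp [h2], .right σ h3⟩
    | off h =>
      obtain ⟨A₁, B₁, A₂, B₂, rfl, rfl, h1, h2, h3⟩ := Split.insert he h
      exact ⟨.off :: A₁, B₁, .off :: A₂, B₂, rfl, rfl, by simp [h1], by simp [h2], .off h3⟩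

/-- Weakening by a variable that is not linear. -/
theorem HasType.insert {n : ℕ} {G : Ctx S n} {t : Tm S n} {τ : S.Ty n} (h : HasType G t τ) :
    ∀ {A B : Ctx S n} {e : Entry S n}, (∀ σ, e ≠ .lin σ) → G = A ++ B →
      HasType (A ++ e :: B) (t.ren id (insIdx A.length)) τ := by
  induction h with
  | star h => rintro A B e he rfl; exact .star (h.insert he)
  | Y h => rintro A B e he rfl; exact .Y (h.insert he)
  | con c h => rintro A B e he rfl; exact .con c (h.insert he)
  | ivar h hi => rintro A B e he rfl; exact .ivar (h.insert he) (by rw [insIdx_get]; exact hi)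
  | @lvar n G i σ hi h =>
    rintro A B e he rfl
    refine .lvar (by rw [insIdx_get]; exact hi) ?_
    rw [insIdx_eq]
    split_ifs with hl
    · rw [List.set_append_left _ _ hl] at h ⊢
      exact h.insert he
    · rw [List.set_append_right _ _ (by omega)] at h ⊢
      rw [show i + 1 - A.length = (i - A.length) + 1 by omega, List.set_cons_succ]
      exact h.insert he
  | app hs _ _ h1 h2 =>
    rintro A B e he rfl
    obtain ⟨A₁, B₁, A₂, B₂, rfl, rfl, l1, l2, h3⟩ := hs.insert he
    exact .app h3 (l1 ▸ h1 he rfl) (l2 ▸ h2 he rfl)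
  | tensor hs _ _ h1 h2 =>
    rintro A B e he rfl
    obtain ⟨A₁, B₁, A₂, B₂, rfl, rfl, l1, l2, h3⟩ := hs.insert he
    exact .tensor h3 (l1 ▸ h1 he rfl) (l2 ▸ h2 he rfl)
  | letS hs _ _ h1 h2 =>
    rintro A B e he rfl
    obtain ⟨A₁, B₁, A₂, B₂, rfl, rfl, l1, l2, h3⟩ := hs.insert he
    exact .letS h3 (l1 ▸ h1 he rfl) (l2 ▸ h2 he rfl)
  | lam _ ih =>
    rintro A B e he rfl
    simp only [Tm.ren, Ty.ren_id]
    exact .lam (ih (A := _ :: A) he rfl)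
  | bang h _ ih => rintro A B e he rfl; exact .bang (h.insert he) (ih he rfl)
  | tlam _ ih =>
    rintro A B e he rfl
    simp only [Tm.ren, liftRen_id]
    refine .tlam ?_
    rw [List.map_append, List.map_cons, ← List.length_map (as := A)]
    refine ih ?_ (by simp)
    cases e with
    | lin σ => exact absurd rfl (he σ)
    | int _ => intro _ h; cases h
    | off => intro _ h; cases h
  | tapp τ _ ih =>
    rintro A B e he rfl; simp only [Tm.ren, Ty.ren_id]; exact .tapp τ (ih he rfl)
  | letT hs _ _ h1 h2 =>
    rintro A B e he rfl
    obtain ⟨A₁, B₁, A₂, B₂, rfl, rfl, l1, l2, h3⟩ := hs.insert he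
    simp only [Tm.ren, Ty.ren_id]
    exact .letT h3 (l1 ▸ h1 he rfl) (l2 ▸ h2 (A := _ :: _ :: A₂) he rfl)
  | letB hs _ _ h1 h2 =>
    rintro A B e he rfl
    obtain ⟨A₁, B₁, A₂, B₂, rfl, rfl, l1, l2, h3⟩ := hs.insert he
    simp only [Tm.ren, Ty.ren_id]
    exact .letB h3 (l1 ▸ h1 he rfl) (l2 ▸ h2 (A := _ :: A₂) he rfl)

theorem HasType.up {n : ℕ} {G : Ctx S n} {t : Tm S n} {τ : S.Ty n} (h : HasType G t τ)
    {e : Entry S n} (he : ∀ σ, e ≠ .lin σ) : HasType (e :: G) (t.up 1) τ :=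
  h.insert (A := []) he rfl

/-- All linear variables go to the right hand context. -/
theorem Split.allRight {n : ℕ} : (G : Ctx S n) → ∃ G₀ : Ctx S n, NoLin G₀ ∧ Split G G₀ G
  | [] => ⟨[], by simp [NoLin], .nil⟩
  | e :: G => by
    obtain ⟨G₀, h, h'⟩ := Split.allRight G
    cases e with
    | int σ => exact ⟨.int σ :: G₀, by simpa [NoLin] using h, .int σ h'⟩
    | lin σ => exact ⟨.off :: G₀, by simpa [NoLin] using h, .right σ h'⟩
    | off => exact ⟨.off :: G₀, by simpa [NoLin] using h, .off h'⟩

theorem Split.self {n : ℕ} : {G : Ctx S n} → NoLin G → Split G G G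
  | [], _ => .nil
  | e :: G, hG => by
    have h' := Split.self (G := G) (fun σ h => hG σ (List.mem_cons_of_mem _ h))
    cases e with
    | int σ => exact .int σ h'
    | lin σ => exact absurd List.mem_cons_self (hG σ)
    | off => exact .off h'

theorem HasType.ilam {n : ℕ} {G : Ctx S n} {t : Tm S n} {σ τ : S.Ty n}
    (h : HasType (.int σ :: G) t τ) : HasType G (.ilam σ t) (.arr σ τ) := by
  obtain ⟨G₀, h0, hs⟩ := Split.allRight G
  refine .lam (.letB (.left _ hs) (.lvar rfl (by simpa [NoLin] using h0)) ?_)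
  exact h.insert (A := [.int σ]) (B := G) (e := .off) (by simp) rfl

/-- A term that may stand for the action on a type variable. -/
def Leaf {n : ℕ} (G : Ctx S n) (c : Tm S n) (σ τ : S.Ty n) : Prop :=
  (∃ i, c = .var i ∧ G[i]? = some (.int (.lolli σ τ))) ∨ (c = .idt σ ∧ σ = τ)

theorem Leaf.hasType {n : ℕ} {G : Ctx S n} {c : Tm S n} {σ τ : S.Ty n} (h : Leaf G c σ τ)
    (hG : NoLin G) : HasType G c (.lolli σ τ) := by
  rcases h with ⟨i, rfl, hi⟩ | ⟨rfl, rfl⟩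
  · exact .ivar hG hi
  · exact .lam (.lvar rfl (by simpa [NoLin] using hG))

theorem Leaf.up {n : ℕ} {G : Ctx S n} {c : Tm S n} {σ τ : S.Ty n} (h : Leaf G c σ τ)
    (H : Ctx S n) : Leaf (H ++ G) (c.up H.length) σ τ := by
  rcases h with ⟨i, rfl, hi⟩ | ⟨rfl, rfl⟩
  · refine .inl ⟨i + H.length, rfl, ?_⟩
    rw [List.getElem?_append_right (by omega)]; simpa using hi
  · refine .inr ⟨?_, rfl⟩
    simp [Tm.up, Tm.idt, Tm.ren, Ty.ren_id, liftIdx]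

theorem Leaf.tup {n : ℕ} {G : Ctx S n} {c : Tm S n} {σ τ : S.Ty n} (h : Leaf G c σ τ) :
    Leaf (G.map (Entry.ren Fin.succ)) c.tup σ.wk τ.wk := by
  rcases h with ⟨i, rfl, hi⟩ | ⟨rfl, rfl⟩
  · refine .inl ⟨i, rfl, ?_⟩
    rw [List.getElem?_map, hi]; rfl
  · exact .inr ⟨rfl, rfl⟩

/-- The variable `i` occurs below a type constant. -/
def Ty.OccCon {K : TySig.{u}} : {n : ℕ} → Ty K n → Fin n → Prop
  | _, .var _, _ => False
  | _, .con _ a, i => ∃ j p, (a j).Occ p i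
  | _, .one, _ => False
  | _, .tensor σ τ, i => σ.OccCon i ∨ τ.OccCon i
  | _, .lolli σ τ, i => σ.OccCon i ∨ τ.OccCon i
  | _, .bang σ, i => σ.OccCon i
  | _, .pi σ, i => σ.OccCon i.succ

theorem liftRen_succ {n m : ℕ} {f : Fin n → Fin m} {i : Fin m}
    (h : ∃ j, liftRen f j = i.succ) : ∃ j, f j = i := by
  obtain ⟨j, h⟩ := h
  revert h
  refine Fin.cases (fun h => ?_) (fun j h => ⟨j, Fin.succ_injective _ h⟩) j
  exact absurd h (Fin.succ_ne_zero i).symm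

theorem Ty.occ_ren {K : TySig.{u}} : {n m : ℕ} → (f : Fin n → Fin m) → (σ : Ty K n) →
    (p : Bool) → (i : Fin m) → (σ.ren f).Occ p i → ∃ j, f j = i
  | _, _, f, .var j, _, _, h => ⟨j, h.2.symm⟩
  | _, _, f, .con _ a, p, i, h => by
      obtain ⟨j, h⟩ := h
      exact (a j).occ_ren f p i h
  | _, _, _, .one, _, _, h => h.elim
  | _, _, f, .tensor σ τ, p, i, h => h.elim (σ.occ_ren f p i) (τ.occ_ren f p i)
  | _, _, f, .lolli σ τ, p, i, h => h.elim (σ.occ_ren f _ i) (τ.occ_ren f p i)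
  | _, _, f, .bang σ, p, i, h => σ.occ_ren f p i h
  | _, _, f, .pi σ, p, i, h => liftRen_succ (σ.occ_ren (liftRen f) p i.succ h)

theorem Ty.occCon_ren {K : TySig.{u}} : {n m : ℕ} → (f : Fin n → Fin m) → (σ : Ty K n) →
    (i : Fin m) → (σ.ren f).OccCon i → ∃ j, f j = i
  | _, _, f, .con _ a, i, h => by
      obtain ⟨j, p, h⟩ := h
      exact (a j).occ_ren f p i h
  | _, _, f, .tensor σ τ, i, h => h.elim (σ.occCon_ren f i) (τ.occCon_ren f i)
  | _, _, f, .lolli σ τ, i, h => h.elim (σ.occCon_ren f i) (τ.occCon_ren f i)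
  | _, _, f, .bang σ, i, h => σ.occCon_ren f i h
  | _, _, f, .pi σ, i, h => liftRen_succ (σ.occCon_ren (liftRen f) i.succ h)

theorem IndConstr.not_occCon {K : TySig.{u}} {n : ℕ} {σ : Ty K n} (h : IndConstr σ) :
    ∀ i, ¬ σ.OccCon i := by
  induction h with
  | var | one => intro i h; exact h
  | closed σ => intro i h; obtain ⟨j, _⟩ := σ.occCon_ren _ i h; exact j.elim0
  | tensor _ _ h1 h2 | lolli _ _ h1 h2 => intro i h; exact h.elim (h1 i) (h2 i)
  | bang _ ih => intro i h; exact ih i h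
  | pi _ ih => intro i h; exact ih _ h

theorem Ty.sub_congr {K : TySig.{u}} : {n m : ℕ} → (s s' : Fin n → Ty K m) → (σ : Ty K n) →
    (∀ p i, σ.Occ p i → s i = s' i) → σ.sub s = σ.sub s'
  | _, _, _, _, .var i, h => h true i ⟨rfl, rfl⟩
  | _, _, s, s', .con _ a, h => by
      simp only [Ty.sub]
      congr 1; funext j; exact (a j).sub_congr s s' (fun p i hi => h p i ⟨j, hi⟩)
  | _, _, _, _, .one, _ => rfl
  | _, _, s, s', .tensor σ τ, h => by
      simp only [Ty.sub]
      rw [σ.sub_congr s s' (fun p i hi => h p i (.inl hi)),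
        τ.sub_congr s s' (fun p i hi => h p i (.inr hi))]
  | _, _, s, s', .lolli σ τ, h => by
      simp only [Ty.sub]
      rw [σ.sub_congr s s' (fun p i hi => h (!p) i (.inl (by simpa using hi))),
        τ.sub_congr s s' (fun p i hi => h p i (.inr hi))]
  | _, _, s, s', .bang σ, h => by
      simp only [Ty.sub]
      rw [σ.sub_congr s s' h]
  | _, _, s, s', .pi σ, h => by
      simp only [Ty.sub]
      rw [σ.sub_congr (liftTy s) (liftTy s') (fun p i => Fin.cases (fun _ => rfl)
        (fun i hi => by simp only [liftTy, Fin.cases_succ]; rw [h p i hi]) i)]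

theorem Ty.inst_wk {K : TySig.{u}} {n : ℕ} (σ : Ty K (n + 1)) :
    (σ.ren (liftRen Fin.succ)).sub (instTy (.var 0)) = σ := by
  rw [Ty.sub_ren]
  have : (fun i => instTy (Ty.var 0 : Ty K (n + 1)) (liftRen Fin.succ i)) = Ty.var := by
    funext i; exact Fin.cases rfl (fun _ => rfl) i
  rw [this, Ty.sub_var]

/-- The action of a type on maps is well typed. -/
theorem act_hasType : {k n : ℕ} → (σ : S.Ty k) → (s s' : Fin k → S.Ty n) →
    (c : Fin k → Tm S n) → (G : Ctx S n) → NoLin G →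
    (∀ i, σ.Occ true i → Leaf G (c i) (s i) (s' i)) →
    (∀ i, σ.Occ false i → Leaf G (c i) (s' i) (s i)) →
    (∀ i, σ.OccCon i → s i = s' i) →
    HasType G (act σ s s' c) (.lolli (σ.sub s) (σ.sub s'))
  | _, _, .var i, s, s', c, G, hG, h1, _, _ => (h1 i ⟨rfl, rfl⟩).hasType hG
  | _, _, .con d a, s, s', c, G, hG, _, _, h3 => by
      have : (Ty.con d a : S.Ty _).sub s = (Ty.con d a).sub s' :=
        Ty.sub_congr s s' _ (fun p i hi => h3 i (by obtain ⟨j, hj⟩ := hi; exact ⟨j, p, hj⟩))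
      rw [this]
      simp only [act]
      rw [this]
      exact (Leaf.hasType (.inr ⟨rfl, rfl⟩) hG)
  | _, _, .one, s, s', c, G, hG, _, _, _ => Leaf.hasType (.inr ⟨rfl, rfl⟩) hG
  | _, _, .tensor σ τ, s, s', c, G, hG, h1, h2, h3 => by
      have hs := Split.self hG
      refine .lam (.letT (.left _ hs) (.lvar rfl (by simpa [NoLin] using hG)) ?_)
      have hN : NoLin (Entry.off :: Entry.off :: Entry.off :: G) := by simpa [NoLin] using hG
      have e := fun i A B (h : Leaf G (c i) A B) => h.up [.off, .off, .off]
      refine .tensor (.right _ (.left _ (.off hs))) (σ := σ.sub s') (τ := τ.sub s') ?_ ?_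
      · refine .app (σ := σ.sub s) (.off (.right _ (.off hs))) ?_
          (.lvar rfl (by simpa [NoLin] using hG))
        exact act_hasType σ s s' _ _ hN (fun i h => e i _ _ (h1 i (.inl h)))
          (fun i h => e i _ _ (h2 i (.inl h))) (fun i h => h3 i (.inl h))
      · refine .app (σ := τ.sub s) (.right _ (.off (.off hs))) ?_
          (.lvar rfl (by simpa [NoLin] using hG))
        exact act_hasType τ s s' _ _ hN (fun i h => e i _ _ (h1 i (.inr h)))
          (fun i h => e i _ _ (h2 i (.inr h))) (fun i h => h3 i (.inr h))
  | _, _, .lolli σ τ, s, s', c, G, hG, h1, h2, h3 => by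
      have hs := Split.self hG
      have hN : NoLin (Entry.off :: G) := by simpa [NoLin] using hG
      have e := fun i A B (h : Leaf G (c i) A B) => h.up [.off]
      have hσ : HasType (.off :: G) (act σ s' s (fun i => (c i).up 1))
          (.lolli (σ.sub s') (σ.sub s)) :=
        act_hasType σ s' s _ _ hN (fun i h => e i _ _ (h2 i (.inl h)))
          (fun i h => e i _ _ (h1 i (.inl h))) (fun i h => (h3 i (.inl h)).symm)
      have hτ : HasType (.off :: G) (act τ s s' (fun i => (c i).up 1))
          (.lolli (τ.sub s) (τ.sub s')) :=
        act_hasType τ s s' _ _ hN (fun i h => e i _ _ (h1 i (.inr h)))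
          (fun i h => e i _ _ (h2 i (.inr h))) (fun i h => h3 i (.inr h))
      refine .lam (.lam (.app (σ := τ.sub s) (.right _ (.right _ hs)) (hτ.up (by simp)) ?_))
      refine .app (σ := σ.sub s') (.right _ (.left _ hs)) ?_
        (.lvar rfl (by simpa [NoLin] using hG))
      refine HasType.up (t := Tm.comp _ _ _) (e := .off) ?_ (by simp)
      refine .lam (.app (σ := σ.sub s) (.right _ (.left _ hs))
        (.lvar rfl (by simpa [NoLin] using hG)) ?_)
      exact .app (σ := σ.sub s') (.right _ (.off hs)) (hσ.up (by simp))
        (.lvar rfl (by simpa [NoLin] using hG))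
  | _, _, .bang σ, s, s', c, G, hG, h1, h2, h3 => by
      have hs := Split.self hG
      refine .lam (.letB (.left _ hs) (.lvar rfl (by simpa [NoLin] using hG)) ?_)
      have hN : NoLin (Entry.int (σ.sub s) :: Entry.off :: G) := by simpa [NoLin] using hG
      have e := fun i A B (h : Leaf G (c i) A B) => h.up [.int (σ.sub s), .off]
      refine .bang hN (.app (σ := σ.sub s) (Split.self hN) ?_ (.ivar hN rfl))
      exact act_hasType σ s s' _ _ hN (fun i h => e i _ _ (h1 i h))
          (fun i h => e i _ _ (h2 i h)) (fun i h => h3 i h)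
  | k, n, .pi σ, s, s', c, G, hG, h1, h2, h3 => by
      have hG' := hG.map (m := n + 1) Fin.succ
      refine .lam (.tlam (.app (σ := σ.sub (liftTy s)) (.right _ (Split.self hG')) ?_ ?_))
      · have e : ∀ i A B, Leaf G (c i) A B → Leaf (.off :: G.map (Entry.ren Fin.succ))
            ((c i).up 1).tup A.wk B.wk := fun i A B h => (h.up [.off]).tup
        refine act_hasType σ _ _ _ _ (by simpa [NoLin] using hG') ?_ ?_ ?_
        · exact fun i => Fin.cases (fun _ => .inr ⟨rfl, rfl⟩) (fun i h => e i _ _ (h1 i h)) i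
        · exact fun i => Fin.cases (fun _ => .inr ⟨rfl, rfl⟩) (fun i h => e i _ _ (h2 i h)) i
        · exact fun i => Fin.cases (fun _ => rfl)
            (fun i h => by simp only [liftTy, Fin.cases_succ]; rw [h3 i h]) i
      · have := HasType.tapp (S := S) (G := .lin ((Ty.pi (σ.sub (liftTy s))).ren Fin.succ) ::
          G.map (Entry.ren Fin.succ)) (t := .var 0)
          (σ := (σ.sub (liftTy s)).ren (liftRen Fin.succ)) (.var 0)
          (.lvar rfl (by simpa [NoLin] using hG'))
        rw [Ty.inst_wk] at this
        exact this

theorem functorTm_hasType {n : ℕ} {σ : S.Ty 1} (hσ : IndConstr σ) (hpos : ¬ σ.Occ false 0)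
    {G : Ctx S n} (hG : NoLin G) : HasType G (functorTm σ)
      (.pi (.pi (.arr (.lolli (.var 1) (.var 0)) (.lolli (σ.at (.var 1)) (σ.at (.var 0)))))) := by
  refine .tlam (.tlam (.ilam ?_))
  refine act_hasType σ _ _ _ _ ?_ (fun _ _ => .inl ⟨0, rfl, rfl⟩) (fun i h => ?_)
    (fun i h => absurd h (hσ.not_occCon i))
  · have := (hG.map (m := n + 1) Fin.succ).map (m := n + 2) Fin.succ
    simpa [NoLin] using this
  · rw [Subsingleton.elim i 0] at h; exact absurd h hpos

theorem mapTm_hasType {n : ℕ} {σ : S.Ty 1} (hσ : IndConstr σ) (hpos : ¬ σ.Occ false 0)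
    {G : Ctx S n} (hG : NoLin G) {τ τ' : S.Ty n} {f : Tm S n} (hf : HasType G f (.lolli τ τ')) :
    HasType G (mapTm σ τ τ' f) (.lolli (σ.at τ) (σ.at τ')) := by
  have h := HasType.tapp τ' (HasType.tapp τ (functorTm_hasType hσ hpos hG))
  simp only [Ty.arr, Ty.sub, Ty.at_sub] at h
  have e1 : ((liftTy (instTy τ) 1).sub (instTy τ') : S.Ty n) = τ := by
    change (τ.ren Fin.succ).sub (instTy τ') = τ
    rw [Ty.sub_ren]; exact τ.sub_var
  have e0 : ((liftTy (instTy τ) 0).sub (instTy τ') : S.Ty n) = τ' := rfl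
  rw [e1, e0] at h
  exact .app (Split.self hG) h (.bang hG hf)

theorem foldTm_hasType {n : ℕ} (σ : S.Ty 1) {G : Ctx S n} (hG : NoLin G) :
    HasType G (foldTm σ)
      (.pi (.arr (.lolli (σ.at (.var 0)) (.var 0)) (.lolli (mu σ) (.var 0)))) := by
  have hG' := hG.map (m := n + 1) Fin.succ
  refine .tlam (.ilam (.lam ?_))
  refine .app (.left _ (.int _ (Split.self hG'))) (σ := .bang (.lolli (σ.at (.var 0)) (.var 0)))
    ?_ (.bang (by simpa [NoLin] using hG') (.ivar (by simpa [NoLin] using hG') rfl))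
  have := HasType.tapp (S := S)
    (G := .lin (mu σ) :: .int (.lolli (σ.at (.var 0)) (.var 0)) :: G.map (Entry.ren Fin.succ))
    (t := .var 0) (.var 0) (.lvar rfl (by simpa [NoLin] using hG'))
  simp only [Ty.arr, Ty.sub, Ty.at_sub] at this
  exact this

theorem foldAt_hasType {n : ℕ} (σ : S.Ty 1) {G : Ctx S n} (hG : NoLin G) {τ : S.Ty n} {f : Tm S n}
    (hf : HasType G f (.lolli (σ.at τ) τ)) : HasType G (foldAt σ τ f) (.lolli (mu σ) τ) := by
  have h := HasType.tapp τ (foldTm_hasType σ hG)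
  simp only [Ty.arr, Ty.sub, Ty.at_sub, mu_sub] at h
  exact .app (Split.self hG) h (.bang hG hf)

/-- The term `in` has type `σ(μα.σ(α)) ⊸ μα.σ(α)`. -/
theorem inTm_hasType {n : ℕ} {σ : S.Ty 1} (hσ : IndConstr σ) (hpos : ¬ σ.Occ false 0)
    {G : Ctx S n} (hG : NoLin G) : HasType G (inTm σ) (.lolli (σ.at (mu σ)) (mu σ)) := by
  have hG' := hG.map (m := n + 1) Fin.succ
  refine .lam (.tlam (.ilam ?_))
  have hN : NoLin (Entry.int (Ty.lolli (σ.at (.var 0)) (.var 0)) :: Entry.off ::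
      G.map (Entry.ren Fin.succ)) := by simpa [NoLin] using hG'
  refine .app (.int _ (.right _ (Split.self hG'))) (σ := σ.at (.var 0)) (.ivar hN rfl) ?_
  refine .app (.int _ (.right _ (Split.self hG'))) (σ := σ.at (mu σ))
    (mapTm_hasType hσ hpos hN (foldAt_hasType σ hN (.ivar hN rfl))) ?_
  refine .lvar ?_ (by simpa [NoLin] using hG')
  simp [Ty.at_ren, mu_ren]

theorem HasType.comp {n : ℕ} {σ τ ω : S.Ty n} {G : Ctx S n} (hG : NoLin G) {g f : Tm S n}
    (hg : HasType G g (.lolli τ ω)) (hf : HasType G f (.lolli σ τ)) :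
    HasType G (.comp σ g f) (.lolli σ ω) :=
  .lam (.app (.right _ (Split.self hG)) (hg.up (by simp))
    (.app (.right _ (Split.self hG)) (hf.up (by simp))
      (.lvar rfl (by simpa [NoLin] using hG))))

theorem HasType.idt {n : ℕ} (σ : S.Ty n) : HasType [] (.idt σ) (.lolli σ σ) :=
  .lam (.lvar rfl (by simp [NoLin]))

theorem noLin_intCtx {n : ℕ} (Γ : List (S.Ty n)) : NoLin (intCtx Γ) := by
  simp [NoLin, intCtx]

/-- Replacement of provably equal closed terms. -/
theorem Proves.replace {T : Theory S} {n : ℕ} {A B : S.Ty n} {t t' w : Tm S n}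
    (ht : HasType [] t A) (ht' : HasType [] t' A) (hw : HasType (intCtx [A]) w B)
    (h1 : HasType [] (w.sub .var (inst1 t)) B)
    (h : Proves T [] [] [] (.eq A t t')) :
    Proves T [] [] [] (.eq B (w.sub .var (inst1 t)) (w.sub .var (inst1 t'))) := by
  have hφ : IsFm T [A, A] [] (.eq B (w.sub .var (inst1 t)) w) :=
    .eq (h1.closed (noLin_intCtx _)) (hw.append (H := [.int A]) (by simp [NoLin]))
  have key : ∀ x : Tm S n, (Fm.eq B (w.sub .var (inst1 t)) w).sub .var (inst2 t x) .rvar =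
      .eq B (w.sub .var (inst1 t)) (w.sub .var (inst1 x)) := by
    intro x
    simp only [Fm.sub, Ty.sub_var, h1.sub_eq]
    rw [hw.sub_congr .var (inst2 t x) (inst1 x) (by
      intro i hi; simp [intCtx] at hi; subst hi; rfl)]
  have d1 := Proves.defrel (T := T) (t := t) (u := t) hφ ht ht
  have d2 := Proves.defrel (T := T) (t := t) (u := t') hφ ht ht'
  rw [key] at d1 d2
  refine .impE (.andE₁ d2) (.eqSubst (.abs hφ) (.impE (.andE₂ d1) ?_) ?_ h)
  · exact .exteq h1 h1 (.refl h1)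
  · exact .exteq ht ht (.refl ht)

theorem Proves.eqRefl {T : Theory S} {n : ℕ} {A : S.Ty n} {t : Tm S n} (h : HasType [] t A) :
    Proves T [] [] [] (.eq A t t) := .exteq h h (.refl h)

theorem Proves.ofExt {T : Theory S} {n : ℕ} {A : S.Ty n} {t w : Tm S n} (h : HasType [] t A)
    (h' : HasType [] w A) (he : ExtEq [] t w A) : Proves T [] [] [] (.eq A t w) := .exteq h h' he

theorem noLin_nil {n : ℕ} : NoLin ([] : Ctx S n) := by simp [NoLin]

theorem Proves.comp_congr {T : Theory S} {n : ℕ} {A B C : S.Ty n} {g g' f f' : Tm S n}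
    (hg : HasType [] g (.lolli B C)) (hg' : HasType [] g' (.lolli B C))
    (hf : HasType [] f (.lolli A B)) (hf' : HasType [] f' (.lolli A B))
    (eg : Proves T [] [] [] (.eq (.lolli B C) g g'))
    (ef : Proves T [] [] [] (.eq (.lolli A B) f f')) :
    Proves T [] [] [] (.eq (.lolli A C) (.comp A g f) (.comp A g' f')) := by
  have k1 : ∀ x : Tm S n, HasType [] x (.lolli B C) →
      (Tm.comp A (.var 0) f).sub .var (inst1 x) = .comp A x f := by
    intro x hx
    simp only [Tm.comp, Tm.sub, Ty.sub_var, hf.up_eq, hf.sub_eq]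
    rfl
  have k2 : ∀ x : Tm S n, HasType [] x (.lolli A B) →
      (Tm.comp A g' (.var 0)).sub .var (inst1 x) = .comp A g' x := by
    intro x hx
    simp only [Tm.comp, Tm.sub, Ty.sub_var, hg'.up_eq, hg'.sub_eq]
    rfl
  have r1 := Proves.replace (w := .comp A (.var 0) f) hg hg'
    (HasType.comp (noLin_intCtx _) (.ivar (noLin_intCtx _) rfl) (hf.closed (noLin_intCtx _)))
    (by rw [k1 g hg]; exact .comp noLin_nil hg hf) eg
  have r2 := Proves.replace (w := .comp A g' (.var 0)) hf hf'
    (HasType.comp (noLin_intCtx _) (hg'.closed (noLin_intCtx _)) (.ivar (noLin_intCtx _) rfl))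
    (by rw [k2 f hf]; exact .comp noLin_nil hg' hf) ef
  rw [k1 g hg, k1 g' hg'] at r1
  rw [k2 f hf, k2 f' hf'] at r2
  exact .eqTrans r1 r2

theorem Proves.mapTm_congr {T : Theory S} {n : ℕ} {σ : S.Ty 1} (hσ : IndConstr σ)
    (hpos : ¬ σ.Occ false 0) {A B : S.Ty n} {f f' : Tm S n}
    (hf : HasType [] f (.lolli A B)) (hf' : HasType [] f' (.lolli A B))
    (ef : Proves T [] [] [] (.eq (.lolli A B) f f')) :
    Proves T [] [] [] (.eq (.lolli (σ.at A) (σ.at B)) (mapTm σ A B f) (mapTm σ A B f')) := by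
  have k : ∀ x : Tm S n, (mapTm σ A B (.var 0)).sub .var (inst1 x) = mapTm σ A B x := by
    intro x
    simp only [mapTm, Tm.sub, Ty.sub_var, (functorTm_hasType hσ hpos noLin_nil).sub_eq]
    rfl
  have r := Proves.replace (w := mapTm σ A B (.var 0)) hf hf'
    (mapTm_hasType hσ hpos (noLin_intCtx _) (.ivar (noLin_intCtx _) rfl))
    (by rw [k f]; exact mapTm_hasType hσ hpos noLin_nil hf) ef
  rwa [k f, k f'] at r

/-- The bound variable of a closed function. -/
theorem HasType.bv {n : ℕ} (A : S.Ty n) : HasType [.lin A] (.var 0) A :=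
  .lvar rfl (by simp [NoLin])

theorem HasType.off {n : ℕ} {t : Tm S n} {A : S.Ty n} (h : HasType [] t A) :
    HasType [.off] t A := h.closed (by simp [NoLin])

theorem Tm.comp_closed {n : ℕ} {A B C : S.Ty n} {g f : Tm S n}
    (hg : HasType [] g (.lolli B C)) (hf : HasType [] f (.lolli A B)) :
    Tm.comp A g f = .lam A (.app g (.app f (.var 0))) := by
  rw [Tm.comp, hg.up_eq, hf.up_eq]

theorem ExtEq.comp_apply {n : ℕ} {A B C D : S.Ty n} {g f x : Tm S n}
    (hg : HasType [] g (.lolli B C)) (hf : HasType [] f (.lolli A B))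
    (hx : HasType [.lin D] x A) :
    ExtEq [.lin D] (.app (.comp A g f) x) (.app g (.app f x)) C := by
  have h := ExtEq.beta (G := [.lin D]) (σ := A) (t := .app g (.app f (.var 0))) (u := x) (τ := C)
    (by
      rw [← Tm.comp_closed hg hf]
      exact .app (.right _ .nil) (HasType.comp noLin_nil hg hf).off hx)
  simp only [Tm.sub, hg.sub_eq, hf.sub_eq] at h
  rw [Tm.comp_closed hg hf]
  exact h

theorem ExtEq.idt_apply {n : ℕ} {A D : S.Ty n} {x : Tm S n} (hx : HasType [.lin D] x A) :
    ExtEq [.lin D] (.app (.idt A) x) x A :=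
  ExtEq.beta (t := .var 0) (.app (.right _ .nil) (HasType.idt A).off hx)

theorem ExtEq.eta_closed {n : ℕ} {A B : S.Ty n} {f : Tm S n} (hf : HasType [] f (.lolli A B)) :
    ExtEq [] (.lam A (.app f (.var 0))) f (.lolli A B) := by
  have := ExtEq.eta hf
  rwa [hf.up_eq] at this

theorem ExtEq.comp_idt {n : ℕ} {A B : S.Ty n} {f : Tm S n} (hf : HasType [] f (.lolli A B)) :
    ExtEq [] (.comp A f (.idt A)) f (.lolli A B) := by
  rw [Tm.comp_closed hf (HasType.idt A)]
  exact .trans (.lam (.app (.right _ .nil) (.refl hf.off) (.idt_apply (.bv A)))) (.eta_closed hf)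

theorem ExtEq.idt_comp {n : ℕ} {A B : S.Ty n} {f : Tm S n} (hf : HasType [] f (.lolli A B)) :
    ExtEq [] (.comp A (.idt B) f) f (.lolli A B) := by
  rw [Tm.comp_closed (HasType.idt B) hf]
  exact .trans (.lam (.idt_apply (.app (.right _ .nil) hf.off (.bv A)))) (.eta_closed hf)

theorem ExtEq.comp_assoc {n : ℕ} {A B C D : S.Ty n} {h g f : Tm S n}
    (hh : HasType [] h (.lolli C D)) (hg : HasType [] g (.lolli B C))
    (hf : HasType [] f (.lolli A B)) :
    ExtEq [] (.comp A h (.comp A g f)) (.comp A (.comp B h g) f) (.lolli A D) := by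
  rw [Tm.comp_closed hh (HasType.comp noLin_nil hg hf),
    Tm.comp_closed (HasType.comp noLin_nil hh hg) hf]
  refine .lam (.trans (.app (.right _ .nil) (.refl hh.off) (.comp_apply hg hf (.bv A))) ?_)
  exact .symm (.comp_apply hh hg (.app (.right _ .nil) hf.off (.bv A)))

end Facts

/-! ## The category of linear functions -/

/-- Objects of the category `LinType_Ξ`, where `Ξ` has `n` type variables. -/
structure LinType {S : Sig.{u, v}} (T : Theory S) (n : ℕ) where
  ty : S.Ty n

/-- Closed terms `Ξ | -; - ⊢ f : σ ⊸ τ`, up to provable internal equality. -/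
def linSetoid {S : Sig.{u, v}} (T : Theory S) {n : ℕ} (σ τ : S.Ty n) :
    Setoid {f : Tm S n // HasType [] f (.lolli σ τ)} where
  r f g := Proves T [] [] [] (.eq (.lolli σ τ) f.1 g.1)
  iseqv := ⟨fun f => .eqRefl f.2, fun h => .eqSymm h, fun h h' => .eqTrans h h'⟩

/-- Morphisms of `LinType_Ξ`. -/
def LinHom {S : Sig.{u, v}} (T : Theory S) {n : ℕ} (σ τ : S.Ty n) : Type (max u v) :=
  Quotient (linSetoid T σ τ)

/-- The class of the term `f`. -/
def LinHom.mk {S : Sig.{u, v}} (T : Theory S) {n : ℕ} {σ τ : S.Ty n} (f : Tm S n)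
    (hf : HasType [] f (.lolli σ τ)) : LinHom T σ τ := Quotient.mk _ ⟨f, hf⟩

/-- The category `LinType_Ξ`. -/
instance {S : Sig.{u, v}} (T : Theory S) (n : ℕ) :
    CategoryTheory.Category.{max u v} (LinType T n) where
  Hom A B := LinHom T A.ty B.ty
  id A := .mk T (.idt A.ty) (.idt A.ty)
  comp {A _ _} f g := Quotient.map₂
    (fun f g => ⟨.comp A.ty g.1 f.1, .comp noLin_nil g.2 f.2⟩)
    (fun f f' hf g g' hg => Proves.comp_congr g.2 g'.2 f.2 f'.2 hg hf) f g
  id_comp := by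
    rintro A B ⟨f⟩
    exact Quotient.sound
      (Proves.ofExt (HasType.comp noLin_nil f.2 (.idt A.ty)) f.2 (.comp_idt f.2))
  comp_id := by
    rintro A B ⟨f⟩
    exact Quotient.sound
      (Proves.ofExt (HasType.comp noLin_nil (.idt B.ty) f.2) f.2 (.idt_comp f.2))
  assoc := by
    rintro A B C D ⟨f⟩ ⟨g⟩ ⟨h⟩
    exact Quotient.sound (Proves.ofExt (HasType.comp noLin_nil h.2 (.comp noLin_nil g.2 f.2))
      (HasType.comp noLin_nil (.comp noLin_nil h.2 g.2) f.2) (.comp_assoc h.2 g.2 f.2))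

/-- The object `σ(τ)`. -/
def typeObj {S : Sig.{u, v}} (T : Theory S) (n : ℕ) (σ : S.Ty 1) (A : LinType T n) : LinType T n :=
  ⟨σ.at A.ty⟩

open CategoryTheory in
/-- The action `[f] ↦ [σ(f)]` of a type `α ⊢ σ` on the morphisms of `LinType_Ξ`. -/
def typeMap {S : Sig.{u, v}} (T : Theory S) (n : ℕ) {σ : S.Ty 1} (hσ : IndConstr σ)
    (hpos : ¬ σ.Occ false 0) {A B : LinType T n} (f : A ⟶ B) :
    typeObj T n σ A ⟶ typeObj T n σ B :=
  Quotient.map (sa := linSetoid T A.ty B.ty) (sb := linSetoid T (σ.at A.ty) (σ.at B.ty))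
    (fun f => ⟨mapTm σ A.ty B.ty f.1, mapTm_hasType hσ hpos noLin_nil f.2⟩)
    (fun f f' h => Proves.mapTm_congr hσ hpos f.2 f'.2 h) f

open CategoryTheory in
/-- The functor laws for `σ`. -/
def IsFunctorial {S : Sig.{u, v}} (T : Theory S) (n : ℕ) {σ : S.Ty 1} (hσ : IndConstr σ)
    (hpos : ¬ σ.Occ false 0) : Prop :=
  (∀ A : LinType T n, typeMap T n hσ hpos (𝟙 A) = 𝟙 (typeObj T n σ A)) ∧
  ∀ {A B C : LinType T n} (f : A ⟶ B) (g : B ⟶ C),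
    typeMap T n hσ hpos (f ≫ g) = typeMap T n hσ hpos f ≫ typeMap T n hσ hpos g

open CategoryTheory in
/-- The functor `LinType_Ξ ⥤ LinType_Ξ` induced by `σ`. -/
def typeFunctor {S : Sig.{u, v}} (T : Theory S) (n : ℕ) {σ : S.Ty 1} (hσ : IndConstr σ)
    (hpos : ¬ σ.Occ false 0) (h : IsFunctorial T n hσ hpos) : LinType T n ⥤ LinType T n where
  obj := typeObj T n σ
  map := typeMap T n hσ hpos
  map_id := h.1
  map_comp := h.2

open CategoryTheory in
/-- The algebra `in : σ(μα.σ(α)) ⊸ μα.σ(α)` for the functor induced by `σ`. -/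
def muAlgebra {S : Sig.{u, v}} (T : Theory S) (n : ℕ) {σ : S.Ty 1} (hσ : IndConstr σ)
    (hpos : ¬ σ.Occ false 0) (h : IsFunctorial T n hσ hpos) :
    Endofunctor.Algebra (typeFunctor T n hσ hpos h) where
  a := ⟨mu σ⟩
  str := LinHom.mk T (inTm σ) (inTm_hasType hσ hpos noLin_nil)

/-- The term `h : μα.σ(α) ⊸ τ` is a map of algebras from `in` to `f : σ(τ) ⊸ τ`, i.e.,
`h ∘ in = f ∘ σ(h)` is provable. -/
def IsAlgMap {S : Sig.{u, v}} (T : Theory S) {n : ℕ} (σ : S.Ty 1) (τ : S.Ty n) (f h : Tm S n) :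
    Prop :=
  HasType [] h (.lolli (mu σ) τ) ∧
  Proves T [] [] [] (.eq (.lolli (σ.at (mu σ)) τ)
    (.comp (σ.at (mu σ)) h (inTm σ)) (.comp (σ.at (mu σ)) f (mapTm σ (mu σ) τ h)))

end LAPL

namespace LAPL

section

variable {K : TySig.{u}} {S : Sig.{u, v}}

/-! ## Renaming and substitution -/

-- The engine is relational parametricity, which identity extension supplies. For a closed type the
-- schema has no relations to plug in, so it says that the relational interpretation of the type is
-- equality. Hence every term of closed type, even one with intuitionistic free variables, is
-- related to itself (`Proves.parametric`).
--
-- Apply this to the term `M_σ`, of type ∏α,β.(α ⊸ β) → σ(α) ⊸ σ(β). If f and g carry an admissible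
-- relation R into an admissible relation R', then σ(f) and σ(g) carry σ[R] into σ[R']
-- (`Proves.mapTm_parametric`). The relation used most is the graph ⟨h⟩ of a map h : A ⊸ B, written
-- as the reindexing of eq_B along (h, id), which makes it admissible.
--
-- Functoriality. The equation σ(id) = id is a structural induction on σ that uses extensionality
-- only (`Proves.act_idt`). Since (h, id) carries ⟨h⟩ into eq_B, and σ[eq_B] is equality, σ[⟨h⟩](x,
-- y) implies σ(h) x = σ(id) y = y (`Proves.graph`); only this inclusion of the graph lemma is
-- needed. For composites, (f, g ∘ f) carries eq_A into ⟨g⟩, so σ(f) x and σ(g ∘ f) x are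
-- σ[⟨g⟩]-related, and the graph lemma gives σ(g)(σ(f) x) = σ(g ∘ f) x (`Proves.mapTm_comp`).
--
-- Initiality. That fold is a map of algebras is a beta computation (`ExtEq.foldAt_in`). For
-- uniqueness, apply parametricity to an element u of μα.σ(α), with α interpreted by the graph of h
-- : A ⊸ B. If h ∘ f = g ∘ σ(h), the graph lemma shows that f and g are related at σ(α) ⊸ α, and
-- therefore h (u A !f) = u B !g (`Proves.mu_natural`). Taking fold α !v for h and `in` for f gives
-- (u μ !in) α !v = u α !v, hence u μ !in = u (`Proves.mu_in`). For any map of algebras h from `in`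
-- to f this yields h u = h (u μ !in) = u τ !f = fold τ !f u (`IsAlgMap.eq_foldAt`).
--
-- One step needs more than plain extensionality: two functions on !σ that agree on all !x are equal
-- (`Proves.arr_ext`). This again follows from identity extension, because the relation !(σ[eq]) is
-- equality on !σ and is defined by testing against functions out of !σ.
--
-- The rest of the development is de Bruijn bookkeeping, the stability of typing and well-formedness
-- under renaming, and introduction and elimination rules for the relational type constructors.

theorem liftTy_liftRen {n m l : ℕ} (f : Fin n → Fin m) (a : Fin m → Ty K l) (i : Fin (n + 1)) :
    liftTy a (liftRen f i) = liftTy (fun j => a (f j)) i :=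
  Fin.cases rfl (fun _ => rfl) i

theorem ren_liftTy {n m l : ℕ} (a : Fin n → Ty K m) (f : Fin m → Fin l) (i : Fin (n + 1)) :
    (liftTy a i).ren (liftRen f) = liftTy (fun j => (a j).ren f) i := by
  refine Fin.cases rfl (fun j => ?_) i
  simp only [liftTy, Fin.cases_succ, Ty.wk, Ty.ren_ren]; rfl

theorem sub_liftTy {n m l : ℕ} (a : Fin n → Ty K m) (b : Fin m → Ty K l) (i : Fin (n + 1)) :
    (liftTy a i).sub (liftTy b) = liftTy (fun j => (a j).sub b) i := by
  refine Fin.cases rfl (fun j => ?_) i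
  simp only [liftTy, Fin.cases_succ, Ty.wk, Ty.sub_ren, Ty.ren_sub]

theorem Ty.ren_eq_sub {n m : ℕ} (f : Fin n → Fin m) (σ : Ty K n) :
    σ.ren f = σ.sub (fun i => .var (f i)) := by
  rw [← Ty.sub_ren f Ty.var, Ty.sub_var]

theorem liftIdx_comp (r q : ℕ → ℕ) (i : ℕ) :
    liftIdx q (liftIdx r i) = liftIdx (fun j => q (r j)) i := by
  cases i <;> rfl

theorem liftIdx_id : liftIdx (fun i => i) = fun i => i := by
  funext i; cases i <;> rfl

/-- The composition laws have a forced order. A lifted substitution contains weakenings, so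
following a substitution by a renaming under a binder already needs the law for two renamings.
Composing two substitutions of terms is avoided; `act_sub` covers the terms that matter. -/
theorem Tm.ren_ren : {n m l : ℕ} → (f : Fin n → Fin m) → (r : ℕ → ℕ) → (g : Fin m → Fin l) →
    (q : ℕ → ℕ) → (t : Tm S n) →
    (t.ren f r).ren g q = t.ren (fun i => g (f i)) (fun i => q (r i))
  | _, _, _, _, _, _, _, .var _ => rfl
  | _, _, _, _, _, _, _, .con _ => rfl
  | _, _, _, _, _, _, _, .star => rfl
  | _, _, _, _, _, _, _, .Y => rfl
  | _, _, _, f, r, g, q, .lam _ t => by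
      simp only [Tm.ren, Ty.ren_ren, t.ren_ren, liftIdx_comp]
  | _, _, _, f, r, g, q, .app t u => by simp only [Tm.ren, t.ren_ren, u.ren_ren]
  | _, _, _, f, r, g, q, .tensor t u => by simp only [Tm.ren, t.ren_ren, u.ren_ren]
  | _, _, _, f, r, g, q, .bang t => by simp only [Tm.ren, t.ren_ren]
  | _, _, _, f, r, g, q, .tlam t => by simp only [Tm.ren, t.ren_ren, liftRen_comp]
  | _, _, _, f, r, g, q, .tapp t _ => by simp only [Tm.ren, Ty.ren_ren, t.ren_ren]
  | _, _, _, f, r, g, q, .letT _ _ t u => by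
      simp only [Tm.ren, Ty.ren_ren, t.ren_ren, u.ren_ren, liftIdx_comp]
  | _, _, _, f, r, g, q, .letB _ t u => by
      simp only [Tm.ren, Ty.ren_ren, t.ren_ren, u.ren_ren, liftIdx_comp]
  | _, _, _, f, r, g, q, .letS t u => by simp only [Tm.ren, t.ren_ren, u.ren_ren]

theorem liftTm_liftIdx {n : ℕ} (r : ℕ → ℕ) (s : ℕ → Tm S n) (i : ℕ) :
    liftTm s (liftIdx r i) = liftTm (fun j => s (r j)) i := by
  cases i <;> rfl

theorem ren_liftTm {n m : ℕ} (s : ℕ → Tm S n) (f : Fin n → Fin m) (r : ℕ → ℕ) (i : ℕ) :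
    (liftTm s i).ren f (liftIdx r) = liftTm (fun j => (s j).ren f r) i := by
  cases i with
  | zero => rfl
  | succ i => simp only [liftTm, Tm.up, Tm.ren_ren]; rfl

theorem Tm.tup_ren {n m : ℕ} (t : Tm S n) (f : Fin n → Fin m) (r : ℕ → ℕ) :
    t.tup.ren (liftRen f) r = (t.ren f r).tup := by
  simp only [Tm.tup, Tm.ren_ren]; rfl

theorem Tm.sub_ren : {n m l : ℕ} → (f : Fin n → Fin m) → (r : ℕ → ℕ) → (a : Fin m → S.Ty l) →
    (s : ℕ → Tm S l) → (t : Tm S n) →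
    (t.ren f r).sub a s = t.sub (fun i => a (f i)) (fun i => s (r i))
  | _, _, _, _, _, _, _, .var _ => rfl
  | _, _, _, _, _, _, _, .con _ => rfl
  | _, _, _, _, _, _, _, .star => rfl
  | _, _, _, _, _, _, _, .Y => rfl
  | _, _, _, f, r, g, q, .lam _ t => by
      simp only [Tm.ren, Tm.sub, Ty.sub_ren, t.sub_ren, liftTm_liftIdx]
  | _, _, _, f, r, g, q, .app t u => by simp only [Tm.ren, Tm.sub, t.sub_ren, u.sub_ren]
  | _, _, _, f, r, g, q, .tensor t u => by simp only [Tm.ren, Tm.sub, t.sub_ren, u.sub_ren]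
  | _, _, _, f, r, g, q, .bang t => by simp only [Tm.ren, Tm.sub, t.sub_ren]
  | _, _, _, f, r, g, q, .tlam t => by simp only [Tm.ren, Tm.sub, t.sub_ren, liftTy_liftRen]
  | _, _, _, f, r, g, q, .tapp t _ => by simp only [Tm.ren, Tm.sub, Ty.sub_ren, t.sub_ren]
  | _, _, _, f, r, g, q, .letT _ _ t u => by
      simp only [Tm.ren, Tm.sub, Ty.sub_ren, t.sub_ren, u.sub_ren, liftTm_liftIdx]
  | _, _, _, f, r, g, q, .letB _ t u => by
      simp only [Tm.ren, Tm.sub, Ty.sub_ren, t.sub_ren, u.sub_ren, liftTm_liftIdx]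
  | _, _, _, f, r, g, q, .letS t u => by simp only [Tm.ren, Tm.sub, t.sub_ren, u.sub_ren]

theorem Tm.ren_sub : {n m l : ℕ} → (a : Fin n → S.Ty m) → (s : ℕ → Tm S m) → (f : Fin m → Fin l) →
    (r : ℕ → ℕ) → (t : Tm S n) →
    (t.sub a s).ren f r = t.sub (fun i => (a i).ren f) (fun i => (s i).ren f r)
  | _, _, _, _, _, _, _, .var _ => rfl
  | _, _, _, _, _, _, _, .con _ => rfl
  | _, _, _, _, _, _, _, .star => rfl
  | _, _, _, _, _, _, _, .Y => rfl
  | _, _, _, f, r, g, q, .lam _ t => by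
      simp only [Tm.ren, Tm.sub, Ty.ren_sub, t.ren_sub, ren_liftTm]
  | _, _, _, f, r, g, q, .app t u => by simp only [Tm.ren, Tm.sub, t.ren_sub, u.ren_sub]
  | _, _, _, f, r, g, q, .tensor t u => by simp only [Tm.ren, Tm.sub, t.ren_sub, u.ren_sub]
  | _, _, _, f, r, g, q, .bang t => by simp only [Tm.ren, Tm.sub, t.ren_sub]
  | _, _, _, f, r, g, q, .tlam t => by
      simp only [Tm.ren, Tm.sub, t.ren_sub, ren_liftTy, Tm.tup_ren]
  | _, _, _, f, r, g, q, .tapp t _ => by simp only [Tm.ren, Tm.sub, Ty.ren_sub, t.ren_sub]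
  | _, _, _, f, r, g, q, .letT _ _ t u => by
      simp only [Tm.ren, Tm.sub, Ty.ren_sub, t.ren_sub, u.ren_sub, ren_liftTm]
  | _, _, _, f, r, g, q, .letB _ t u => by
      simp only [Tm.ren, Tm.sub, Ty.ren_sub, t.ren_sub, u.ren_sub, ren_liftTm]
  | _, _, _, f, r, g, q, .letS t u => by simp only [Tm.ren, Tm.sub, t.ren_sub, u.ren_sub]

/-- Lets facts proved for substitutions, such as `HasType.sub` and the substitution laws for `M_σ`
and fold, serve for renamings as well. -/
theorem Tm.ren_eq_sub {n m : ℕ} (f : Fin n → Fin m) (r : ℕ → ℕ) (t : Tm S n) :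
    t.ren f r = t.sub (fun i => .var (f i)) (fun i => .var (r i)) := by
  rw [← Tm.sub_ren f r Ty.var Tm.var, Tm.sub_var]

theorem Tm.tup_sub {n m : ℕ} (t : Tm S n) (a : Fin n → S.Ty m) (s : ℕ → Tm S m) :
    t.tup.sub (liftTy a) (fun i => (s i).tup) = (t.sub a s).tup := by
  simp only [Tm.tup, Tm.ren_sub, Tm.sub_ren, id]; rfl

theorem Tm.up_sub {n m : ℕ} (t : Tm S n) (a : Fin n → S.Ty m) (s : ℕ → Tm S m) :
    (t.up 1).sub a (liftTm s) = (t.sub a s).up 1 := by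
  simp only [Tm.up, Tm.ren_sub, Tm.sub_ren, id, Ty.ren_id]; rfl

-- Composition of renamings and substitutions in propositions and relations

mutual
theorem Fm.ren_ren : {n m l : ℕ} → (f : Fin n → Fin m) → (r p : ℕ → ℕ) → (g : Fin m → Fin l) →
    (r' p' : ℕ → ℕ) → (φ : Fm S n) → (φ.ren f r p).ren g r' p' =
      φ.ren (fun i => g (f i)) (fun i => r' (r i)) (fun i => p' (p i))
  | _, _, _, _, _, _, _, _, _, .eq _ _ _ => by simp only [Fm.ren, Ty.ren_ren, Tm.ren_ren]
  | _, _, _, _, _, _, _, _, _, .rel ρ _ _ => by simp only [Fm.ren, Tm.ren_ren, ρ.ren_ren]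
  | _, _, _, _, _, _, _, _, _, .imp φ ψ => by simp only [Fm.ren, φ.ren_ren, ψ.ren_ren]
  | _, _, _, _, _, _, _, _, _, .bot => rfl
  | _, _, _, _, _, _, _, _, _, .top => rfl
  | _, _, _, _, _, _, _, _, _, .and φ ψ => by simp only [Fm.ren, φ.ren_ren, ψ.ren_ren]
  | _, _, _, _, _, _, _, _, _, .or φ ψ => by simp only [Fm.ren, φ.ren_ren, ψ.ren_ren]
  | _, _, _, _, _, _, _, _, _, .allT φ => by simp only [Fm.ren, φ.ren_ren, liftRen_comp]
  | _, _, _, _, _, _, _, _, _, .allX _ φ => by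
      simp only [Fm.ren, Ty.ren_ren, φ.ren_ren, liftIdx_comp]
  | _, _, _, _, _, _, _, _, _, .allR _ _ _ φ => by
      simp only [Fm.ren, Ty.ren_ren, φ.ren_ren, liftIdx_comp]
  | _, _, _, _, _, _, _, _, _, .exT φ => by simp only [Fm.ren, φ.ren_ren, liftRen_comp]
  | _, _, _, _, _, _, _, _, _, .exX _ φ => by
      simp only [Fm.ren, Ty.ren_ren, φ.ren_ren, liftIdx_comp]
  | _, _, _, _, _, _, _, _, _, .exR _ _ _ φ => by
      simp only [Fm.ren, Ty.ren_ren, φ.ren_ren, liftIdx_comp]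
theorem RelE.ren_ren : {n m l : ℕ} → (f : Fin n → Fin m) → (r p : ℕ → ℕ) → (g : Fin m → Fin l) →
    (r' p' : ℕ → ℕ) → (ρ : RelE S n) → (ρ.ren f r p).ren g r' p' =
      ρ.ren (fun i => g (f i)) (fun i => r' (r i)) (fun i => p' (p i))
  | _, _, _, _, _, _, _, _, _, .rvar _ => rfl
  | _, _, _, _, _, _, _, _, _, .abs _ _ φ => by
      simp only [RelE.ren, Ty.ren_ren, φ.ren_ren, liftIdx_comp]
  | _, _, _, _, _, _, _, _, _, .interp _ _ ρ => by simp only [RelE.ren, (ρ _).ren_ren]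
end

theorem RelE.up_up {n : ℕ} (ρ : RelE S n) (k l : ℕ) : (ρ.up k).up l = ρ.up (k + l) := by
  simp only [RelE.up, RelE.ren_ren, Nat.add_assoc]; rfl

theorem liftRel_liftIdx {n : ℕ} (p : ℕ → ℕ) (q : ℕ → RelE S n) (i : ℕ) :
    liftRel q (liftIdx p i) = liftRel (fun j => q (p j)) i := by
  cases i <;> rfl

mutual
theorem Fm.sub_ren : {n m l : ℕ} → (f : Fin n → Fin m) → (r p : ℕ → ℕ) → (a : Fin m → S.Ty l) →
    (s : ℕ → Tm S l) → (q : ℕ → RelE S l) → (φ : Fm S n) → (φ.ren f r p).sub a s q =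
      φ.sub (fun i => a (f i)) (fun i => s (r i)) (fun i => q (p i))
  | _, _, _, _, _, _, _, _, _, .eq _ _ _ => by simp only [Fm.ren, Fm.sub, Ty.sub_ren, Tm.sub_ren]
  | _, _, _, _, _, _, _, _, _, .rel ρ _ _ => by simp only [Fm.ren, Fm.sub, Tm.sub_ren, ρ.sub_ren]
  | _, _, _, _, _, _, _, _, _, .imp φ ψ => by simp only [Fm.ren, Fm.sub, φ.sub_ren, ψ.sub_ren]
  | _, _, _, _, _, _, _, _, _, .bot => rfl
  | _, _, _, _, _, _, _, _, _, .top => rfl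
  | _, _, _, _, _, _, _, _, _, .and φ ψ => by simp only [Fm.ren, Fm.sub, φ.sub_ren, ψ.sub_ren]
  | _, _, _, _, _, _, _, _, _, .or φ ψ => by simp only [Fm.ren, Fm.sub, φ.sub_ren, ψ.sub_ren]
  | _, _, _, _, _, _, _, _, _, .allT φ => by
      simp only [Fm.ren, Fm.sub, φ.sub_ren, liftTy_liftRen]
  | _, _, _, _, _, _, _, _, _, .allX _ φ => by
      simp only [Fm.ren, Fm.sub, Ty.sub_ren, φ.sub_ren, liftTm_liftIdx]
  | _, _, _, _, _, _, _, _, _, .allR _ _ _ φ => by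
      simp only [Fm.ren, Fm.sub, Ty.sub_ren, φ.sub_ren, liftRel_liftIdx]
  | _, _, _, _, _, _, _, _, _, .exT φ => by
      simp only [Fm.ren, Fm.sub, φ.sub_ren, liftTy_liftRen]
  | _, _, _, _, _, _, _, _, _, .exX _ φ => by
      simp only [Fm.ren, Fm.sub, Ty.sub_ren, φ.sub_ren, liftTm_liftIdx]
  | _, _, _, _, _, _, _, _, _, .exR _ _ _ φ => by
      simp only [Fm.ren, Fm.sub, Ty.sub_ren, φ.sub_ren, liftRel_liftIdx]
theorem RelE.sub_ren : {n m l : ℕ} → (f : Fin n → Fin m) → (r p : ℕ → ℕ) → (a : Fin m → S.Ty l) →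
    (s : ℕ → Tm S l) → (q : ℕ → RelE S l) → (ρ : RelE S n) → (ρ.ren f r p).sub a s q =
      ρ.sub (fun i => a (f i)) (fun i => s (r i)) (fun i => q (p i))
  | _, _, _, _, _, _, _, _, _, .rvar _ => rfl
  | _, _, _, _, _, _, _, _, _, .abs _ _ φ => by
      simp only [RelE.ren, RelE.sub, Ty.sub_ren, φ.sub_ren, liftTm_liftIdx]
  | _, _, _, _, _, _, _, _, _, .interp _ _ ρ => by simp only [RelE.ren, RelE.sub, (ρ _).sub_ren]
end

theorem RelE.tup_ren {n m : ℕ} (ρ : RelE S n) (f : Fin n → Fin m) (r p : ℕ → ℕ) :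
    ρ.tup.ren (liftRen f) r p = (ρ.ren f r p).tup := by
  simp only [RelE.tup, RelE.ren_ren]; rfl

theorem RelE.up_one_ren {n m : ℕ} (ρ : RelE S n) (f : Fin n → Fin m) (r p : ℕ → ℕ) :
    (ρ.up 1).ren f (liftIdx r) p = (ρ.ren f r p).up 1 := by
  simp only [RelE.up, RelE.ren_ren]; rfl

theorem RelE.up_two_ren {n m : ℕ} (ρ : RelE S n) (f : Fin n → Fin m) (r p : ℕ → ℕ) :
    (ρ.up 2).ren f (liftIdx (liftIdx r)) p = (ρ.ren f r p).up 2 := by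
  simp only [RelE.up, RelE.ren_ren]; rfl

theorem ren_liftRel {n m : ℕ} (q : ℕ → RelE S n) (f : Fin n → Fin m) (r p : ℕ → ℕ) (i : ℕ) :
    (liftRel q i).ren f r (liftIdx p) = liftRel (fun j => (q j).ren f r p) i := by
  cases i with
  | zero => rfl
  | succ i => simp only [liftRel, RelE.rup, RelE.ren_ren]; rfl

mutual
theorem Fm.ren_sub : {n m l : ℕ} → (a : Fin n → S.Ty m) → (s : ℕ → Tm S m) → (q : ℕ → RelE S m) →
    (f : Fin m → Fin l) → (r p : ℕ → ℕ) → (φ : Fm S n) → (φ.sub a s q).ren f r p =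
      φ.sub (fun i => (a i).ren f) (fun i => (s i).ren f r) (fun i => (q i).ren f r p)
  | _, _, _, _, _, _, _, _, _, .eq _ _ _ => by simp only [Fm.ren, Fm.sub, Ty.ren_sub, Tm.ren_sub]
  | _, _, _, _, _, _, _, _, _, .rel ρ _ _ => by simp only [Fm.ren, Fm.sub, Tm.ren_sub, ρ.ren_sub]
  | _, _, _, _, _, _, _, _, _, .imp φ ψ => by simp only [Fm.ren, Fm.sub, φ.ren_sub, ψ.ren_sub]
  | _, _, _, _, _, _, _, _, _, .bot => rfl
  | _, _, _, _, _, _, _, _, _, .top => rfl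
  | _, _, _, _, _, _, _, _, _, .and φ ψ => by simp only [Fm.ren, Fm.sub, φ.ren_sub, ψ.ren_sub]
  | _, _, _, _, _, _, _, _, _, .or φ ψ => by simp only [Fm.ren, Fm.sub, φ.ren_sub, ψ.ren_sub]
  | _, _, _, _, _, _, _, _, _, .allT φ => by
      simp only [Fm.ren, Fm.sub, φ.ren_sub, ren_liftTy, Tm.tup_ren, RelE.tup_ren]
  | _, _, _, _, _, _, _, _, _, .allX _ φ => by
      simp only [Fm.ren, Fm.sub, Ty.ren_sub, φ.ren_sub, ren_liftTm, RelE.up_one_ren]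
  | _, _, _, _, _, _, _, _, _, .allR _ _ _ φ => by
      simp only [Fm.ren, Fm.sub, Ty.ren_sub, φ.ren_sub, ren_liftRel]
  | _, _, _, _, _, _, _, _, _, .exT φ => by
      simp only [Fm.ren, Fm.sub, φ.ren_sub, ren_liftTy, Tm.tup_ren, RelE.tup_ren]
  | _, _, _, _, _, _, _, _, _, .exX _ φ => by
      simp only [Fm.ren, Fm.sub, Ty.ren_sub, φ.ren_sub, ren_liftTm, RelE.up_one_ren]
  | _, _, _, _, _, _, _, _, _, .exR _ _ _ φ => by
      simp only [Fm.ren, Fm.sub, Ty.ren_sub, φ.ren_sub, ren_liftRel]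
theorem RelE.ren_sub : {n m l : ℕ} → (a : Fin n → S.Ty m) → (s : ℕ → Tm S m) →
    (q : ℕ → RelE S m) → (f : Fin m → Fin l) → (r p : ℕ → ℕ) → (ρ : RelE S n) →
    (ρ.sub a s q).ren f r p =
      ρ.sub (fun i => (a i).ren f) (fun i => (s i).ren f r) (fun i => (q i).ren f r p)
  | _, _, _, _, _, _, _, _, _, .rvar _ => rfl
  | _, _, _, _, _, _, _, _, _, .abs _ _ φ => by
      simp only [RelE.ren, RelE.sub, Ty.ren_sub, φ.ren_sub, ren_liftTm, RelE.up_two_ren]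
  | _, _, _, _, _, _, _, _, _, .interp _ _ ρ => by simp only [RelE.ren, RelE.sub, (ρ _).ren_sub]
end

theorem liftRel_rvar {n : ℕ} : liftRel (RelE.rvar : ℕ → RelE S n) = RelE.rvar := by
  funext i; cases i <;> rfl

theorem Tm.var_tup {n : ℕ} : (fun i => (Tm.var i : Tm S n).tup) = Tm.var := rfl

theorem RelE.rvar_tup {n : ℕ} : (fun i => (RelE.rvar i : RelE S n).tup) = RelE.rvar := by
  funext i; simp only [RelE.tup, RelE.ren, id]

theorem RelE.rvar_up {n : ℕ} (k : ℕ) : (fun i => (RelE.rvar i : RelE S n).up k) = RelE.rvar := by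
  funext i; simp only [RelE.up, RelE.ren, id]

mutual
theorem Fm.sub_var : {n : ℕ} → (φ : Fm S n) → φ.sub .var .var .rvar = φ
  | _, .eq _ _ _ => by simp only [Fm.sub, Ty.sub_var, Tm.sub_var]
  | _, .rel ρ _ _ => by simp only [Fm.sub, Tm.sub_var, ρ.sub_var]
  | _, .imp φ ψ => by simp only [Fm.sub, φ.sub_var, ψ.sub_var]
  | _, .bot => rfl
  | _, .top => rfl
  | _, .and φ ψ => by simp only [Fm.sub, φ.sub_var, ψ.sub_var]
  | _, .or φ ψ => by simp only [Fm.sub, φ.sub_var, ψ.sub_var]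
  | _, .allT φ => by simp only [Fm.sub, liftTy_var, Tm.var_tup, RelE.rvar_tup, φ.sub_var]
  | _, .allX _ φ => by simp only [Fm.sub, Ty.sub_var, liftTm_var, RelE.rvar_up, φ.sub_var]
  | _, .allR _ _ _ φ => by simp only [Fm.sub, Ty.sub_var, liftRel_rvar, φ.sub_var]
  | _, .exT φ => by simp only [Fm.sub, liftTy_var, Tm.var_tup, RelE.rvar_tup, φ.sub_var]
  | _, .exX _ φ => by simp only [Fm.sub, Ty.sub_var, liftTm_var, RelE.rvar_up, φ.sub_var]
  | _, .exR _ _ _ φ => by simp only [Fm.sub, Ty.sub_var, liftRel_rvar, φ.sub_var]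
theorem RelE.sub_var : {n : ℕ} → (ρ : RelE S n) → ρ.sub .var .var .rvar = ρ
  | _, .rvar _ => rfl
  | _, .abs _ _ φ => by simp only [RelE.sub, Ty.sub_var, liftTm_var, RelE.rvar_up, φ.sub_var]
  | _, .interp _ _ ρ => by simp only [RelE.sub, (ρ _).sub_var]
end

/-- The logic has a substitution rule but no separate renaming rule. Reading a renaming as a
substitution of variables makes renaming an instance of that rule. -/
theorem Fm.ren_eq_sub {n m : ℕ} (f : Fin n → Fin m) (r p : ℕ → ℕ) (φ : Fm S n) :
    φ.ren f r p = φ.sub (fun i => .var (f i)) (fun i => .var (r i)) (fun i => .rvar (p i)) := by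
  rw [← Fm.sub_ren f r p Ty.var Tm.var RelE.rvar, Fm.sub_var]

theorem RelE.ren_eq_sub {n m : ℕ} (f : Fin n → Fin m) (r p : ℕ → ℕ) (ρ : RelE S n) :
    ρ.ren f r p = ρ.sub (fun i => .var (f i)) (fun i => .var (r i)) (fun i => .rvar (p i)) := by
  rw [← RelE.sub_ren f r p Ty.var Tm.var RelE.rvar, RelE.sub_var]

end

section

variable {K : TySig.{u}} {S : Sig.{u, v}}

/-! ## Typing of renamed and substituted terms -/

theorem Ty.instTy_ren {n m : ℕ} (σ : Ty K (n + 1)) (τ : Ty K n) (f : Fin n → Fin m) :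
    (σ.sub (instTy τ)).ren f = (σ.ren (liftRen f)).sub (instTy (τ.ren f)) := by
  rw [Ty.ren_sub, Ty.sub_ren]
  congr 1; funext i; exact Fin.cases rfl (fun _ => rfl) i

theorem Ty.wk_sub_instTy {n : ℕ} (σ τ : Ty K n) : σ.wk.sub (instTy τ) = σ := by
  rw [Ty.wk, Ty.sub_ren]; exact σ.sub_var

/-- The usual substitution lemma; it matches the type of a type application before and after
substitution. -/
theorem Ty.instTy_sub {n m : ℕ} (σ : Ty K (n + 1)) (τ : Ty K n) (a : Fin n → Ty K m) :
    (σ.sub (instTy τ)).sub a = (σ.sub (liftTy a)).sub (instTy (τ.sub a)) := by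
  rw [Ty.sub_sub, Ty.sub_sub]
  congr 1; funext i
  refine Fin.cases rfl (fun j => ?_) i
  simp only [instTy, liftTy, Fin.cases_succ, Ty.sub]
  exact (Ty.wk_sub_instTy _ _).symm

theorem Ty.wk_sub_liftTy {n m : ℕ} (σ : Ty K n) (a : Fin n → Ty K m) :
    σ.wk.sub (liftTy a) = (σ.sub a).wk := by
  simp only [Ty.wk, Ty.sub_ren, Ty.ren_sub]; rfl

theorem Ty.close_ren {n m : ℕ} (σ : Ty K 0) (f : Fin n → Fin m) :
    (σ.close : Ty K n).ren f = σ.close := by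
  rw [Ty.close, Ty.ren_ren]; congr 1; funext i; exact i.elim0

theorem Ty.close_sub {n m : ℕ} (σ : Ty K 0) (a : Fin n → Ty K m) :
    (σ.close : Ty K n).sub a = σ.close := by
  rw [Ty.close, Ty.sub_ren, Ty.close, Ty.ren_eq_sub]; congr 1; funext i; exact i.elim0

-- Stability of typing under renaming and substitution

theorem Split.map {n m : ℕ} (f : Fin n → Fin m) {G G₁ G₂ : Ctx S n} (h : Split G G₁ G₂) :
    Split (G.map (Entry.ren f)) (G₁.map (Entry.ren f)) (G₂.map (Entry.ren f)) := by
  induction h with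
  | nil => exact .nil
  | int σ _ ih => exact .int _ ih
  | left σ _ ih => exact .left _ ih
  | right σ _ ih => exact .right _ ih
  | off _ ih => exact .off ih

theorem map_liftRen_succ {n m : ℕ} (f : Fin n → Fin m) (G : Ctx S n) :
    (G.map (Entry.ren Fin.succ)).map (Entry.ren (liftRen f)) =
      (G.map (Entry.ren f)).map (Entry.ren Fin.succ) := by
  simp only [List.map_map]
  congr 1; funext e
  cases e <;> simp only [Function.comp, Entry.ren, Ty.ren_ren] <;> rfl

/-- Comes before the substitution lemma because it is needed there: below a type abstraction the
substituted terms are weakened by a type variable and must remain well typed. -/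
theorem HasType.tren {n : ℕ} {G : Ctx S n} {t : Tm S n} {τ : S.Ty n} (h : HasType G t τ) :
    ∀ {m : ℕ} (f : Fin n → Fin m),
      HasType (G.map (Entry.ren f)) (t.ren f (fun i => i)) (τ.ren f) := by
  induction h with
  | star h => intro m f; exact .star (h.map f)
  | Y h => intro m f; exact .Y (h.map f)
  | con c h => intro m f; rw [Ty.close_ren]; exact .con c (h.map f)
  | ivar h hi =>
    intro m f
    exact .ivar (h.map f) (by rw [List.getElem?_map, hi]; rfl)
  | lvar hi h =>
    intro m f
    refine .lvar (by rw [List.getElem?_map, hi]; rfl) ?_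
    have := h.map f
    rwa [List.map_set] at this
  | app hs _ _ h1 h2 => intro m f; exact .app (hs.map f) (h1 f) (h2 f)
  | tensor hs _ _ h1 h2 => intro m f; exact .tensor (hs.map f) (h1 f) (h2 f)
  | letS hs _ _ h1 h2 => intro m f; exact .letS (hs.map f) (h1 f) (h2 f)
  | lam _ ih => intro m f; simp only [Tm.ren, liftIdx_id]; exact .lam (ih f)
  | bang h _ ih => intro m f; exact .bang (h.map f) (ih f)
  | tlam _ ih =>
    intro m f
    refine .tlam ?_
    rw [← map_liftRen_succ]
    exact ih (liftRen f)
  | tapp τ _ ih =>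
    intro m f
    rw [Ty.instTy_ren]
    exact .tapp _ (ih f)
  | letT hs _ _ h1 h2 =>
    intro m f; simp only [Tm.ren, liftIdx_id]; exact .letT (hs.map f) (h1 f) (h2 f)
  | letB hs _ _ h1 h2 =>
    intro m f; simp only [Tm.ren, liftIdx_id]; exact .letB (hs.map f) (h1 f) (h2 f)

/-- Substitution in the types of an entry. -/
def Entry.sub {n m : ℕ} (a : Fin n → S.Ty m) : Entry S n → Entry S m
  | .int σ => .int (σ.sub a)
  | .lin σ => .lin (σ.sub a)
  | .off => .off

/-- The lift of a term substitution under `k` binders. -/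
def liftTms {n : ℕ} : ℕ → (ℕ → Tm S n) → ℕ → Tm S n
  | 0, s => s
  | k + 1, s => liftTm (liftTms k s)

theorem liftTm_tup {n : ℕ} (s : ℕ → Tm S n) :
    (fun i => (liftTm s i).tup) = liftTm (fun i => (s i).tup) := by
  funext i
  cases i with
  | zero => rfl
  | succ i => simp only [liftTm, Tm.tup, Tm.up, Tm.ren_ren]; rfl

theorem liftTms_tup {n : ℕ} (k : ℕ) (s : ℕ → Tm S n) :
    (fun i => (liftTms k s i).tup) = liftTms k (fun i => (s i).tup) := by
  induction k with
  | zero => rfl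
  | succ k ih => rw [liftTms, liftTm_tup, ih]; rfl

theorem noLin_map_sub {n m : ℕ} (a : Fin n → S.Ty m) {H : Ctx S n} {Γ : List (S.Ty n)}
    {Γ' : List (S.Ty m)} (h : NoLin (H ++ intCtx Γ)) :
    NoLin (H.map (Entry.sub a) ++ intCtx Γ') := by
  refine NoLin.append (fun σ hm => ?_) (noLin_intCtx _)
  obtain ⟨e, he, h'⟩ := List.mem_map.1 hm
  cases e with
  | int _ => cases h'
  | off => cases h'
  | lin τ => exact h τ (List.mem_append_left _ he)

/-- A splitting distributes linear variables only, and these all lie in `H`; the intuitionistic tail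
is copied to both sides and may be exchanged for another one. The lengths are recorded because they
count the lifts of the substitution. -/
theorem Split.map_sub {n m : ℕ} (a : Fin n → S.Ty m) {Γ : List (S.Ty n)} {Γ' : List (S.Ty m)} :
    ∀ {H G₁ G₂ : Ctx S n}, Split (H ++ intCtx Γ) G₁ G₂ → ∃ H₁ H₂ : Ctx S n,
      G₁ = H₁ ++ intCtx Γ ∧ G₂ = H₂ ++ intCtx Γ ∧ H₁.length = H.length ∧ H₂.length = H.length ∧
      Split (H.map (Entry.sub a) ++ intCtx Γ') (H₁.map (Entry.sub a) ++ intCtx Γ')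
        (H₂.map (Entry.sub a) ++ intCtx Γ')
  | [], G₁, G₂, h => by
    -- A purely intuitionistic context splits only into two copies of itself.
    have : ∀ {Γ : List (S.Ty n)} {G₁ G₂}, Split (intCtx Γ) G₁ G₂ →
        G₁ = intCtx Γ ∧ G₂ = intCtx Γ := by
      intro Γ
      induction Γ with
      | nil => intro G₁ G₂ h; cases h; exact ⟨rfl, rfl⟩
      | cons σ Γ ih =>
        intro G₁ G₂ h
        simp only [intCtx, List.map_cons] at h
        cases h with
        | int _ h => obtain ⟨rfl, rfl⟩ := ih h; exact ⟨rfl, rfl⟩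
    obtain ⟨rfl, rfl⟩ := this h
    exact ⟨[], [], rfl, rfl, rfl, rfl, Split.self (noLin_intCtx _)⟩
  | e :: H, G₁, G₂, h => by
    simp only [List.cons_append] at h
    cases h with
    | int σ h =>
      obtain ⟨H₁, H₂, rfl, rfl, l1, l2, h⟩ := Split.map_sub a (Γ' := Γ') h
      exact ⟨.int σ :: H₁, .int σ :: H₂, rfl, rfl, by simp [l1], by simp [l2], .int _ h⟩
    | left σ h =>
      obtain ⟨H₁, H₂, rfl, rfl, l1, l2, h⟩ := Split.map_sub a (Γ' := Γ') h
      exact ⟨.lin σ :: H₁, .off :: H₂, rfl, rfl, by simp [l1], by simp [l2], .left _ h⟩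
    | right σ h =>
      obtain ⟨H₁, H₂, rfl, rfl, l1, l2, h⟩ := Split.map_sub a (Γ' := Γ') h
      exact ⟨.off :: H₁, .lin σ :: H₂, rfl, rfl, by simp [l1], by simp [l2], .right _ h⟩
    | off h =>
      obtain ⟨H₁, H₂, rfl, rfl, l1, l2, h⟩ := Split.map_sub a (Γ' := Γ') h
      exact ⟨.off :: H₁, .off :: H₂, rfl, rfl, by simp [l1], by simp [l2], .off h⟩

/-- The lifted substitution fixes the variables of `H` and sends those of `Γ` to weakened terms. The
weakening crosses entries of `H`, which is harmless here since none of them is linear. -/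
theorem hasType_liftTms_int {n m : ℕ} {a : Fin n → S.Ty m} {Γ : List (S.Ty n)}
    {Γ' : List (S.Ty m)} {s : ℕ → Tm S m}
    (hs : ∀ i σ, Γ[i]? = some σ → HasType (intCtx Γ') (s i) (σ.sub a)) :
    ∀ {H : Ctx S n} {i : ℕ} {σ : S.Ty n}, NoLin (H ++ intCtx Γ) →
      (H ++ intCtx Γ)[i]? = some (.int σ) →
      HasType (H.map (Entry.sub a) ++ intCtx Γ') (liftTms H.length s i) (σ.sub a)
  | [], i, σ, _, hi => by
    refine hs i σ ?_
    simp only [List.nil_append, intCtx, List.getElem?_map, Option.map_eq_some_iff] at hi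
    obtain ⟨σ', h, h'⟩ := hi
    cases h'; exact h
  | e :: H, 0, σ, h, hi => by
    simp only [List.cons_append, List.getElem?_cons_zero, Option.some.injEq] at hi
    subst hi
    exact .ivar (noLin_map_sub a h) rfl
  | e :: H, i + 1, σ, h, hi => by
    refine HasType.up (hasType_liftTms_int (H := H) (i := i) hs (fun σ hm => h σ (List.mem_cons_of_mem _ hm)) hi) ?_
    intro τ he
    exact noLin_map_sub (Γ' := Γ') a h τ (by rw [← he]; exact List.mem_cons_self)

/-- A linear variable can only sit in `H`, where the substitution fixes it. Every entry crossed on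
the way to it is nonlinear, because the variable is the only linear one. -/
theorem hasType_liftTms_lin {n m : ℕ} {a : Fin n → S.Ty m} {Γ : List (S.Ty n)}
    {Γ' : List (S.Ty m)} {s : ℕ → Tm S m} :
    ∀ {H : Ctx S n} {i : ℕ} {σ : S.Ty n}, (H ++ intCtx Γ)[i]? = some (.lin σ) →
      NoLin ((H ++ intCtx Γ).set i .off) →
      HasType (H.map (Entry.sub a) ++ intCtx Γ') (liftTms H.length s i) (σ.sub a)
  | [], i, σ, hi, _ => absurd (List.mem_iff_getElem?.2 ⟨i, hi⟩) (noLin_intCtx _ σ)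
  | e :: H, 0, σ, hi, h => by
    simp only [List.cons_append, List.getElem?_cons_zero, Option.some.injEq] at hi
    subst hi
    exact .lvar rfl (noLin_map_sub (H := .off :: H) a h)
  | e :: H, i + 1, σ, hi, h => by
    rw [List.cons_append, List.set_cons_succ] at h
    refine HasType.up (hasType_liftTms_lin (H := H) (i := i) hi (fun σ hm => h σ (List.mem_cons_of_mem _ hm))) ?_
    intro τ he
    cases e with
    | int _ => cases he
    | off => cases he
    | lin τ => exact h τ List.mem_cons_self

/-- Types may be substituted for type variables and intuitionistic terms for intuitionistic
variables. -/
theorem HasType.sub_append {n : ℕ} {G : Ctx S n} {t : Tm S n} {τ : S.Ty n} (h : HasType G t τ) :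
    ∀ {m : ℕ} {a : Fin n → S.Ty m} {H : Ctx S n} {Γ : List (S.Ty n)} {Γ' : List (S.Ty m)}
      {s : ℕ → Tm S m}, G = H ++ intCtx Γ →
      (∀ i σ, Γ[i]? = some σ → HasType (intCtx Γ') (s i) (σ.sub a)) →
      HasType (H.map (Entry.sub a) ++ intCtx Γ') (t.sub a (liftTms H.length s)) (τ.sub a) := by
  -- `H` collects the variables bound on the way down. Only these may be linear, and the
  -- substitution leaves them alone.
  induction h with
  | star h => rintro m a H Γ Γ' s rfl hs; exact .star (noLin_map_sub a h)
  | Y h => rintro m a H Γ Γ' s rfl hs; exact .Y (noLin_map_sub a h)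
  | con c h =>
    rintro m a H Γ Γ' s rfl hs; rw [Ty.close_sub]; exact .con c (noLin_map_sub a h)
  | ivar h hi => rintro m a H Γ Γ' s rfl hs; exact hasType_liftTms_int hs h hi
  | lvar hi h => rintro m a H Γ Γ' s rfl hs; exact hasType_liftTms_lin hi h
  | app hs _ _ h1 h2 =>
    rintro m a H Γ Γ' s rfl hs'
    obtain ⟨H₁, H₂, rfl, rfl, l1, l2, hs⟩ := hs.map_sub a (Γ' := Γ')
    exact .app hs (l1 ▸ h1 rfl hs') (l2 ▸ h2 rfl hs')
  | tensor hs _ _ h1 h2 =>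
    rintro m a H Γ Γ' s rfl hs'
    obtain ⟨H₁, H₂, rfl, rfl, l1, l2, hs⟩ := hs.map_sub a (Γ' := Γ')
    exact .tensor hs (l1 ▸ h1 rfl hs') (l2 ▸ h2 rfl hs')
  | letS hs _ _ h1 h2 =>
    rintro m a H Γ Γ' s rfl hs'
    obtain ⟨H₁, H₂, rfl, rfl, l1, l2, hs⟩ := hs.map_sub a (Γ' := Γ')
    exact .letS hs (l1 ▸ h1 rfl hs') (l2 ▸ h2 rfl hs')
  | lam _ ih => rintro m a H Γ Γ' s rfl hs; exact .lam (ih (H := _ :: H) rfl hs)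
  | bang h _ ih => rintro m a H Γ Γ' s rfl hs; exact .bang (noLin_map_sub a h) (ih rfl hs)
  | @tlam n G t σ _ ih =>
    rintro m a H Γ Γ' s rfl hs
    refine .tlam ?_
    rw [liftTms_tup]
    -- Below the type abstraction the induction hypothesis is used for the lifted type substitution,
    -- with `H`, both contexts and all substituted terms weakened by a type variable.
    have := ih (m := m + 1) (a := liftTy a) (H := H.map (Entry.ren Fin.succ)) (Γ := Γ.map Ty.wk)
      (Γ' := Γ'.map Ty.wk) (s := fun i => (s i).tup)
      (by simp only [List.map_append, intCtx, List.map_map]; rfl) ?_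
    · simp only [List.length_map, List.map_map] at this
      convert this using 1
      simp only [List.map_append, intCtx, List.map_map]
      congr 1
      congr 1; funext e
      cases e <;> simp only [Function.comp, Entry.ren, Entry.sub]
      all_goals exact congrArg _ (Ty.wk_sub_liftTy _ a).symm
    · intro i σ hi
      simp only [List.getElem?_map, Option.map_eq_some_iff] at hi
      obtain ⟨σ, hi, rfl⟩ := hi
      have := (hs i σ hi).tren (m := m + 1) Fin.succ
      rw [Ty.wk_sub_liftTy, intCtx, List.map_map]
      simp only [intCtx, List.map_map] at this
      exact this
  | tapp τ _ ih =>
    rintro m a H Γ Γ' s rfl hs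
    rw [Ty.instTy_sub]
    exact .tapp _ (ih rfl hs)
  | letT hs _ _ h1 h2 =>
    rintro m a H Γ Γ' s rfl hs'
    obtain ⟨H₁, H₂, rfl, rfl, l1, l2, hs⟩ := hs.map_sub a (Γ' := Γ')
    exact .letT hs (l1 ▸ h1 rfl hs') (l2 ▸ h2 (H := _ :: _ :: H₂) rfl hs')
  | letB hs _ _ h1 h2 =>
    rintro m a H Γ Γ' s rfl hs'
    obtain ⟨H₁, H₂, rfl, rfl, l1, l2, hs⟩ := hs.map_sub a (Γ' := Γ')
    exact .letB hs (l1 ▸ h1 rfl hs') (l2 ▸ h2 (H := _ :: H₂) rfl hs')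

theorem HasType.sub {n m : ℕ} {Γ : List (S.Ty n)} {t : Tm S n} {τ : S.Ty n}
    (h : HasType (intCtx Γ) t τ) {a : Fin n → S.Ty m} {Γ' : List (S.Ty m)} {s : ℕ → Tm S m}
    (hs : ∀ i σ, Γ[i]? = some σ → HasType (intCtx Γ') (s i) (σ.sub a)) :
    HasType (intCtx Γ') (t.sub a s) (τ.sub a) :=
  h.sub_append (H := []) rfl hs

/-- The renaming `f`, `r` maps the variables of `Γ` to variables of `Γ'`. -/
def VarRen {n m : ℕ} (f : Fin n → Fin m) (r : ℕ → ℕ) (Γ : List (S.Ty n)) (Γ' : List (S.Ty m)) :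
    Prop :=
  ∀ i σ, Γ[i]? = some σ → Γ'[r i]? = some (σ.ren f)

theorem HasType.var {n : ℕ} {Γ : List (S.Ty n)} {i : ℕ} {σ : S.Ty n} (h : Γ[i]? = some σ) :
    HasType (intCtx Γ) (.var i) σ :=
  .ivar (noLin_intCtx _) (by simp [intCtx, h])

theorem VarRen.hasType {n m : ℕ} {f : Fin n → Fin m} {r : ℕ → ℕ} {Γ : List (S.Ty n)}
    {Γ' : List (S.Ty m)} (h : VarRen f r Γ Γ') (i : ℕ) (σ : S.Ty n) (hi : Γ[i]? = some σ) :
    HasType (intCtx Γ') (.var (r i)) (σ.sub (fun j => .var (f j))) := by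
  rw [← Ty.ren_eq_sub]; exact .var (h i σ hi)

theorem VarRen.lift {n m : ℕ} {f : Fin n → Fin m} {r : ℕ → ℕ} {Γ : List (S.Ty n)}
    {Γ' : List (S.Ty m)} (h : VarRen f r Γ Γ') (σ : S.Ty n) :
    VarRen f (liftIdx r) (σ :: Γ) (σ.ren f :: Γ')
  | 0, τ, hi => by cases hi; rfl
  | i + 1, τ, hi => h i τ hi

theorem VarRen.wk {n m : ℕ} {f : Fin n → Fin m} {r : ℕ → ℕ} {Γ : List (S.Ty n)}
    {Γ' : List (S.Ty m)} (h : VarRen f r Γ Γ') :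
    VarRen (liftRen f) r (Γ.map Ty.wk) (Γ'.map Ty.wk) := by
  intro i σ hi
  simp only [List.getElem?_map, Option.map_eq_some_iff] at hi ⊢
  obtain ⟨σ, hi, rfl⟩ := hi
  exact ⟨_, h i σ hi, by simp only [Ty.wk, Ty.ren_ren]; rfl⟩

theorem HasType.ren {n m : ℕ} {Γ : List (S.Ty n)} {t : Tm S n} {τ : S.Ty n}
    (h : HasType (intCtx Γ) t τ) {f : Fin n → Fin m} {r : ℕ → ℕ} {Γ' : List (S.Ty m)}
    (hr : VarRen f r Γ Γ') : HasType (intCtx Γ') (t.ren f r) (τ.ren f) := by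
  rw [Tm.ren_eq_sub, Ty.ren_eq_sub]
  exact h.sub hr.hasType

/-- Renaming of type variables. -/
def RDecl.ren {n m : ℕ} (f : Fin n → Fin m) (d : RDecl S n) : RDecl S m :=
  ⟨d.adm, d.dom.ren f, d.cod.ren f⟩

/-- The renaming `f`, `q` maps the relation variables of `Θ` to relation variables of `Θ'`. -/
def RelRen {n m : ℕ} (f : Fin n → Fin m) (q : ℕ → ℕ) (Θ : List (RDecl S n))
    (Θ' : List (RDecl S m)) : Prop :=
  ∀ i d, Θ[i]? = some d → Θ'[q i]? = some (d.ren f)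

theorem RelRen.lift {n m : ℕ} {f : Fin n → Fin m} {r : ℕ → ℕ} {Θ : List (RDecl S n)}
    {Θ' : List (RDecl S m)} (h : RelRen f r Θ Θ') (d : RDecl S n) :
    RelRen f (liftIdx r) (d :: Θ) (d.ren f :: Θ')
  | 0, τ, hi => by cases hi; rfl
  | i + 1, τ, hi => h i τ hi

theorem RelRen.wk {n m : ℕ} {f : Fin n → Fin m} {r : ℕ → ℕ} {Θ : List (RDecl S n)}
    {Θ' : List (RDecl S m)} (h : RelRen f r Θ Θ') :
    RelRen (liftRen f) r (Θ.map RDecl.wk) (Θ'.map RDecl.wk) := by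
  intro i σ hi
  simp only [List.getElem?_map, Option.map_eq_some_iff] at hi ⊢
  obtain ⟨σ, hi, rfl⟩ := hi
  exact ⟨_, h i σ hi, by simp only [RDecl.ren, RDecl.wk, Ty.wk, Ty.ren_ren]; rfl⟩

theorem RelE.eqr_ren {n m : ℕ} (f : Fin n → Fin m) (r q : ℕ → ℕ) (σ : S.Ty n) :
    (RelE.eqr σ).ren f r q = .eqr (σ.ren f) := by
  simp [RelE.eqr, RelE.graph, RelE.ren, Fm.ren, Tm.up, Tm.idt, Tm.ren, Ty.ren_id, liftIdx]

theorem RelE.eqr_sub {n m : ℕ} (a : Fin n → S.Ty m) (s : ℕ → Tm S m) (q : ℕ → RelE S m)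
    (σ : S.Ty n) : (RelE.eqr σ).sub a s q = .eqr (σ.sub a) := by
  simp [RelE.eqr, RelE.graph, RelE.sub, Fm.sub, Tm.up, Tm.idt, Tm.ren, Tm.sub, Ty.ren_id, liftIdx,
    liftTm]

theorem RelE.pull_ren {n m : ℕ} (f : Fin n → Fin m) (r q : ℕ → ℕ) (σ τ : S.Ty n) (t u : Tm S n)
    (ρ : RelE S n) : (RelE.pull σ τ t u ρ).ren f r q =
      .pull (σ.ren f) (τ.ren f) (t.ren f r) (u.ren f r) (ρ.ren f r q) := by
  simp [RelE.pull, RelE.ren, Fm.ren, Tm.up, Tm.ren, RelE.up, RelE.ren_ren, Tm.ren_ren, liftIdx]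

theorem Fm.equiv_ren {n m : ℕ} (f : Fin n → Fin m) (r q : ℕ → ℕ) (σ τ : S.Ty n)
    (ρ ρ' : RelE S n) : (Fm.equiv σ τ ρ ρ').ren f r q =
      .equiv (σ.ren f) (τ.ren f) (ρ.ren f r q) (ρ'.ren f r q) := by
  simp [Fm.equiv, Fm.iff, Fm.ren, Tm.ren, RelE.up, RelE.ren_ren, liftIdx]

/-- The instance of the substitution rule in which variables replace variables. A relation variable
goes to one with the same admissibility flag, as the rule demands. -/
theorem Proves.ren {T : Theory S} {n m : ℕ} {Γ : List (S.Ty n)} {Θ : List (RDecl S n)}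
    {Φ : List (Fm S n)} {φ : Fm S n} (h : Proves T Γ Θ Φ φ) {f : Fin n → Fin m} {r q : ℕ → ℕ}
    {Γ' : List (S.Ty m)} {Θ' : List (RDecl S m)} (hr : VarRen f r Γ Γ') (hq : RelRen f q Θ Θ') :
    Proves T Γ' Θ' (Φ.map (Fm.ren f r q)) (φ.ren f r q) := by
  have := h.sub (fun i => .var (f i)) (fun i => .var (r i)) (fun i => .rvar (q i)) hr.hasType
    (Θ' := Θ') (fun i b σ τ hi => .rvar (by
      rw [hq i _ hi]; simp only [RDecl.ren, Ty.ren_eq_sub]))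
  rw [← Fm.ren_eq_sub] at this
  convert this using 2
  funext χ; exact Fm.ren_eq_sub f r q χ

-- Well-formedness is mutual with provability, because the rule `congr` has a proof as a premise.
-- The recursion need not enter that proof: `Proves.ren` renames it outright.
mutual
theorem IsRel.ren {T : Theory S} : ∀ {b : Bool} {n m : ℕ} {Γ : List (S.Ty n)}
    {Θ : List (RDecl S n)} {ρ : RelE S n} {σ τ : S.Ty n}, IsRel T b Γ Θ ρ σ τ →
    ∀ {f : Fin n → Fin m} {r q : ℕ → ℕ} {Γ' : List (S.Ty m)} {Θ' : List (RDecl S m)},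
    VarRen f r Γ Γ' → RelRen f q Θ Θ' → IsRel T b Γ' Θ' (ρ.ren f r q) (σ.ren f) (τ.ren f)
  | _, _, _, _, _, _, _, _, .rvar h, _, _, _, _, _, hr, hq => .rvar (hq _ _ h)
  | _, _, _, _, _, _, _, _, .abs h, _, _, _, _, _, hr, hq =>
      .abs (h.ren ((hr.lift _).lift _) hq)
  | _, _, _, _, _, _, _, _, .ofAdm h, _, _, _, _, _, hr, hq => .ofAdm (h.ren hr hq)
  | _, _, _, _, _, _, _, _, .eqr σ, _, _, _, _, _, _, _ => by rw [RelE.eqr_ren]; exact .eqr _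
  | _, _, _, _, _, _, _, _, .pull h ht hu, _, _, _, _, _, hr, hq => by
      rw [RelE.pull_ren]; exact .pull (h.ren hr hq) (ht.ren hr) (hu.ren hr)
  | _, _, _, _, _, _, _, _, .and h h', _, _, _, _, _, hr, hq => by
      have := IsRel.and (h.ren hr hq) (h'.ren hr hq)
      simpa [RelE.ren, Fm.ren, Tm.ren, RelE.up, RelE.ren_ren, liftIdx] using this
  | _, _, _, _, _, _, _, _, .op h, _, _, _, _, _, hr, hq => by
      have := IsRel.op (h.ren hr hq)
      simpa [RelE.ren, Fm.ren, Tm.ren, RelE.up, RelE.ren_ren, liftIdx] using this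
  | _, _, _, _, _, _, _, _, .top σ τ, _, _, _, _, _, _, _ => .top _ _
  | _, _, _, _, _, _, _, _, .imp h h', _, _, _, _, _, hr, hq => by
      have := IsRel.imp (h.ren hr hq) (h'.ren hr hq)
      simpa [RelE.ren, Fm.ren, Tm.ren, RelE.up, Fm.up, RelE.ren_ren, Fm.ren_ren, liftIdx]
        using this
  | _, _, _, _, _, _, _, _, .allT (σ := σ) (τ := τ) h, f, _, _, _, _, hr, hq => by
      have e : ∀ ω : S.Ty _, ω.wk.ren (liftRen f) = (ω.ren f).wk := fun ω => by
        simp only [Ty.wk, Ty.ren_ren]; rfl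
      have h' := h.ren hr.wk hq.wk
      rw [e, e] at h'
      have := IsRel.allT h'
      simpa [RelE.ren, Fm.ren, Tm.ren, RelE.up, RelE.ren_ren, liftIdx] using this
  | _, _, _, _, _, _, _, _, .allX h, _, r, _, _, _, hr, hq => by
      have := IsRel.allX (h.ren (hr.lift _) hq)
      simp only [RelE.ren_ren, id] at this
      simp only [RelE.ren, Fm.ren, Tm.ren, RelE.ren_ren, liftIdx, id]
      -- The quantified variable stays innermost while the two variables of the relation are
      -- inserted beyond it. The two resulting renamings agree at index zero and at successors.
      convert this using 7
      rename_i i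
      cases i <;> rfl
  | _, _, _, _, _, _, _, _, .allR h, _, _, _, _, _, hr, hq => by
      have := IsRel.allR (h.ren hr (hq.lift _))
      simpa [RelE.ren, Fm.ren, Tm.ren, RelE.up, RelE.ren_ren, liftIdx] using this
  | _, _, _, _, _, _, _, _, .congr h h' h'', _, _, _, _, _, hr, hq => by
      have := h''.ren hr hq
      rw [Fm.equiv_ren] at this
      exact .congr (h.ren hr hq) (h'.ren hr hq) this
  | _, _, _, _, _, _, _, _, .interp σ h, _, _, _, _, _, hr, hq => by
      rw [Ty.ren_sub, Ty.ren_sub]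
      exact .interp σ (fun i => (h i).ren hr hq)
theorem IsFm.ren {T : Theory S} : ∀ {n m : ℕ} {Γ : List (S.Ty n)}
    {Θ : List (RDecl S n)} {φ : Fm S n}, IsFm T Γ Θ φ →
    ∀ {f : Fin n → Fin m} {r q : ℕ → ℕ} {Γ' : List (S.Ty m)} {Θ' : List (RDecl S m)},
    VarRen f r Γ Γ' → RelRen f q Θ Θ' → IsFm T Γ' Θ' (φ.ren f r q)
  | _, _, _, _, _, .eq ht hu, _, _, _, _, _, hr, _ => .eq (ht.ren hr) (hu.ren hr)
  | _, _, _, _, _, .rel h ht hu, _, _, _, _, _, hr, hq =>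
      .rel (h.ren hr hq) (ht.ren hr) (hu.ren hr)
  | _, _, _, _, _, .imp h h', _, _, _, _, _, hr, hq => .imp (h.ren hr hq) (h'.ren hr hq)
  | _, _, _, _, _, .bot, _, _, _, _, _, _, _ => .bot
  | _, _, _, _, _, .top, _, _, _, _, _, _, _ => .top
  | _, _, _, _, _, .and h h', _, _, _, _, _, hr, hq => .and (h.ren hr hq) (h'.ren hr hq)
  | _, _, _, _, _, .or h h', _, _, _, _, _, hr, hq => .or (h.ren hr hq) (h'.ren hr hq)
  | _, _, _, _, _, .allT h, _, _, _, _, _, hr, hq => .allT (h.ren hr.wk hq.wk)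
  | _, _, _, _, _, .allX h, _, _, _, _, _, hr, hq => .allX (h.ren (hr.lift _) hq)
  | _, _, _, _, _, .allR h, _, _, _, _, _, hr, hq => .allR (h.ren hr (hq.lift _))
  | _, _, _, _, _, .exT h, _, _, _, _, _, hr, hq => .exT (h.ren hr.wk hq.wk)
  | _, _, _, _, _, .exX h, _, _, _, _, _, hr, hq => .exX (h.ren (hr.lift _) hq)
  | _, _, _, _, _, .exR h, _, _, _, _, _, hr, hq => .exR (h.ren hr (hq.lift _))
end

end

section

variable {S : Sig.{u, v}}

/-! ## Derived rules -/

section Rules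

variable {T : Theory S} {n : ℕ} {Γ : List (S.Ty n)} {Θ : List (RDecl S n)} {Φ : List (Fm S n)}

/-- The propositions in `Φ` are well formed. -/
def Wf (T : Theory S) (Γ : List (S.Ty n)) (Θ : List (RDecl S n)) (Φ : List (Fm S n)) : Prop :=
  ∀ χ ∈ Φ, IsFm T Γ Θ χ

theorem Wf.nil : Wf T Γ Θ [] := by simp [Wf]

theorem Wf.cons {φ : Fm S n} (h : IsFm T Γ Θ φ) (hΦ : Wf T Γ Θ Φ) : Wf T Γ Θ (φ :: Φ) := by
  intro χ hχ
  rcases List.mem_cons.1 hχ with rfl | hχ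
  exacts [h, hΦ _ hχ]

theorem Wf.singleton {φ : Fm S n} (h : IsFm T Γ Θ φ) : Wf T Γ Θ [φ] := Wf.nil.cons h

theorem Proves.ofNil {φ : Fm S n} (h : Proves T Γ Θ [] φ) (hΦ : Wf T Γ Θ Φ) :
    Proves T Γ Θ Φ φ := .weak (List.nil_subset _) hΦ h

theorem Proves.head {φ : Fm S n} (h : Wf T Γ Θ (φ :: Φ)) : Proves T Γ Θ (φ :: Φ) φ :=
  .hyp h List.mem_cons_self

theorem Proves.ext {σ : S.Ty n} {t u : Tm S n} (hΦ : Wf T Γ Θ Φ) (ht : HasType (intCtx Γ) t σ)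
    (hu : HasType (intCtx Γ) u σ) (h : ExtEq (intCtx Γ) t u σ) : Proves T Γ Θ Φ (.eq σ t u) :=
  (Proves.exteq ht hu h).ofNil hΦ

theorem Proves.refl {σ : S.Ty n} {t : Tm S n} (hΦ : Wf T Γ Θ Φ) (ht : HasType (intCtx Γ) t σ) :
    Proves T Γ Θ Φ (.eq σ t t) := .ext hΦ ht ht (.refl ht)

theorem HasType.iapp {t u : Tm S n} {σ τ : S.Ty n} (ht : HasType (intCtx Γ) t (.lolli σ τ))
    (hu : HasType (intCtx Γ) u σ) : HasType (intCtx Γ) (.app t u) τ :=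
  .app (Split.self (noLin_intCtx _)) ht hu

theorem HasType.ibang {t : Tm S n} {σ : S.Ty n} (ht : HasType (intCtx Γ) t σ) :
    HasType (intCtx Γ) (.bang t) (.bang σ) := .bang (noLin_intCtx _) ht

theorem varRen_up (Γ' : List (S.Ty n)) : VarRen id (· + Γ'.length) Γ (Γ' ++ Γ) := by
  intro i σ h
  rw [List.getElem?_append_right (by simp)]
  simpa [Ty.ren_id] using h

theorem relRen_id : RelRen id id Θ Θ := by
  intro i d h
  simpa [RDecl.ren, Ty.ren_id] using h

theorem HasType.iup {t : Tm S n} {σ : S.Ty n} (h : HasType (intCtx Γ) t σ) (Γ' : List (S.Ty n)) :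
    HasType (intCtx (Γ' ++ Γ)) (t.up Γ'.length) σ := by
  have := h.ren (varRen_up Γ')
  rwa [Ty.ren_id] at this

theorem IsRel.up {b : Bool} {ρ : RelE S n} {σ τ : S.Ty n} (h : IsRel T b Γ Θ ρ σ τ)
    (Γ' : List (S.Ty n)) : IsRel T b (Γ' ++ Γ) Θ (ρ.up Γ'.length) σ τ := by
  have := h.ren (varRen_up Γ') relRen_id
  rwa [Ty.ren_id, Ty.ren_id] at this

theorem RelE.up_inst2 (ρ : RelE S n) (t u : Tm S n) : (ρ.up 2).sub .var (inst2 t u) .rvar = ρ := by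
  rw [RelE.up, RelE.sub_ren]; exact ρ.sub_var

theorem Tm.up_inst2 (w t u : Tm S n) : (w.up 2).sub .var (inst2 t u) = w := by
  rw [Tm.up, Tm.sub_ren]; exact w.sub_var

/-- The elimination rule merely moves the bound variable into the context; instantiation is then the
substitution rule. Both quantifiers are handled together since equivalence of relations and the
relational function spaces always quantify over a pair. -/
theorem Proves.allXX_elim {σ τ : S.Ty n} {φ : Fm S n} {t u : Tm S n}
    (h : Proves T Γ Θ Φ (.allX σ (.allX τ φ))) (ht : HasType (intCtx Γ) t σ)
    (hu : HasType (intCtx Γ) u τ) : Proves T Γ Θ Φ (φ.sub .var (inst2 t u) .rvar) := by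
  have := h.allXE.allXE.sub (Γ' := Γ) (Θ' := Θ) .var (inst2 t u) .rvar
    (fun i ω hi => by
      rw [Ty.sub_var]
      match i, hi with
      | 0, hi => cases hi; exact hu
      | 1, hi => cases hi; exact ht
      | i + 2, hi => exact .var hi)
    (fun i b ω ω' hi => by rw [Ty.sub_var, Ty.sub_var]; exact .rvar hi)
  simp only [List.map_map] at this
  convert this
  -- The hypotheses were weakened twice, and the instantiation undoes this.
  refine (List.map_id Φ).symm.trans (List.map_congr_left fun χ _ => ?_)
  simp only [Function.comp, Fm.up, Fm.sub_ren]
  exact χ.sub_var.symm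

theorem Proves.equiv_mp {σ τ : S.Ty n} {ρ ρ' : RelE S n} {t u : Tm S n}
    (h : Proves T Γ Θ [] (.equiv σ τ ρ ρ')) (hΦ : Wf T Γ Θ Φ) (ht : HasType (intCtx Γ) t σ)
    (hu : HasType (intCtx Γ) u τ) (hr : Proves T Γ Θ Φ (.rel ρ t u)) :
    Proves T Γ Θ Φ (.rel ρ' t u) := by
  have := (h.allXX_elim ht hu).ofNil hΦ
  simp only [Fm.iff, Fm.sub, RelE.up_inst2] at this
  exact .impE (.andE₁ this) hr

theorem Proves.equiv_mpr {σ τ : S.Ty n} {ρ ρ' : RelE S n} {t u : Tm S n}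
    (h : Proves T Γ Θ [] (.equiv σ τ ρ ρ')) (hΦ : Wf T Γ Θ Φ) (ht : HasType (intCtx Γ) t σ)
    (hu : HasType (intCtx Γ) u τ) (hr : Proves T Γ Θ Φ (.rel ρ' t u)) :
    Proves T Γ Θ Φ (.rel ρ t u) := by
  have := (h.allXX_elim ht hu).ofNil hΦ
  simp only [Fm.iff, Fm.sub, RelE.up_inst2] at this
  exact .impE (.andE₂ this) hr

theorem Proves.abs_elim {σ τ : S.Ty n} {φ : Fm S n} {t u : Tm S n}
    (hφ : IsFm T (τ :: σ :: Γ) Θ φ) (hΦ : Wf T Γ Θ Φ) (ht : HasType (intCtx Γ) t σ)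
    (hu : HasType (intCtx Γ) u τ) (h : Proves T Γ Θ Φ (.rel (.abs σ τ φ) t u)) :
    Proves T Γ Θ Φ (φ.sub .var (inst2 t u) .rvar) :=
  .impE (.andE₁ ((Proves.defrel hφ ht hu).ofNil hΦ)) h

theorem Proves.abs_intro {σ τ : S.Ty n} {φ : Fm S n} {t u : Tm S n}
    (hφ : IsFm T (τ :: σ :: Γ) Θ φ) (hΦ : Wf T Γ Θ Φ) (ht : HasType (intCtx Γ) t σ)
    (hu : HasType (intCtx Γ) u τ) (h : Proves T Γ Θ Φ (φ.sub .var (inst2 t u) .rvar)) :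
    Proves T Γ Θ Φ (.rel (.abs σ τ φ) t u) :=
  .impE (.andE₂ ((Proves.defrel hφ ht hu).ofNil hΦ)) h

/-! ### Reindexing and the identity relation -/

theorem IsFm.pull {ρ : RelE S n} {σ τ σ' τ' : S.Ty n} {f g : Tm S n}
    (hρ : IsRel T false Γ Θ ρ σ τ) (hf : HasType (intCtx Γ) f (.lolli σ' σ))
    (hg : HasType (intCtx Γ) g (.lolli τ' τ)) :
    IsFm T (τ' :: σ' :: Γ) Θ (.rel (ρ.up 2) (.app (f.up 2) (.var 1)) (.app (g.up 2) (.var 0))) :=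
  .rel (hρ.up [τ', σ']) ((hf.iup [τ', σ']).iapp (.var rfl)) ((hg.iup [τ', σ']).iapp (.var rfl))

theorem Proves.pull_elim {ρ : RelE S n} {σ τ σ' τ' : S.Ty n} {f g t u : Tm S n}
    (hρ : IsRel T false Γ Θ ρ σ τ) (hf : HasType (intCtx Γ) f (.lolli σ' σ))
    (hg : HasType (intCtx Γ) g (.lolli τ' τ)) (hΦ : Wf T Γ Θ Φ) (ht : HasType (intCtx Γ) t σ')
    (hu : HasType (intCtx Γ) u τ') (h : Proves T Γ Θ Φ (.rel (.pull σ' τ' f g ρ) t u)) :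
    Proves T Γ Θ Φ (.rel ρ (.app f t) (.app g u)) := by
  have := h.abs_elim (.pull hρ hf hg) hΦ ht hu
  simp only [Fm.sub, RelE.up_inst2, Tm.sub, Tm.up_inst2] at this
  exact this

theorem Proves.pull_intro {ρ : RelE S n} {σ τ σ' τ' : S.Ty n} {f g t u : Tm S n}
    (hρ : IsRel T false Γ Θ ρ σ τ) (hf : HasType (intCtx Γ) f (.lolli σ' σ))
    (hg : HasType (intCtx Γ) g (.lolli τ' τ)) (hΦ : Wf T Γ Θ Φ) (ht : HasType (intCtx Γ) t σ')
    (hu : HasType (intCtx Γ) u τ') (h : Proves T Γ Θ Φ (.rel ρ (.app f t) (.app g u))) :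
    Proves T Γ Θ Φ (.rel (.pull σ' τ' f g ρ) t u) := by
  refine .abs_intro (.pull hρ hf hg) hΦ ht hu ?_
  simp only [Fm.sub, RelE.up_inst2, Tm.sub, Tm.up_inst2]
  exact h

theorem HasType.idt' {G : Ctx S n} (hG : NoLin G) (σ : S.Ty n) :
    HasType G (.idt σ) (.lolli σ σ) := (HasType.idt σ).closed hG

theorem HasType.iidt (σ : S.Ty n) : HasType (intCtx Γ) (.idt σ) (.lolli σ σ) :=
  .idt' (noLin_intCtx _) σ

theorem ExtEq.idt_iapp {σ : S.Ty n} {t : Tm S n} (ht : HasType (intCtx Γ) t σ) :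
    ExtEq (intCtx Γ) (.app (.idt σ) t) t σ :=
  ExtEq.beta (t := .var 0) ((HasType.iidt σ).iapp ht)

theorem Proves.idt_app {σ : S.Ty n} {t : Tm S n} (hΦ : Wf T Γ Θ Φ)
    (ht : HasType (intCtx Γ) t σ) : Proves T Γ Θ Φ (.eq σ (.app (.idt σ) t) t) :=
  .ext hΦ ((HasType.iidt σ).iapp ht) ht (.idt_iapp ht)

theorem IsFm.eqr (σ : S.Ty n) :
    IsFm T (σ :: σ :: Γ) Θ (.eq σ (.app ((Tm.idt σ).up 2) (.var 1)) (.var 0)) :=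
  .eq (HasType.iapp (by rw [(HasType.idt σ).up_eq]; exact .iidt σ) (.var rfl)) (.var rfl)

/-- Since `eqr` is the graph of the identity, membership unfolds to (λ°x. x) t = u, and a beta step
remains. -/
theorem Proves.eqr_elim {σ : S.Ty n} {t u : Tm S n} (hΦ : Wf T Γ Θ Φ)
    (ht : HasType (intCtx Γ) t σ) (hu : HasType (intCtx Γ) u σ)
    (h : Proves T Γ Θ Φ (.rel (.eqr σ) t u)) : Proves T Γ Θ Φ (.eq σ t u) := by
  have := h.abs_elim (.eqr σ) hΦ ht hu
  simp only [Fm.sub, Tm.sub, Tm.up_inst2, Ty.sub_var] at this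
  exact .eqTrans (.eqSymm (.idt_app hΦ ht)) this

theorem Proves.eqr_intro {σ : S.Ty n} {t u : Tm S n} (hΦ : Wf T Γ Θ Φ)
    (ht : HasType (intCtx Γ) t σ) (hu : HasType (intCtx Γ) u σ)
    (h : Proves T Γ Θ Φ (.eq σ t u)) : Proves T Γ Θ Φ (.rel (.eqr σ) t u) := by
  refine .abs_intro (.eqr σ) hΦ ht hu ?_
  simp only [Fm.sub, Tm.sub, Tm.up_inst2, Ty.sub_var]
  exact .eqTrans (.idt_app hΦ ht) h

/-- Equals may be replaced only inside definable relations, so the congruence is read off from the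
relation t x = a b between a and b, which holds at (t, x) by reflexivity. -/
theorem Proves.app_congr {σ τ : S.Ty n} {t t' x x' : Tm S n} (hΦ : Wf T Γ Θ Φ)
    (ht : HasType (intCtx Γ) t (.lolli σ τ)) (ht' : HasType (intCtx Γ) t' (.lolli σ τ))
    (hx : HasType (intCtx Γ) x σ) (hx' : HasType (intCtx Γ) x' σ)
    (h : Proves T Γ Θ Φ (.eq (.lolli σ τ) t t')) (h' : Proves T Γ Θ Φ (.eq σ x x')) :
    Proves T Γ Θ Φ (.eq τ (.app t x) (.app t' x')) := by
  have hφ : IsFm T (σ :: .lolli σ τ :: Γ) Θ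
      (.eq τ (.app (t.up 2) (x.up 2)) (.app (.var 1) (.var 0))) :=
    .eq ((ht.iup [_, _]).iapp (hx.iup [_, _])) (HasType.iapp (.var (by rfl)) (.var (by rfl)))
  have := (Proves.eqSubst (.abs hφ) (Proves.abs_intro hφ hΦ ht hx (by
    simp only [Fm.sub, Tm.sub, Tm.up_inst2, Ty.sub_var]
    exact .refl hΦ (ht.iapp hx))) h h').abs_elim hφ hΦ ht' hx'
  simp only [Fm.sub, Tm.sub, Tm.up_inst2, Ty.sub_var] at this
  exact this

/-! ### Function spaces -/

theorem IsFm.relLolli {ρ ρ' : RelE S n} {σ τ σ' τ' : S.Ty n} (hρ : IsRel T false Γ Θ ρ σ τ)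
    (hρ' : IsRel T false Γ Θ ρ' σ' τ') :
    IsFm T (.lolli τ τ' :: .lolli σ σ' :: Γ) Θ (.allX σ (.allX τ (.imp
      (.rel (ρ.up 4) (.var 1) (.var 0))
      (.rel (ρ'.up 4) (.app (.var 3) (.var 1)) (.app (.var 2) (.var 0)))))) :=
  .allX (.allX (.imp (.rel (hρ.up [_, _, _, _]) (.var rfl) (.var rfl))
    (.rel (hρ'.up [_, _, _, _]) (HasType.iapp (σ := σ) (.var rfl) (.var rfl))
      (HasType.iapp (σ := τ) (.var rfl) (.var rfl)))))

theorem IsRel.lolli {ρ ρ' : RelE S n} {σ τ σ' τ' : S.Ty n} (hρ : IsRel T false Γ Θ ρ σ τ)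
    (hρ' : IsRel T false Γ Θ ρ' σ' τ') :
    IsRel T false Γ Θ (.lolli σ τ σ' τ' ρ ρ') (.lolli σ σ') (.lolli τ τ') :=
  .abs (.relLolli hρ hρ')

/-- Of the four weakenings, two belong to the related functions and disappear on instantiation; the
two for the quantified arguments remain. -/
theorem RelE.up_four_inst2 (ρ : RelE S n) (t u : Tm S n) :
    (ρ.up 4).sub .var (liftTm (liftTm (inst2 t u))) (fun i => ((RelE.rvar i).up 1).up 1) =
      ρ.up 2 := by
  rw [RelE.up, RelE.sub_ren, RelE.up, RelE.ren_eq_sub]; rfl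

theorem Tm.up_up_one (w : Tm S n) : (w.up 1).up 1 = w.up 2 := by
  simp only [Tm.up, Tm.ren_ren]; rfl

theorem Fm.relLolli_inst2 (ρ ρ' : RelE S n) (σ τ : S.Ty n) (t u : Tm S n) :
    (Fm.allX σ (.allX τ (.imp (.rel (ρ.up 4) (.var 1) (.var 0))
      (.rel (ρ'.up 4) (.app (.var 3) (.var 1)) (.app (.var 2) (.var 0)))))).sub
        .var (inst2 t u) .rvar =
    .allX σ (.allX τ (.imp (.rel (ρ.up 2) (.var 1) (.var 0))
      (.rel (ρ'.up 2) (.app (t.up 2) (.var 1)) (.app (u.up 2) (.var 0))))) := by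
  simp only [Fm.sub, Tm.sub, Ty.sub_var, RelE.up_four_inst2, ← Tm.up_up_one]
  rfl

theorem Fm.relArr_inst2 (ρ ρ' : RelE S n) (σ τ : S.Ty n) (t u : Tm S n) :
    (Fm.allX σ (.allX τ (.imp (.rel (ρ.up 4) (.var 1) (.var 0))
      (.rel (ρ'.up 4) (.app (.var 3) (.bang (.var 1))) (.app (.var 2) (.bang (.var 0))))))).sub
        .var (inst2 t u) .rvar =
    .allX σ (.allX τ (.imp (.rel (ρ.up 2) (.var 1) (.var 0))
      (.rel (ρ'.up 2) (.app (t.up 2) (.bang (.var 1))) (.app (u.up 2) (.bang (.var 0)))))) := by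
  simp only [Fm.sub, Tm.sub, Ty.sub_var, RelE.up_four_inst2, ← Tm.up_up_one]
  rfl

theorem Proves.lolli_elim {ρ ρ' : RelE S n} {σ τ σ' τ' : S.Ty n} {t u x y : Tm S n}
    (hρ : IsRel T false Γ Θ ρ σ τ) (hρ' : IsRel T false Γ Θ ρ' σ' τ') (hΦ : Wf T Γ Θ Φ)
    (ht : HasType (intCtx Γ) t (.lolli σ σ')) (hu : HasType (intCtx Γ) u (.lolli τ τ'))
    (hx : HasType (intCtx Γ) x σ) (hy : HasType (intCtx Γ) y τ)
    (h : Proves T Γ Θ Φ (.rel (.lolli σ τ σ' τ' ρ ρ') t u)) (h' : Proves T Γ Θ Φ (.rel ρ x y)) :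
    Proves T Γ Θ Φ (.rel ρ' (.app t x) (.app u y)) := by
  have := h.abs_elim (.relLolli hρ hρ') hΦ ht hu
  rw [Fm.relLolli_inst2] at this
  have := this.allXX_elim hx hy
  simp only [Fm.sub, RelE.up_inst2, Tm.sub, Tm.up_inst2] at this
  exact .impE this h'

/-- The hypothesis list is empty because the related pairs of functions in the parametricity
arguments are always established unconditionally. -/
theorem Proves.lolli_intro {ρ ρ' : RelE S n} {σ τ σ' τ' : S.Ty n} {t u : Tm S n}
    (hρ : IsRel T false Γ Θ ρ σ τ) (hρ' : IsRel T false Γ Θ ρ' σ' τ')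
    (ht : HasType (intCtx Γ) t (.lolli σ σ')) (hu : HasType (intCtx Γ) u (.lolli τ τ'))
    (h : Proves T (τ :: σ :: Γ) Θ [.rel (ρ.up 2) (.var 1) (.var 0)]
      (.rel (ρ'.up 2) (.app (t.up 2) (.var 1)) (.app (u.up 2) (.var 0)))) :
    Proves T Γ Θ [] (.rel (.lolli σ τ σ' τ' ρ ρ') t u) := by
  refine .abs_intro (.relLolli hρ hρ') .nil ht hu ?_
  rw [Fm.relLolli_inst2]
  exact .allXI Wf.nil (.allXI Wf.nil (.impI h))

theorem IsFm.relArr {ρ ρ' : RelE S n} {σ τ σ' τ' : S.Ty n} (hρ : IsRel T false Γ Θ ρ σ τ)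
    (hρ' : IsRel T false Γ Θ ρ' σ' τ') :
    IsFm T (.arr τ τ' :: .arr σ σ' :: Γ) Θ (.allX σ (.allX τ (.imp
      (.rel (ρ.up 4) (.var 1) (.var 0))
      (.rel (ρ'.up 4) (.app (.var 3) (.bang (.var 1))) (.app (.var 2) (.bang (.var 0))))))) :=
  .allX (.allX (.imp (.rel (hρ.up [_, _, _, _]) (.var rfl) (.var rfl))
    (.rel (hρ'.up [_, _, _, _]) (HasType.iapp (σ := .bang σ) (.var rfl) (.ibang (.var rfl)))
      (HasType.iapp (σ := .bang τ) (.var rfl) (.ibang (.var rfl))))))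

theorem IsRel.arr {ρ ρ' : RelE S n} {σ τ σ' τ' : S.Ty n} (hρ : IsRel T false Γ Θ ρ σ τ)
    (hρ' : IsRel T false Γ Θ ρ' σ' τ') :
    IsRel T false Γ Θ (.arr σ τ σ' τ' ρ ρ') (.arr σ σ') (.arr τ τ') :=
  .abs (.relArr hρ hρ')

theorem Proves.arr_elim {ρ ρ' : RelE S n} {σ τ σ' τ' : S.Ty n} {t u x y : Tm S n}
    (hρ : IsRel T false Γ Θ ρ σ τ) (hρ' : IsRel T false Γ Θ ρ' σ' τ') (hΦ : Wf T Γ Θ Φ)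
    (ht : HasType (intCtx Γ) t (.arr σ σ')) (hu : HasType (intCtx Γ) u (.arr τ τ'))
    (hx : HasType (intCtx Γ) x σ) (hy : HasType (intCtx Γ) y τ)
    (h : Proves T Γ Θ Φ (.rel (.arr σ τ σ' τ' ρ ρ') t u)) (h' : Proves T Γ Θ Φ (.rel ρ x y)) :
    Proves T Γ Θ Φ (.rel ρ' (.app t (.bang x)) (.app u (.bang y))) := by
  have := h.abs_elim (.relArr hρ hρ') hΦ ht hu
  rw [Fm.relArr_inst2] at this
  have := this.allXX_elim hx hy
  simp only [Fm.sub, RelE.up_inst2, Tm.sub, Tm.up_inst2] at this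
  exact .impE this h'

theorem Proves.arr_intro {ρ ρ' : RelE S n} {σ τ σ' τ' : S.Ty n} {t u : Tm S n}
    (hρ : IsRel T false Γ Θ ρ σ τ) (hρ' : IsRel T false Γ Θ ρ' σ' τ')
    (ht : HasType (intCtx Γ) t (.arr σ σ')) (hu : HasType (intCtx Γ) u (.arr τ τ'))
    (h : Proves T (τ :: σ :: Γ) Θ [.rel (ρ.up 2) (.var 1) (.var 0)]
      (.rel (ρ'.up 2) (.app (t.up 2) (.bang (.var 1))) (.app (u.up 2) (.bang (.var 0))))) :
    Proves T Γ Θ [] (.rel (.arr σ τ σ' τ' ρ ρ') t u) := by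
  refine .abs_intro (.relArr hρ hρ') .nil ht hu ?_
  rw [Fm.relArr_inst2]
  exact .allXI Wf.nil (.allXI Wf.nil (.impI h))

end Rules

end

section

variable {S : Sig.{u, v}}

/-! ### Polymorphic types -/

/-- The declaration `R : Adm(α, β)` of the two most recent type variables. -/
def RDecl.adm₂ {n : ℕ} : RDecl S (n + 2) := ⟨true, .var 1, .var 0⟩

/-- The renaming that picks the second of two new type variables. -/
def pickFst {n : ℕ} : Fin (n + 1) → Fin (n + 2) := Fin.cases 1 (fun i => i.succ.succ)

/-- The renaming that picks the first of two new type variables. -/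
def pickSnd {n : ℕ} : Fin (n + 1) → Fin (n + 2) := Fin.cases 0 (fun i => i.succ.succ)

/-- The substitution `[σ, τ / α, β]`, where `α` has index `1` and `β` has index `0`. -/
def instTy₂ {K : TySig.{u}} {n : ℕ} (σ τ : Ty K n) : Fin (n + 2) → Ty K n :=
  Fin.cases τ (Fin.cases σ Ty.var)

/-- The substitution `[ρ / R]` for the most recent relation variable. -/
def instRel {n : ℕ} (ρ : RelE S n) : ℕ → RelE S n
  | 0 => ρ
  | i + 1 => .rvar i

section Rules

variable {T : Theory S} {n : ℕ} {Γ : List (S.Ty n)} {Θ : List (RDecl S n)} {Φ : List (Fm S n)}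

theorem Ty.wk_wk {K : TySig.{u}} {n : ℕ} (σ : Ty K n) :
    σ.wk.wk = σ.ren (fun i => i.succ.succ) := by
  simp only [Ty.wk, Ty.ren_ren]

theorem varRen_wk₂ : VarRen (fun i : Fin n => i.succ.succ) id Γ ((Γ.map Ty.wk).map Ty.wk) := by
  intro i σ h
  simp only [id, List.getElem?_map, h, Option.map_some, Ty.wk_wk]

theorem relRen_wk₃ (d : RDecl S (n + 2)) :
    RelRen (fun i : Fin n => i.succ.succ) (· + 1) Θ (d :: (Θ.map RDecl.wk).map RDecl.wk) := by
  intro i e h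
  simp only [List.getElem?_cons_succ, List.getElem?_map, h, Option.map_some, RDecl.wk, RDecl.ren,
    Ty.wk_wk]

theorem IsRel.wk3 {b : Bool} {ρ : RelE S n} {σ τ : S.Ty n} (h : IsRel T b Γ Θ ρ σ τ)
    (d : RDecl S (n + 2)) :
    IsRel T b ((Γ.map Ty.wk).map Ty.wk) (d :: (Θ.map RDecl.wk).map RDecl.wk) ρ.wk3
      σ.wk.wk τ.wk.wk := by
  rw [Ty.wk_wk, Ty.wk_wk]
  exact h.ren varRen_wk₂ (relRen_wk₃ d)

theorem HasType.tup {t : Tm S n} {σ : S.Ty n} (h : HasType (intCtx Γ) t σ) :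
    HasType (intCtx (Γ.map Ty.wk)) t.tup σ.wk :=
  h.ren (f := Fin.succ) (r := id) (fun i σ hi => by simp [hi, Ty.wk])

theorem HasType.itapp {t : Tm S n} {σ : S.Ty (n + 1)} (τ : S.Ty n)
    (h : HasType (intCtx Γ) t (.pi σ)) : HasType (intCtx Γ) (.tapp t τ) (σ.sub (instTy τ)) :=
  .tapp τ h

/-- Under the variables α and β of a relational ∏, the left term is applied to α, of index 1, and
the right one to β, of index 0. This lemma and the next put the resulting types in the form of a
renaming. -/
theorem HasType.tapp_fst {Γ : List (S.Ty (n + 2))} {t : Tm S (n + 2)} {σ : S.Ty (n + 1)}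
    (h : HasType (intCtx Γ) t (Ty.pi σ).wk.wk) :
    HasType (intCtx Γ) (.tapp t (.var 1)) (σ.ren pickFst) := by
  have := HasType.tapp (.var 1) h
  convert this using 1
  rw [Ty.sub_ren, Ty.sub_ren, Ty.ren_eq_sub]
  congr 1; funext i
  exact Fin.cases rfl (fun _ => rfl) i

theorem HasType.tapp_snd {Γ : List (S.Ty (n + 2))} {t : Tm S (n + 2)} {σ : S.Ty (n + 1)}
    (h : HasType (intCtx Γ) t (Ty.pi σ).wk.wk) :
    HasType (intCtx Γ) (.tapp t (.var 0)) (σ.ren pickSnd) := by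
  have := HasType.tapp (.var 0) h
  convert this using 1
  rw [Ty.sub_ren, Ty.sub_ren, Ty.ren_eq_sub]
  congr 1; funext i
  exact Fin.cases rfl (fun _ => rfl) i

theorem IsFm.relAll {σ τ : S.Ty (n + 1)} {ρ : RelE S (n + 2)}
    (hρ : IsRel T false ((Γ.map Ty.wk).map Ty.wk)
      (.adm₂ :: (Θ.map RDecl.wk).map RDecl.wk) ρ (σ.ren pickFst) (τ.ren pickSnd)) :
    IsFm T (.pi τ :: .pi σ :: Γ) Θ (.allT (.allT (.allR true (.var 1) (.var 0)
      (.rel (ρ.up 2) (.tapp (.var 1) (.var 1)) (.tapp (.var 0) (.var 0)))))) :=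
  .allT (.allT (.allR (.rel (hρ.up [(Ty.pi τ).wk.wk, (Ty.pi σ).wk.wk])
    (HasType.tapp_fst (.var rfl)) (HasType.tapp_snd (.var rfl)))))

theorem IsRel.all {σ τ : S.Ty (n + 1)} {ρ : RelE S (n + 2)}
    (hρ : IsRel T false ((Γ.map Ty.wk).map Ty.wk)
      (.adm₂ :: (Θ.map RDecl.wk).map RDecl.wk) ρ (σ.ren pickFst) (τ.ren pickSnd)) :
    IsRel T false Γ Θ (.all σ τ ρ) (.pi σ) (.pi τ) :=
  .abs (.relAll hρ)

theorem Fm.relAll_inst2 (ρ : RelE S (n + 2)) (t u : Tm S n) :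
    (Fm.allT (.allT (.allR true (.var 1) (.var 0)
      (.rel (ρ.up 2) (.tapp (.var 1) (.var 1)) (.tapp (.var 0) (.var 0)))))).sub
        .var (inst2 t u) .rvar =
    .allT (.allT (.allR true (.var 1) (.var 0)
      (.rel ρ (.tapp t.tup.tup (.var 1)) (.tapp u.tup.tup (.var 0))))) := by
  have e0 : (liftRel fun i => ((RelE.rvar i : RelE S n).tup).tup) = RelE.rvar := by
    funext i; cases i <;> rfl
  have e : (ρ.up 2).sub .var (fun i => (inst2 t u i).tup.tup)
      (liftRel fun i => (RelE.rvar i).tup.tup) = ρ := by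
    rw [RelE.up, RelE.sub_ren, e0]; exact ρ.sub_var
  simp only [Fm.sub, Tm.sub, Ty.sub_var, liftTy_var, e]
  rfl

/-- After opening the quantifiers over α, β and R, a single use of the substitution rule fills all
three. The relation substituted for R must be admissible, since R was declared so. -/
theorem Proves.all_elim {σ τ : S.Ty (n + 1)} {ρ : RelE S (n + 2)} {R : RelE S n} {A B : S.Ty n}
    {t u : Tm S n} (hρ : IsRel T false ((Γ.map Ty.wk).map Ty.wk)
      (.adm₂ :: (Θ.map RDecl.wk).map RDecl.wk) ρ (σ.ren pickFst) (τ.ren pickSnd))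
    (hΦ : Wf T Γ Θ Φ) (ht : HasType (intCtx Γ) t (.pi σ)) (hu : HasType (intCtx Γ) u (.pi τ))
    (hR : IsRel T true Γ Θ R A B) (h : Proves T Γ Θ Φ (.rel (.all σ τ ρ) t u)) :
    Proves T Γ Θ Φ (.rel (ρ.sub (instTy₂ A B) .var (instRel R)) (.tapp t A) (.tapp u B)) := by
  have h := h.abs_elim (.relAll hρ) hΦ ht hu
  rw [Fm.relAll_inst2] at h
  -- What comes from the original context has been weakened past α and β, and the substitution
  -- brings it back.
  have e : ∀ ω : S.Ty n, ω.wk.wk.sub (instTy₂ A B) = ω := fun ω => by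
    rw [Ty.wk_wk, Ty.sub_ren]; exact ω.sub_var
  have := h.allTE.allTE.allRE.sub (Γ' := Γ) (Θ' := Θ) (instTy₂ A B) .var (instRel R) ?_ ?_
  · simp only [List.map_map, Fm.sub, Tm.sub] at this
    have e' : ∀ w : Tm S n, w.tup.tup.sub (instTy₂ A B) .var = w := fun w => by
      simp only [Tm.tup, Tm.sub_ren]; exact w.sub_var
    rw [e', e'] at this
    convert this using 1
    swap; · rfl
    refine (List.map_id Φ).symm.trans (List.map_congr_left fun χ _ => ?_)
    simp only [Function.comp, Fm.tup, Fm.rup, Fm.sub_ren]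
    exact χ.sub_var.symm
  · intro i ω hi
    simp only [List.getElem?_map, Option.map_map, Option.map_eq_some_iff] at hi
    obtain ⟨ω, hi, rfl⟩ := hi
    simp only [Function.comp, e]
    exact .var hi
  · intro i b ω ω' hi
    match i, hi with
    | 0, hi => cases hi; exact hR
    | i + 1, hi =>
      simp only [List.getElem?_cons_succ, List.getElem?_map, Option.map_map,
        Option.map_eq_some_iff] at hi
      obtain ⟨d, hi', hd⟩ := hi
      cases hd
      change IsRel T d.adm Γ Θ (.rvar i) (d.dom.wk.wk.sub _) (d.cod.wk.wk.sub _)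
      rw [e, e]
      exact .rvar hi'

theorem Proves.all_intro {σ τ : S.Ty (n + 1)} {ρ : RelE S (n + 2)}
    {t u : Tm S n} (hρ : IsRel T false ((Γ.map Ty.wk).map Ty.wk)
      (.adm₂ :: (Θ.map RDecl.wk).map RDecl.wk) ρ (σ.ren pickFst) (τ.ren pickSnd))
    (ht : HasType (intCtx Γ) t (.pi σ)) (hu : HasType (intCtx Γ) u (.pi τ))
    (h : Proves T ((Γ.map Ty.wk).map Ty.wk) (.adm₂ :: (Θ.map RDecl.wk).map RDecl.wk) []
      (.rel ρ (.tapp t.tup.tup (.var 1)) (.tapp u.tup.tup (.var 0)))) :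
    Proves T Γ Θ [] (.rel (.all σ τ ρ) t u) := by
  refine .abs_intro (.relAll hρ) .nil ht hu ?_
  rw [Fm.relAll_inst2]
  exact .allTI Wf.nil (.allTI Wf.nil (.allRI Wf.nil h))

/-! ### The type constructor `!` -/

theorem RelE.up_four_sub {m : ℕ} (ρ : RelE S n) (a : Fin n → S.Ty m) (s : ℕ → Tm S m)
    (q : ℕ → RelE S m) :
    (ρ.up 4).sub a (liftTm (liftTm (liftTm (liftTm s))))
      (fun i => (((q i).up 2).up 1).up 1) = (ρ.sub a s q).up 4 := by
  simp only [RelE.up_up]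
  simp only [RelE.up, RelE.sub_ren, RelE.ren_sub, id, Ty.ren_id]
  congr 1; funext i
  simp only [liftTm, Tm.up, Tm.ren_ren]; rfl

theorem RelE.lolli_sub {m : ℕ} (σ τ σ' τ' : S.Ty n) (ρ ρ' : RelE S n) (a : Fin n → S.Ty m)
    (s : ℕ → Tm S m) (q : ℕ → RelE S m) : (RelE.lolli σ τ σ' τ' ρ ρ').sub a s q =
      .lolli (σ.sub a) (τ.sub a) (σ'.sub a) (τ'.sub a) (ρ.sub a s q) (ρ'.sub a s q) := by
  simp only [RelE.lolli, RelE.sub, Fm.sub, RelE.up_four_sub, Tm.sub]; rfl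

theorem RelE.arr_sub {m : ℕ} (σ τ σ' τ' : S.Ty n) (ρ ρ' : RelE S n) (a : Fin n → S.Ty m)
    (s : ℕ → Tm S m) (q : ℕ → RelE S m) : (RelE.arr σ τ σ' τ' ρ ρ').sub a s q =
      .arr (σ.sub a) (τ.sub a) (σ'.sub a) (τ'.sub a) (ρ.sub a s q) (ρ'.sub a s q) := by
  simp only [RelE.arr, RelE.sub, Fm.sub, RelE.up_four_sub, Tm.sub]; rfl

/-- The relation `(ρ → R) ⊸ R`, for a relation variable `R : Adm(α, β)`. -/
def RelE.bangAux (σ τ : S.Ty n) (ρ : RelE S n) : RelE S (n + 2) :=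
  .lolli (.arr σ.wk.wk (.var 1)) (.arr τ.wk.wk (.var 0)) (.var 1) (.var 0)
    (.arr σ.wk.wk τ.wk.wk (.var 1) (.var 0) ρ.wk3 (.rvar 0)) (.rvar 0)

/-- The type `(σ → α) ⊸ α`. -/
def Ty.bangAux {K : TySig.{u}} {n : ℕ} (σ : Ty K n) : Ty K (n + 1) :=
  .lolli (.arr σ.wk (.var 0)) (.var 0)

theorem IsRel.arr_rvar {ρ : RelE S n} {σ τ : S.Ty n} (hρ : IsRel T false Γ Θ ρ σ τ) :
    IsRel T false ((Γ.map Ty.wk).map Ty.wk) (.adm₂ :: (Θ.map RDecl.wk).map RDecl.wk)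
      (.arr σ.wk.wk τ.wk.wk (.var 1) (.var 0) ρ.wk3 (.rvar 0))
      (.arr σ.wk.wk (.var 1)) (.arr τ.wk.wk (.var 0)) :=
  .arr (hρ.wk3 _) (.ofAdm (.rvar rfl))

theorem IsRel.bangAux {ρ : RelE S n} {σ τ : S.Ty n} (hρ : IsRel T false Γ Θ ρ σ τ) :
    IsRel T false ((Γ.map Ty.wk).map Ty.wk) (.adm₂ :: (Θ.map RDecl.wk).map RDecl.wk)
      (.bangAux σ τ ρ) (σ.bangAux.ren pickFst) (τ.bangAux.ren pickSnd) := by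
  have e1 : σ.bangAux.ren pickFst = .lolli (.arr σ.wk.wk (.var 1)) (.var 1) := by
    simp only [Ty.bangAux, Ty.ren, Ty.arr, Ty.wk, Ty.ren_ren]; rfl
  have e2 : τ.bangAux.ren pickSnd = .lolli (.arr τ.wk.wk (.var 0)) (.var 0) := by
    simp only [Ty.bangAux, Ty.ren, Ty.arr, Ty.wk, Ty.ren_ren]; rfl
  rw [e1, e2]
  exact .lolli hρ.arr_rvar (.ofAdm (.rvar rfl))

theorem bangMap_hasType (σ : S.Ty n) :
    HasType (intCtx Γ) (bangMap σ) (.lolli (.bang σ) (.pi σ.bangAux)) := by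
  have hG := noLin_intCtx Γ
  have hG' := hG.map (m := n + 1) Fin.succ
  refine .lam (.tlam (.lam (.app (σ := (Ty.bang σ).wk) (.left _ (.right _ (Split.self hG')))
    ?_ ?_)))
  · exact .lvar rfl (by simpa [NoLin] using hG')
  · exact .lvar rfl (by simpa [NoLin] using hG')

/-- The encoding of !σ sends x to evaluation at x, so three beta steps turn its value at A and f
into f x. The typing is returned too, since internal equality asks for it. -/
theorem ExtEq.bangMap_app {x f : Tm S n} {σ A : S.Ty n} (hx : HasType (intCtx Γ) x (.bang σ))
    (hf : HasType (intCtx Γ) f (.arr σ A)) :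
    HasType (intCtx Γ) (.app (.tapp (.app (bangMap σ) x) A) f) A ∧
    ExtEq (intCtx Γ) (.app (.tapp (.app (bangMap σ) x) A) f) (.app f x) A := by
  have hS := Split.self (noLin_intCtx Γ)
  have e : σ.bangAux.sub (instTy A) = .lolli (.arr σ A) A := by
    simp only [Ty.bangAux, Ty.sub, Ty.arr, Ty.wk_sub_instTy]; rfl
  have h1 := (bangMap_hasType σ).iapp hx
  have h2 := h1.itapp A
  rw [e] at h2
  refine ⟨h2.iapp hf, ?_⟩
  have b1 := ExtEq.beta h1
  have e1 : (Tm.tlam (.lam (.arr σ.wk (.var 0)) (.app (.var 0) (.var 1)))).sub .var (inst1 x) =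
      .tlam (.lam (.arr σ.wk (.var 0)) (.app (.var 0) (x.tup.up 1))) := by
    simp only [Tm.sub, liftTy_var, Ty.sub_var]; rfl
  rw [e1] at b1
  have b2 := ExtEq.tapp A b1
  rw [e] at b2
  have ex : HasType (.off :: intCtx (Γ.map Ty.wk)) (x.tup.up 1) (Ty.bang σ).wk := hx.tup.up (e := .off) (by simp)
  have h3 : HasType (intCtx Γ)
      (.tlam (.lam (.arr σ.wk (.var 0)) (.app (.var 0) (x.tup.up 1)))) (.pi σ.bangAux) := by
    refine .tlam (.lam ?_)
    have e4 : (intCtx Γ).map (Entry.ren Fin.succ) = intCtx (Γ.map Ty.wk) := by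
      simp only [intCtx, List.map_map]; rfl
    rw [e4]
    exact .app (σ := (Ty.bang σ).wk) (.left _ (Split.self (noLin_intCtx _)))
      (.lvar rfl (by have := noLin_intCtx (Γ.map Ty.wk); simpa [NoLin] using this)) ex
  have b3 := ExtEq.tbeta (h3.itapp A)
  rw [e] at b3
  have h4 : HasType (intCtx Γ) (.lam (.arr σ A) (.app (.var 0) (x.up 1)))
      (.lolli (.arr σ A) A) := by
    refine .lam (.app (σ := .bang σ) (.left _ hS) (.lvar rfl (by
      have := noLin_intCtx Γ; simpa [NoLin] using this)) (hx.up (by simp)))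
  have b4 := ExtEq.beta (h4.iapp hf)
  have e5 : (Tm.lam (.arr σ.wk (.var 0)) (.app (.var 0) (x.tup.up 1))).sub (instTy A) .var =
      .lam (.arr σ A) (.app (.var 0) (x.up 1)) := by
    simp only [Tm.sub, Ty.sub, Ty.arr, Ty.wk_sub_instTy, Tm.up, Tm.tup, Tm.ren_ren, Tm.sub_ren,
      liftTm_var]
    rw [Tm.ren_eq_sub]; rfl
  have e6 : (Tm.app (.var 0) (x.up 1)).sub .var (inst1 f) = .app f x := by
    simp only [Tm.sub, Tm.up, Tm.sub_ren]
    exact congrArg (Tm.app f) x.sub_var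
  rw [e5] at b3
  rw [e6] at b4
  have b12 := b2.trans b3
  exact .trans (.app hS b12 (.refl hf)) b4

theorem RelE.bangAux_sub (σ τ A B : S.Ty n) (ρ R : RelE S n) :
    (RelE.bangAux σ τ ρ).sub (instTy₂ A B) .var (instRel R) =
      .lolli (.arr σ A) (.arr τ B) A B (.arr σ τ A B ρ R) R := by
  have e : ∀ ω : S.Ty n, ω.wk.wk.sub (instTy₂ A B) = ω := fun ω => by
    rw [Ty.wk_wk, Ty.sub_ren]; exact ω.sub_var
  have e' : ρ.wk3.sub (instTy₂ A B) .var (instRel R) = ρ := by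
    rw [RelE.wk3, RelE.sub_ren]; exact ρ.sub_var
  simp only [RelE.bangAux, RelE.lolli_sub, RelE.arr_sub, Ty.arr, Ty.sub, e, e']; rfl

/-- By definition !ρ is pulled back from ∏α.(σ → α) ⊸ α, where it says that evaluation at x and
evaluation at y send (ρ → R)-related functions to R-related values for every admissible R.
Instantiating R and undoing the encoding gives the conclusion. -/
theorem Proves.bang_elim {ρ R : RelE S n} {σ τ A B : S.Ty n} {x y f g : Tm S n}
    (hρ : IsRel T false Γ Θ ρ σ τ) (hR : IsRel T true Γ Θ R A B) (hΦ : Wf T Γ Θ Φ)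
    (hx : HasType (intCtx Γ) x (.bang σ)) (hy : HasType (intCtx Γ) y (.bang τ))
    (hf : HasType (intCtx Γ) f (.arr σ A)) (hg : HasType (intCtx Γ) g (.arr τ B))
    (h : Proves T Γ Θ Φ (.rel (.bang σ τ ρ) x y))
    (h' : Proves T Γ Θ Φ (.rel (.arr σ τ A B ρ R) f g)) :
    Proves T Γ Θ Φ (.rel R (.app f x) (.app g y)) := by
  have h1 := h.pull_elim (IsRel.all hρ.bangAux) (bangMap_hasType σ) (bangMap_hasType τ) hΦ hx hy
  have hx' := (bangMap_hasType σ).iapp hx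
  have hy' := (bangMap_hasType τ).iapp hy
  have h2 := h1.all_elim hρ.bangAux hΦ hx' hy' hR
  have e : ∀ (ω C : S.Ty n), ω.bangAux.sub (instTy C) = .lolli (.arr ω C) C := fun ω C => by
    simp only [Ty.bangAux, Ty.sub, Ty.arr, Ty.wk_sub_instTy]; rfl
  have hx'' := hx'.itapp A
  have hy'' := hy'.itapp B
  rw [e] at hx'' hy''
  have h3 := Proves.lolli_elim (.arr hρ hR.ofAdm) hR.ofAdm hΦ hx'' hy'' hf hg
    (by rw [← RelE.bangAux_sub]; exact h2) h'
  obtain ⟨k1, k2⟩ := ExtEq.bangMap_app hx hf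
  obtain ⟨k3, k4⟩ := ExtEq.bangMap_app hy hg
  exact .eqSubst hR.ofAdm h3 (.ext hΦ k1 (hf.iapp hx) k2) (.ext hΦ k3 (hg.iapp hy) k4)

theorem bangMap_ren {m : ℕ} (σ : S.Ty n) (f : Fin n → Fin m) (r : ℕ → ℕ) :
    (bangMap σ).ren f r = bangMap (σ.ren f) := by
  simp only [bangMap, Tm.ren, Ty.ren, Ty.arr, Ty.wk, Ty.ren_ren]; rfl

theorem Tm.tup_tup (t : Tm S n) : t.tup.tup = t.ren (fun i => i.succ.succ) id := by
  simp only [Tm.tup, Tm.ren_ren]; rfl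

theorem RelE.arr_up (k : ℕ) (σ τ σ' τ' : S.Ty n) (ρ ρ' : RelE S n) :
    (RelE.arr σ τ σ' τ' ρ ρ').up k = .arr σ τ σ' τ' (ρ.up k) (ρ'.up k) := by
  simp only [RelE.up, RelE.ren_eq_sub, RelE.arr_sub, id, Ty.sub_var]

/-- For functions related by ρ → R, the ρ-related arguments x and y give R-related values at !x and
!y. Up to beta this is the condition that the encoding imposes. -/
theorem Proves.bang_intro {ρ : RelE S n} {σ τ : S.Ty n} {x y : Tm S n}
    (hρ : IsRel T false Γ Θ ρ σ τ) (hx : HasType (intCtx Γ) x σ) (hy : HasType (intCtx Γ) y τ)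
    (h : Proves T Γ Θ [] (.rel ρ x y)) :
    Proves T Γ Θ [] (.rel (.bang σ τ ρ) (.bang x) (.bang y)) := by
  have hx' := (bangMap_hasType σ).iapp hx.ibang
  have hy' := (bangMap_hasType τ).iapp hy.ibang
  refine .pull_intro (IsRel.all hρ.bangAux) (bangMap_hasType σ) (bangMap_hasType τ) .nil
    hx.ibang hy.ibang (.all_intro hρ.bangAux hx' hy' ?_)
  have e : ∀ (t : Tm S n) (ω : S.Ty n), (Tm.app (bangMap ω) (.bang t)).tup.tup =
      .app (bangMap ω.wk.wk) (.bang t.tup.tup) := fun t ω => by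
    simp only [Tm.tup, Tm.ren, bangMap_ren, Ty.wk]
  have hx2 := hx.tup.tup
  have hy2 := hy.tup.tup
  have h2 := h.ren varRen_wk₂ (relRen_wk₃ (Θ := Θ) .adm₂)
  simp only [List.map_nil, Fm.ren, ← Tm.tup_tup] at h2
  rw [e, e]
  clear e h hx' hy'
  have hρ2 := hρ.wk3 (.adm₂)
  have hA := hρ.arr_rvar
  change Proves _ _ _ _ (.rel ρ.wk3 _ _) at h2
  -- Once α, β and R are in the context, the weakened data are ordinary data over the larger
  -- context, and their origin no longer matters.
  generalize x.tup.tup = x at *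
  generalize y.tup.tup = y at *
  generalize ρ.wk3 = ρ at *
  generalize σ.wk.wk = σ at *
  generalize τ.wk.wk = τ at *
  generalize (Γ.map Ty.wk).map Ty.wk = Γ at *
  have hR : IsRel T true Γ (.adm₂ :: (Θ.map RDecl.wk).map RDecl.wk) (.rvar 0) (.var 1) (.var 0) :=
    .rvar rfl
  generalize RDecl.adm₂ :: (Θ.map RDecl.wk).map RDecl.wk = Θ at *
  have et : ∀ (ω C : S.Ty (n + 2)), ω.bangAux.sub (instTy C) = .lolli (.arr ω C) C := fun ω C => by
    simp only [Ty.bangAux, Ty.sub, Ty.arr, Ty.wk_sub_instTy]; rfl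
  have kx := ((bangMap_hasType σ).iapp hx2.ibang).itapp (.var 1)
  have ky := ((bangMap_hasType τ).iapp hy2.ibang).itapp (.var 0)
  rw [et] at kx ky
  refine .lolli_intro hA hR.ofAdm kx ky ?_
  have hA2 := hA.up [.arr τ (.var 0), .arr σ (.var 1)]
  change IsRel T false _ Θ (RelE.up 2 _) _ _ at hA2
  rw [RelE.arr_up] at hA2 ⊢
  have hρ3 := hρ2.up [.arr τ (.var 0), .arr σ (.var 1)]
  have hR3 := hR.up [.arr τ (.var 0), .arr σ (.var 1)]
  have hx3 := hx2.iup [.arr τ (.var 0), .arr σ (.var 1)]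
  have hy3 := hy2.iup [.arr τ (.var 0), .arr σ (.var 1)]
  have hf : HasType (intCtx (.arr τ (.var 0) :: .arr σ (.var 1) :: Γ)) (.var 1)
    (.arr σ (.var 1)) := .var rfl
  have hg : HasType (intCtx (.arr τ (.var 0) :: .arr σ (.var 1) :: Γ)) (.var 0)
    (.arr τ (.var 0)) := .var rfl
  have hΦ : Wf T (.arr τ (.var 0) :: .arr σ (.var 1) :: Γ) Θ
      [.rel (.arr σ τ (.var 1) (.var 0) (ρ.up 2) ((RelE.rvar 0).up 2)) (.var 1) (.var 0)] :=
    .singleton (.rel hA2 hf hg)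
  have h3 := h2.ren (varRen_up [.arr τ (.var 0), .arr σ (.var 1)]) relRen_id
  -- The hypothesis that the two function variables are (ρ → R)-related is applied to x and y; what
  -- follows only moves across the beta steps of the encoding.
  have h4 := Proves.arr_elim hρ3 hR3.ofAdm hΦ hf hg hx3 hy3 (.head hΦ) (h3.ofNil hΦ)
  obtain ⟨k1, k2⟩ := ExtEq.bangMap_app hx3.ibang hf
  obtain ⟨k3, k4⟩ := ExtEq.bangMap_app hy3.ibang hg
  have h5 := Proves.eqSubst hR3.ofAdm h4 (.eqSymm (.ext hΦ k1 (hf.iapp hx3.ibang) k2))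
    (.eqSymm (.ext hΦ k3 (hg.iapp hy3.ibang) k4))
  simp only [Tm.up, Tm.ren, bangMap_ren, Ty.ren_id]
  exact h5

end Rules

end

section

variable {S : Sig.{u, v}}

section Rules

variable {T : Theory S} {n : ℕ} {Γ : List (S.Ty n)} {Θ : List (RDecl S n)} {Φ : List (Fm S n)}

/-! ### The relational interpretation of types -/

section Interp

variable {k : ℕ} {ρ : Fin k → RelE S n} {τ τ' : Fin k → S.Ty n} {t u x y : Tm S n}

theorem Proves.interp_var_elim (i : Fin k) (hρ : ∀ i, IsRel T true Γ Θ (ρ i) (τ i) (τ' i))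
    (hΦ : Wf T Γ Θ Φ) (ht : HasType (intCtx Γ) t (τ i)) (hu : HasType (intCtx Γ) u (τ' i))
    (h : Proves T Γ Θ Φ (.rel (.interp k (.var i) ρ) t u)) : Proves T Γ Θ Φ (.rel (ρ i) t u) :=
  (Proves.interpVar i hρ).equiv_mp hΦ ht hu h

theorem Proves.interp_var_intro (i : Fin k) (hρ : ∀ i, IsRel T true Γ Θ (ρ i) (τ i) (τ' i))
    (hΦ : Wf T Γ Θ Φ) (ht : HasType (intCtx Γ) t (τ i)) (hu : HasType (intCtx Γ) u (τ' i))
    (h : Proves T Γ Θ Φ (.rel (ρ i) t u)) : Proves T Γ Θ Φ (.rel (.interp k (.var i) ρ) t u) :=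
  (Proves.interpVar i hρ).equiv_mpr hΦ ht hu h

theorem Proves.interp_lolli_elim {σ σ' : S.Ty k} (hρ : ∀ i, IsRel T true Γ Θ (ρ i) (τ i) (τ' i))
    (hΦ : Wf T Γ Θ Φ) (ht : HasType (intCtx Γ) t ((Ty.lolli σ σ').sub τ))
    (hu : HasType (intCtx Γ) u ((Ty.lolli σ σ').sub τ'))
    (hx : HasType (intCtx Γ) x (σ.sub τ)) (hy : HasType (intCtx Γ) y (σ.sub τ'))
    (h : Proves T Γ Θ Φ (.rel (.interp k (.lolli σ σ') ρ) t u))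
    (h' : Proves T Γ Θ Φ (.rel (.interp k σ ρ) x y)) :
    Proves T Γ Θ Φ (.rel (.interp k σ' ρ) (.app t x) (.app u y)) :=
  .lolli_elim (.ofAdm (.interp σ hρ)) (.ofAdm (.interp σ' hρ)) hΦ ht hu hx hy
    ((Proves.interpLolli σ σ' hρ).equiv_mp hΦ ht hu h) h'

theorem Proves.interp_lolli_intro {σ σ' : S.Ty k} (hρ : ∀ i, IsRel T true Γ Θ (ρ i) (τ i) (τ' i))
    (ht : HasType (intCtx Γ) t ((Ty.lolli σ σ').sub τ))
    (hu : HasType (intCtx Γ) u ((Ty.lolli σ σ').sub τ'))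
    (h : Proves T (σ.sub τ' :: σ.sub τ :: Γ) Θ
      [.rel (.interp k σ (fun i => (ρ i).up 2)) (.var 1) (.var 0)]
      (.rel (.interp k σ' (fun i => (ρ i).up 2)) (.app (t.up 2) (.var 1))
        (.app (u.up 2) (.var 0)))) :
    Proves T Γ Θ [] (.rel (.interp k (.lolli σ σ') ρ) t u) :=
  (Proves.interpLolli σ σ' hρ).equiv_mpr .nil ht hu
    (.lolli_intro (.ofAdm (.interp σ hρ)) (.ofAdm (.interp σ' hρ)) ht hu h)

theorem Proves.interp_bang_intro {σ : S.Ty k} (hρ : ∀ i, IsRel T true Γ Θ (ρ i) (τ i) (τ' i))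
    (hx : HasType (intCtx Γ) x (σ.sub τ)) (hy : HasType (intCtx Γ) y (σ.sub τ'))
    (h : Proves T Γ Θ [] (.rel (.interp k σ ρ) x y)) :
    Proves T Γ Θ [] (.rel (.interp k (.bang σ) ρ) (.bang x) (.bang y)) :=
  (Proves.interpBang σ hρ).equiv_mpr .nil hx.ibang hy.ibang
    (.bang_intro (.ofAdm (.interp σ hρ)) hx hy h)

/-- The bound type variable has index 0, so the relation chosen for it becomes the head of the
family of relations. -/
theorem Proves.interp_pi_elim {σ : S.Ty (k + 1)} {R : RelE S n} {A B : S.Ty n}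
    (hρ : ∀ i, IsRel T true Γ Θ (ρ i) (τ i) (τ' i)) (hR : IsRel T true Γ Θ R A B)
    (hΦ : Wf T Γ Θ Φ) (ht : HasType (intCtx Γ) t ((Ty.pi σ).sub τ))
    (hu : HasType (intCtx Γ) u ((Ty.pi σ).sub τ'))
    (h : Proves T Γ Θ Φ (.rel (.interp k (.pi σ) ρ) t u)) :
    Proves T Γ Θ Φ (.rel (.interp (k + 1) σ (Fin.cases R ρ)) (.tapp t A) (.tapp u B)) := by
  have h1 := (Proves.interpPi σ hρ).equiv_mp hΦ ht hu h
  have h2 : IsRel T true ((Γ.map Ty.wk).map Ty.wk) (.adm₂ :: (Θ.map RDecl.wk).map RDecl.wk)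
      (.interp (k + 1) σ (Fin.cases (.rvar 0) (fun i => (ρ i).wk3)))
      (σ.sub (Fin.cases (.var 1) (fun i => (τ i).wk.wk)))
      (σ.sub (Fin.cases (.var 0) (fun i => (τ' i).wk.wk))) :=
    .interp σ (fun i => Fin.cases (.rvar rfl) (fun i => (hρ i).wk3 _) i)
  -- `all_elim` expects the end types as renamings of the bodies of the two ∏-types, while the
  -- typing rule for interpretations produces them as substitutions.
  have e1 : σ.sub (Fin.cases (.var 1) (fun i => (τ i).wk.wk)) =
      (σ.sub (liftTy τ)).ren pickFst := by
    rw [Ty.ren_sub]; congr 1; funext i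
    refine Fin.cases rfl (fun i => ?_) i
    simp only [liftTy, Fin.cases_succ, Ty.wk, Ty.ren_ren]; rfl
  have e2 : σ.sub (Fin.cases (.var 0) (fun i => (τ' i).wk.wk)) =
      (σ.sub (liftTy τ')).ren pickSnd := by
    rw [Ty.ren_sub]; congr 1; funext i
    refine Fin.cases rfl (fun i => ?_) i
    simp only [liftTy, Fin.cases_succ, Ty.wk, Ty.ren_ren]; rfl
  rw [e1, e2] at h2
  have h3 := h1.all_elim h2.ofAdm hΦ ht hu hR
  simp only [RelE.sub] at h3
  have e3 : (fun i => (Fin.cases (.rvar 0) (fun i => (ρ i).wk3) i : RelE S (n + 2)).sub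
      (instTy₂ A B) .var (instRel R)) = (Fin.cases R ρ : Fin (k + 1) → RelE S n) := by
    funext i
    refine Fin.cases rfl (fun i => ?_) i
    simp only [Fin.cases_succ, RelE.wk3, RelE.sub_ren]
    exact (ρ i).sub_var
  rw [e3] at h3
  exact h3

theorem Proves.interp_ren_elim {l : ℕ} {σ : S.Ty l} {f : Fin l → Fin k}
    (hf : Function.Injective f) (hρ : ∀ i, IsRel T true Γ Θ (ρ i) (τ i) (τ' i))
    (hΦ : Wf T Γ Θ Φ) (ht : HasType (intCtx Γ) t ((σ.ren f).sub τ))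
    (hu : HasType (intCtx Γ) u ((σ.ren f).sub τ'))
    (h : Proves T Γ Θ Φ (.rel (.interp k (σ.ren f) ρ) t u)) :
    Proves T Γ Θ Φ (.rel (.interp l σ (fun i => ρ (f i))) t u) :=
  (Proves.interpRen f σ hf hρ).equiv_mp hΦ ht hu h

theorem Proves.interp_ren_intro {l : ℕ} {σ : S.Ty l} {f : Fin l → Fin k}
    (hf : Function.Injective f) (hρ : ∀ i, IsRel T true Γ Θ (ρ i) (τ i) (τ' i))
    (hΦ : Wf T Γ Θ Φ) (ht : HasType (intCtx Γ) t ((σ.ren f).sub τ))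
    (hu : HasType (intCtx Γ) u ((σ.ren f).sub τ'))
    (h : Proves T Γ Θ Φ (.rel (.interp l σ (fun i => ρ (f i))) t u)) :
    Proves T Γ Θ Φ (.rel (.interp k (σ.ren f) ρ) t u) :=
  (Proves.interpRen f σ hf hρ).equiv_mpr hΦ ht hu h

end Interp

/-! ### Identity extension -/

theorem IsFm.equiv {ρ ρ' : RelE S n} {σ τ : S.Ty n} (h : IsRel T false Γ Θ ρ σ τ)
    (h' : IsRel T false Γ Θ ρ' σ τ) : IsFm T Γ Θ (.equiv σ τ ρ ρ') := by
  have k : IsFm T (τ :: σ :: Γ) Θ (.rel (ρ.up 2) (.var 1) (.var 0)) :=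
    .rel (h.up [_, _]) (.var rfl) (.var rfl)
  have k' : IsFm T (τ :: σ :: Γ) Θ (.rel (ρ'.up 2) (.var 1) (.var 0)) :=
    .rel (h'.up [_, _]) (.var rfl) (.var rfl)
  exact .allX (.allX (.and (.imp k k') (.imp k' k)))

theorem IsFm.allTys {k : ℕ} {φ : Fm S k} (h : IsFm T [] [] φ) :
    IsFm T [] [] (Fm.allTys k φ) := by
  induction k with
  | zero => exact h
  | succ k ih => exact ih (.allT h)

theorem Proves.allTys_elim {k : ℕ} {φ : Fm S k} (h : Proves T [] [] [] (Fm.allTys k φ)) :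
    Proves T [] [] [] φ := by
  induction k with
  | zero => exact h
  | succ k ih => exact (ih h).allTE

theorem Fm.equiv_sub {m : ℕ} (a : Fin n → S.Ty m) (s : ℕ → Tm S m) (q : ℕ → RelE S m)
    (σ τ : S.Ty n) (ρ ρ' : RelE S n) : (Fm.equiv σ τ ρ ρ').sub a s q =
      .equiv (σ.sub a) (τ.sub a) (ρ.sub a s q) (ρ'.sub a s q) := by
  have e : ∀ ρ : RelE S n, (ρ.up 2).sub a (liftTm (liftTm s)) (fun i => ((q i).up 1).up 1) =
      (ρ.sub a s q).up 2 := fun ρ => by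
    simp only [RelE.up_up]
    simp only [RelE.up, RelE.sub_ren, RelE.ren_sub, id, Ty.ren_id]
    congr 1; funext i
    simp only [liftTm, Tm.up, Tm.ren_ren]; rfl
  simp only [Fm.equiv, Fm.iff, Fm.sub, e, Tm.sub]; rfl

/-- The schema is stated for type variables, in empty contexts. Opening its quantifiers and
substituting types yields it at arbitrary types and in every context. -/
theorem Proves.identity_extension (hident : identityExtension S ⊆ T) {k : ℕ} (σ : S.Ty k)
    (τ : Fin k → S.Ty n) : Proves T Γ Θ []
      (.equiv (σ.sub τ) (σ.sub τ) (.interp k σ (fun i => .eqr (τ i))) (.eqr (σ.sub τ))) := by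
  have hrel := IsRel.interp (T := T) (Γ := []) (Θ := []) σ
    (fun i => IsRel.eqr (T := T) (Ty.var i : S.Ty k))
  have hfm : IsFm T [] [] (Fm.equiv σ σ (.interp k σ (fun i => .eqr (.var i))) (.eqr σ)) := by
    refine .equiv ?_ (.ofAdm (.eqr σ))
    have e : σ.sub (fun i => Ty.var i) = σ := σ.sub_var
    rw [e] at hrel
    exact .ofAdm hrel
  have h := (Proves.ax (T := T) (hident ⟨k, σ, rfl⟩) hfm.allTys).allTys_elim
  have h' := h.sub (Γ' := Γ) (Θ' := Θ) τ .var .rvar (by simp) (by simp)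
  simp only [List.map_nil, Fm.equiv_sub, RelE.sub, RelE.eqr_sub, Ty.sub] at h'
  exact h'

theorem Proves.interp_eqr_elim (hident : identityExtension S ⊆ T) {k : ℕ} {σ : S.Ty k}
    {τ : Fin k → S.Ty n} {t u : Tm S n} (hΦ : Wf T Γ Θ Φ) (ht : HasType (intCtx Γ) t (σ.sub τ))
    (hu : HasType (intCtx Γ) u (σ.sub τ))
    (h : Proves T Γ Θ Φ (.rel (.interp k σ (fun i => .eqr (τ i))) t u)) :
    Proves T Γ Θ Φ (.eq (σ.sub τ) t u) :=
  .eqr_elim hΦ ht hu ((Proves.identity_extension hident σ τ).equiv_mp hΦ ht hu h)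

theorem Proves.interp_eqr_intro (hident : identityExtension S ⊆ T) {k : ℕ} {σ : S.Ty k}
    {τ : Fin k → S.Ty n} {t u : Tm S n} (hΦ : Wf T Γ Θ Φ) (ht : HasType (intCtx Γ) t (σ.sub τ))
    (hu : HasType (intCtx Γ) u (σ.sub τ)) (h : Proves T Γ Θ Φ (.eq (σ.sub τ) t u)) :
    Proves T Γ Θ Φ (.rel (.interp k σ (fun i => .eqr (τ i))) t u) :=
  (Proves.identity_extension hident σ τ).equiv_mpr hΦ ht hu (.eqr_intro hΦ ht hu h)

/-! ### Extensionality -/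

theorem Proves.lolli_ext (hext : extensionality S ⊆ T) {σ τ : S.Ty n} {t u : Tm S n}
    (ht : HasType (intCtx Γ) t (.lolli σ τ)) (hu : HasType (intCtx Γ) u (.lolli σ τ))
    (h : Proves T (σ :: Γ) Θ [] (.eq τ (.app (t.up 1) (.var 0)) (.app (u.up 1) (.var 0)))) :
    Proves T Γ Θ [] (.eq (.lolli σ τ) t u) :=
  .impE (.ax (hext (.fn ht hu)) (.imp (.allX (.eq ((ht.iup [σ]).iapp (.var rfl))
    ((hu.iup [σ]).iapp (.var rfl)))) (.eq ht hu))) (.allXI Wf.nil h)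

theorem HasType.tup_tapp {t : Tm S n} {τ : S.Ty (n + 1)} (h : HasType (intCtx Γ) t (.pi τ)) :
    HasType (intCtx (Γ.map Ty.wk)) (.tapp t.tup (.var 0)) τ := by
  have := HasType.itapp (.var 0) h.tup
  rwa [Ty.inst_wk] at this

theorem Proves.pi_ext (hext : extensionality S ⊆ T) {τ : S.Ty (n + 1)} {t u : Tm S n}
    (ht : HasType (intCtx Γ) t (.pi τ)) (hu : HasType (intCtx Γ) u (.pi τ))
    (h : Proves T (Γ.map Ty.wk) (Θ.map RDecl.wk) []
      (.eq τ (.tapp t.tup (.var 0)) (.tapp u.tup (.var 0)))) :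
    Proves T Γ Θ [] (.eq (.pi τ) t u) :=
  .impE (.ax (hext (.ty ht hu)) (.imp (.allT (.eq ht.tup_tapp hu.tup_tapp)) (.eq ht hu)))
    (.allTI Wf.nil h)

/-- As for application, the congruence comes from replacement inside a definable relation, here !a =
!b between a and b, starting from the pair (x, x). -/
theorem Proves.bang_congr {σ : S.Ty n} {x y : Tm S n} (hΦ : Wf T Γ Θ Φ)
    (hx : HasType (intCtx Γ) x σ) (hy : HasType (intCtx Γ) y σ)
    (h : Proves T Γ Θ Φ (.eq σ x y)) : Proves T Γ Θ Φ (.eq (.bang σ) (.bang x) (.bang y)) := by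
  have hφ : IsFm T (σ :: σ :: Γ) Θ (.eq (.bang σ) (.bang (.var 1)) (.bang (.var 0))) :=
    .eq (HasType.ibang (.var (by rfl))) (HasType.ibang (.var (by rfl)))
  have := (Proves.eqSubst (.abs hφ) (Proves.abs_intro hφ hΦ hx hx (by
    simp only [Fm.sub, Ty.sub_var]
    exact .refl hΦ hx.ibang)) (.refl hΦ hx) h).abs_elim hφ hΦ hx hy
  simp only [Fm.sub, Ty.sub_var] at this
  exact this

/-- Functions on `!σ` are equal if they agree on all `!x`. -/
theorem Proves.arr_ext (hext : extensionality S ⊆ T) (hident : identityExtension S ⊆ T)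
    {σ τ : S.Ty n} {t u : Tm S n} (ht : HasType (intCtx Γ) t (.arr σ τ))
    (hu : HasType (intCtx Γ) u (.arr σ τ))
    (h : Proves T (σ :: Γ) Θ []
      (.eq τ (.app (t.up 1) (.bang (.var 0))) (.app (u.up 1) (.bang (.var 0))))) :
    Proves T Γ Θ [] (.eq (.arr σ τ) t u) := by
  refine .lolli_ext hext ht hu ?_
  have ht1 := ht.iup [.bang σ]
  have hu1 := hu.iup [.bang σ]
  have hx : HasType (intCtx (.bang σ :: Γ)) (.var 0) (.bang σ) := .var rfl
  have hx' : HasType (intCtx (.bang σ :: Γ)) (.var 0) ((Ty.bang σ).sub .var) := by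
    rw [Ty.sub_var]; exact hx
  have hE : ∀ i : Fin n, IsRel T true (.bang σ :: Γ) Θ (.eqr (.var i)) (.var i) (.var i) :=
    fun i => .eqr _
  -- Identity extension at !σ relates the variable y : !σ to itself, and unfolding the
  -- interpretation of ! makes the relation !(σ[eq]). Testing it against eq_τ reduces t y = u y to
  -- the relatedness of t and u under σ[eq] → eq_τ.
  have e1 := Proves.interp_eqr_intro (Θ := Θ) hident .nil hx' hx' (.refl .nil hx')
  have e2 := (Proves.interpBang σ hE).equiv_mp .nil hx' hx' e1
  have hI : IsRel T false (.bang σ :: Γ) Θ (.interp n σ (fun i => .eqr (.var i))) σ σ := by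
    have := IsRel.interp σ hE
    have e : σ.sub (fun i => Ty.var i) = σ := σ.sub_var
    rw [e] at this
    exact .ofAdm this
  have hR := IsRel.eqr (T := T) (Γ := .bang σ :: Γ) (Θ := Θ) τ
  have es : σ.sub (fun i => Ty.var i) = σ := σ.sub_var
  simp only [es] at e2
  refine .eqr_elim .nil (ht1.iapp hx) (hu1.iapp hx) (.bang_elim hI hR .nil hx hx ht1 hu1 e2 ?_)
  refine .arr_intro hI hR.ofAdm ht1 hu1 ?_
  have hI2 := hI.up [σ, σ]
  have hΦ : Wf T (σ :: σ :: .bang σ :: Γ) Θ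
      [.rel ((RelE.interp n σ (fun i => .eqr (.var i))).up 2) (.var 1) (.var 0)] :=
    .singleton (.rel hI2 (.var rfl) (.var rfl))
  have eu : (RelE.interp n σ (fun i => .eqr (.var i)) : RelE S n).up 2 =
      .interp n σ (fun i => .eqr (.var i)) := by
    simp only [RelE.up, RelE.ren, RelE.eqr_ren, Ty.ren_id]
  have h1 : HasType (intCtx (σ :: σ :: .bang σ :: Γ)) (.var 1) σ := .var rfl
  have h0 : HasType (intCtx (σ :: σ :: .bang σ :: Γ)) (.var 0) σ := .var rfl
  have ht3 := ht1.iup [σ, σ]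
  have hu3 := hu1.iup [σ, σ]
  -- Identity extension once more, now at σ: related arguments are equal.
  have key : Proves T (σ :: σ :: .bang σ :: Γ) Θ
      [.rel ((RelE.interp n σ (fun i => .eqr (.var i))).up 2) (.var 1) (.var 0)]
      (.eq σ (.var 1) (.var 0)) := by
    rw [eu] at hΦ ⊢
    have := Proves.interp_eqr_elim (τ := Ty.var) hident hΦ (by rw [Ty.sub_var]; exact h1)
      (by rw [Ty.sub_var]; exact h0) (.head hΦ)
    rwa [Ty.sub_var] at this
  -- The argument in `h` becomes the left one of the two related arguments, which has index 1. The
  -- variables of `Γ` skip both arguments and the variable of type !σ, so they move up by two beyond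
  -- their places in `h`.
  have h' := h.ren (f := id) (r := fun i => liftIdx (· + 1) i + 1) (q := id)
    (Γ' := σ :: σ :: .bang σ :: Γ) (Θ' := Θ)
    (fun i ω hi => by
      rw [Ty.ren_id]
      match i, hi with
      | 0, hi => exact hi
      | i + 1, hi => exact hi) relRen_id
  simp only [List.map_nil, Fm.ren, Tm.ren, Ty.ren_id, Tm.up, Tm.ren_ren] at h'
  have eR : ∀ w : Tm S n, (w.up 1).up 2 =
      w.ren id (fun i => liftIdx (· + 1) (i + 1) + 1) := fun w => by
    simp only [Tm.up, Tm.ren_ren]; rfl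
  change HasType _ ((t.up 1).up 2) _ at ht3
  change HasType _ ((u.up 1).up 2) _ at hu3
  have h'' : Proves T (σ :: σ :: .bang σ :: Γ) Θ []
      (.eq τ (.app ((t.up 1).up 2) (.bang (.var 1))) (.app ((u.up 1).up 2) (.bang (.var 1)))) := by
    rw [eR, eR]; exact h'
  have eE : (RelE.eqr τ).up 2 = .eqr τ := by rw [RelE.up, RelE.eqr_ren, Ty.ren_id]
  rw [eE]
  -- With arguments a and b of type σ: t !a = u !a by assumption, and u !a = u !b because a = b.
  exact .eqr_intro hΦ (ht3.iapp h1.ibang) (hu3.iapp h0.ibang) (.eqTrans (h''.ofNil hΦ)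
    (.app_congr hΦ hu3 hu3 h1.ibang h0.ibang (.refl hΦ hu3) (.bang_congr hΦ h1 h0 key)))

end Rules

end

section

variable {S : Sig.{u, v}}

/-! ## The action of a type on identities -/

theorem Tm.comp_sub {n m : ℕ} (σ : S.Ty n) (g f : Tm S n) (a : Fin n → S.Ty m) (p : ℕ → Tm S m) :
    (Tm.comp σ g f).sub a p = .comp (σ.sub a) (g.sub a p) (f.sub a p) := by
  simp only [Tm.comp, Tm.sub, Tm.up_sub]; rfl

theorem Tm.up_add {n : ℕ} (t : Tm S n) (k l : ℕ) : (t.up k).up l = t.up (k + l) := by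
  simp only [Tm.up, Tm.ren_ren, Nat.add_assoc]; rfl

theorem Tm.up_two_sub {n m : ℕ} (t : Tm S n) (a : Fin n → S.Ty m) (s : ℕ → Tm S m) :
    (t.up 2).sub a (liftTm (liftTm s)) = (t.sub a s).up 2 := by
  rw [← t.up_add 1 1, ← (t.sub a s).up_add 1 1, Tm.up_sub, Tm.up_sub]

theorem Tm.up_three_sub {n m : ℕ} (t : Tm S n) (a : Fin n → S.Ty m) (s : ℕ → Tm S m) :
    (t.up 3).sub a (liftTm (liftTm (liftTm s))) = (t.sub a s).up 3 := by
  rw [← t.up_add 2 1, ← (t.sub a s).up_add 2 1, Tm.up_sub, Tm.up_two_sub]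

/-- The maps acted on are parameters of a recursion outside the calculus. Because substitution
passes through it, `M_σ` applied to two types and to !f reduces by beta to the action on f itself.
-/
theorem act_sub : {k n m : ℕ} → (σ : S.Ty k) → (s s' : Fin k → S.Ty n) → (c : Fin k → Tm S n) →
    (a : Fin n → S.Ty m) → (p : ℕ → Tm S m) → (act σ s s' c).sub a p =
      act σ (fun i => (s i).sub a) (fun i => (s' i).sub a) (fun i => (c i).sub a p)
  | _, _, _, .var i, _, _, _, _, _ => rfl
  | _, _, _, .con d e, s, _, _, a, p => by
      simp only [act, Tm.idt, Tm.sub, Ty.sub_sub]; rfl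
  | _, _, _, .one, _, _, _, _, _ => rfl
  | _, _, _, .tensor σ τ, s, s', c, a, p => by
      simp only [act, Tm.sub, act_sub σ, act_sub τ, Ty.sub, Ty.sub_sub, Tm.up_three_sub]; rfl
  | _, _, _, .lolli σ τ, s, s', c, a, p => by
      simp only [act, Tm.sub, Tm.comp_sub, act_sub σ, act_sub τ, Ty.sub, Ty.sub_sub, Tm.up_sub]
      rfl
  | _, _, _, .bang σ, s, s', c, a, p => by
      simp only [act, Tm.sub, act_sub σ, Ty.sub, Ty.sub_sub, Tm.up_two_sub]; rfl
  | k, n, m, .pi σ, s, s', c, a, p => by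
      have e1 : ∀ s : Fin k → S.Ty n, (fun i => (liftTy s i).sub (liftTy a)) =
          liftTy (fun i => (s i).sub a) := fun s => funext (sub_liftTy s a)
      simp only [act, Tm.sub, act_sub σ, Ty.sub, Ty.sub_sub, e1]
      congr 5
      funext i
      refine Fin.cases rfl (fun i => ?_) i
      simp only [Fin.cases_succ, Tm.tup_sub, Tm.up_sub]

theorem Tm.ilam_sub {n m : ℕ} (σ : S.Ty n) (t : Tm S n) (a : Fin n → S.Ty m) (p : ℕ → Tm S m) :
    (Tm.ilam σ t).sub a p = .ilam (σ.sub a) (t.sub a (liftTm p)) := by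
  simp only [Tm.ilam, Tm.sub, Tm.sub_ren, Tm.ren_sub, id, Ty.ren_id, Ty.sub]
  congr 3
  funext i
  cases i with
  | zero => rfl
  | succ i => simp only [liftIdx, liftTm, Tm.up, Tm.ren_ren]

theorem intCtx_wk {n : ℕ} (Γ : List (S.Ty n)) :
    (intCtx Γ).map (Entry.ren Fin.succ) = intCtx (Γ.map Ty.wk) := by
  simp only [intCtx, List.map_map]; rfl

section Rules

variable {T : Theory S} {n : ℕ} {Γ : List (S.Ty n)} {Θ : List (RDecl S n)} {Φ : List (Fm S n)}

theorem HasType.itlam {t : Tm S (n + 1)} {σ : S.Ty (n + 1)}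
    (h : HasType (intCtx (Γ.map Ty.wk)) t σ) : HasType (intCtx Γ) (.tlam t) (.pi σ) :=
  .tlam (by rw [intCtx_wk]; exact h)

theorem ExtEq.iapp {t t' u u' : Tm S n} {σ τ : S.Ty n}
    (h : ExtEq (intCtx Γ) t t' (.lolli σ τ)) (h' : ExtEq (intCtx Γ) u u' σ) :
    ExtEq (intCtx Γ) (.app t u) (.app t' u') τ :=
  .app (Split.self (noLin_intCtx _)) h h'

/-- The beta rule for intuitionistic abstractions. -/
theorem ExtEq.ilam_app {t u : Tm S n} {σ τ : S.Ty n} (ht : HasType (intCtx (σ :: Γ)) t τ)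
    (hu : HasType (intCtx Γ) u σ) :
    ExtEq (intCtx Γ) (.app (.ilam σ t) (.bang u)) (t.sub .var (inst1 u)) τ := by
  have h1 := ExtEq.beta (HasType.iapp (HasType.ilam (G := intCtx Γ) ht) hu.ibang)
  have e : (Tm.letB σ (.var 0) (t.ren id (liftIdx (· + 1)))).sub .var (inst1 (.bang u)) =
      .letB σ (.bang u) t := by
    simp only [Tm.sub, Ty.sub_var, Tm.sub_ren]
    congr 1
    refine Eq.trans ?_ t.sub_var
    congr 1; funext i; cases i <;> rfl
  rw [e] at h1
  exact h1.trans (.betaB (.letB (Split.self (noLin_intCtx _)) hu.ibang ht))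

/-- Linear variables are allowed in the context: the identity is closed, so all of them go to the
argument. -/
theorem ExtEq.idt_app {G : Ctx S n} {x : Tm S n} {A : S.Ty n} (hx : HasType G x A) :
    ExtEq G (.app (.idt A) x) x A := by
  obtain ⟨G₀, h0, hs⟩ := Split.allRight G
  exact .beta (t := .var 0) (.app hs (.idt' h0 A) hx)

/-- The three unavailable positions hold the consumed tensor variable and its two components, none
of which may occur in the maps applied to the components. -/
theorem HasType.tensorMap {G : Ctx S n} (hG : NoLin G) {f g : Tm S n} {σ τ σ' τ' : S.Ty n}
    (hf : HasType (.off :: .off :: .off :: G) f (.lolli σ σ'))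
    (hg : HasType (.off :: .off :: .off :: G) g (.lolli τ τ')) :
    HasType G (.lam (.tensor σ τ) (.letT σ τ (.var 0)
      (.tensor (.app f (.var 1)) (.app g (.var 0))))) (.lolli (.tensor σ τ) (.tensor σ' τ')) := by
  have hs := Split.self hG
  refine .lam (.letT (.left _ hs) (.lvar rfl (by simpa [NoLin] using hG)) ?_)
  refine .tensor (.right _ (.left _ (.off hs))) (σ := σ') (τ := τ') ?_ ?_
  · exact .app (.off (.right _ (.off hs))) hf (.lvar rfl (by simpa [NoLin] using hG))
  · exact .app (.right _ (.off (.off hs))) hg (.lvar rfl (by simpa [NoLin] using hG))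

theorem HasType.bangMap {G : Ctx S n} (hG : NoLin G) {f : Tm S n} {σ σ' : S.Ty n}
    (hf : HasType (.int σ :: .off :: G) f (.lolli σ σ')) :
    HasType G (.lam (.bang σ) (.letB σ (.var 0) (.bang (.app f (.var 0)))))
      (.lolli (.bang σ) (.bang σ')) := by
  have hN : NoLin (Entry.int σ :: .off :: G) := by simpa [NoLin] using hG
  exact .lam (.letB (.left _ (Split.self hG)) (.lvar rfl (by simpa [NoLin] using hG))
    (.bang hN (.app (Split.self hN) hf (.ivar hN rfl))))

/-- Provable equality of closed terms does not depend on the context. -/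
theorem Proves.eq_weaken {σ : S.Ty n} {t u : Tm S n} (h : Proves T [] [] [] (.eq σ t u)) :
    Proves T Γ Θ [] (.eq σ t u) := by
  have := h.sub (Γ' := Γ) (Θ' := Θ) .var .var .rvar (by simp) (by simp)
  simpa only [List.map_nil, Fm.sub_var] using this

/-- Polarity plays no role here, since an identity is a map in both directions. The induction for
σ(id) = id can therefore run over all types. -/
theorem act_idt_hasType {k : ℕ} (σ : S.Ty k) (s : Fin k → S.Ty n) :
    HasType [] (act σ s s (fun i => .idt (s i))) (.lolli (σ.sub s) (σ.sub s)) :=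
  act_hasType σ s s _ [] noLin_nil (fun _ _ => .inr ⟨rfl, rfl⟩) (fun _ _ => .inr ⟨rfl, rfl⟩)
    (fun _ _ => rfl)

theorem Tm.idt_up (σ : S.Ty n) (k : ℕ) : (Tm.idt σ).up k = .idt σ := (HasType.idt σ).up_eq k

end Rules

/-- Induction on the type. For ⊗ and ! the component actions are replaced by identities, and the eta
rule of the corresponding let finishes. For ⊸ and ∏ extensionality reduces the claim to arguments,
where beta exposes the component actions; for ∏ the induction hypothesis lives over one more type
variable. -/
theorem Proves.act_idt {T : Theory S} (hext : extensionality S ⊆ T) : {k n : ℕ} → (σ : S.Ty k) →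
    (s : Fin k → S.Ty n) → Proves T [] [] [] (.eq (.lolli (σ.sub s) (σ.sub s))
      (act σ s s (fun i => .idt (s i))) (.idt (σ.sub s)))
  | _, _, .var i, s => .eqRefl (.idt _)
  | _, _, .con d a, s => .eqRefl (.idt _)
  | _, _, .one, s => .eqRefl (.idt _)
  | k, n, .tensor σ τ, s => by
      have hA := act_idt_hasType σ s
      have hB := act_idt_hasType τ s
      have ihA := Proves.act_idt hext σ s
      have ihB := Proves.act_idt hext τ s
      have hN : ∀ A : S.Ty n, NoLin (.off :: .off :: .off :: intCtx [A]) := fun A => by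
        simp [NoLin, intCtx]
      have hN' : NoLin (.off :: .off :: .off :: [] : Ctx S n) := by simp [NoLin]
      simp only [act, Tm.idt_up]
      generalize act σ s s (fun i => .idt (s i)) = A at *
      generalize act τ s s (fun i => .idt (s i)) = B at *
      simp only [Ty.sub]
      generalize σ.sub s = σ at *
      generalize τ.sub s = τ at *
      -- The action to be replaced is abstracted to a variable. It has index 3 because the term
      -- binds the pair and its two components above it.
      have k1 : ∀ x : Tm S n, HasType [] x (.lolli σ σ) →
          (Tm.lam (.tensor σ τ) (.letT σ τ (.var 0) (.tensor (.app (.var 3) (.var 1))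
            (.app B (.var 0))))).sub .var (inst1 x) =
          .lam (.tensor σ τ) (.letT σ τ (.var 0) (.tensor (.app x (.var 1))
            (.app B (.var 0)))) := fun x hx => by
        simp only [Tm.sub, Ty.sub_var, hB.sub_eq, liftTm, inst1, hx.up_eq]
        rfl
      have k2 : ∀ x : Tm S n, HasType [] x (.lolli τ τ) →
          (Tm.lam (.tensor σ τ) (.letT σ τ (.var 0) (.tensor (.app (.idt σ) (.var 1))
            (.app (.var 3) (.var 0))))).sub .var (inst1 x) =
          .lam (.tensor σ τ) (.letT σ τ (.var 0) (.tensor (.app (.idt σ) (.var 1))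
            (.app x (.var 0)))) := fun x hx => by
        simp only [Tm.sub, Ty.sub_var, (HasType.idt σ).sub_eq, liftTm, inst1, hx.up_eq]
        rfl
      have hI := HasType.idt σ
      have hI' := HasType.idt τ
      have r1 := Proves.replace (w := .lam (.tensor σ τ) (.letT σ τ (.var 0)
          (.tensor (.app (.var 3) (.var 1)) (.app B (.var 0))))) hA hI
        (.tensorMap (noLin_intCtx _) (.ivar (hN _) rfl) (hB.closed (hN _)))
        (by rw [k1 A hA]; exact .tensorMap noLin_nil (hA.closed hN') (hB.closed hN')) ihA
      have r2 := Proves.replace (w := .lam (.tensor σ τ) (.letT σ τ (.var 0)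
          (.tensor (.app (.idt σ) (.var 1)) (.app (.var 3) (.var 0))))) hB hI'
        (.tensorMap (noLin_intCtx _) (hI.closed (hN _)) (.ivar (hN _) rfl))
        (by rw [k2 B hB]; exact .tensorMap noLin_nil (hI.closed hN') (hB.closed hN')) ihB
      rw [k1 A hA, k1 _ hI] at r1
      rw [k2 B hB, k2 _ hI'] at r2
      refine .eqTrans r1 (.eqTrans r2 (.ofExt
        (.tensorMap noLin_nil (hI.closed hN') (hI'.closed hN')) (HasType.idt _) (.lam ?_)))
      -- With both actions replaced, the body is (id x) ⊗ (id y); two beta steps and the eta rule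
      -- for ⊗ remain.
      refine .trans (.letT (.left _ .nil) (.refl (.bv _))
        (.tensor (.right _ (.left _ (.off .nil)))
          (.idt_app (.lvar rfl (by simp [NoLin]))) (.idt_app (.lvar rfl (by simp [NoLin])))))
        (.etaT (.bv _))
  | k, n, .lolli σ τ, s => by
      have hA := act_idt_hasType σ s
      have hB := act_idt_hasType τ s
      have ihA := Proves.act_idt hext σ s
      have ihB := Proves.act_idt hext τ s
      have hL := act_idt_hasType (.lolli σ τ) s
      simp only [act, Tm.idt_up] at hL ⊢
      generalize act σ s s (fun i => .idt (s i)) = A at *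
      generalize act τ s s (fun i => .idt (s i)) = B at *
      simp only [Ty.sub] at hL ⊢
      generalize σ.sub s = σ at *
      generalize τ.sub s = τ at *
      have eC : Tm.comp σ B (.comp σ (.var 0) A) =
          .lam σ (.app B (.app (.lam σ (.app (.var 2) (.app A (.var 0)))) (.var 0))) := by
        simp only [Tm.comp, hB.up_eq, hA.up_eq]
        simp only [Tm.up, Tm.ren, Ty.ren_id]
        rw [hA.ren_eq _ (by simp)]; rfl
      have h0 : HasType (intCtx [.lolli σ τ]) (.var 0) (.lolli σ τ) := .var rfl
      have hA2 := hA.closed (noLin_intCtx [σ, .lolli σ τ])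
      have hB2 := hB.closed (noLin_intCtx [σ, .lolli σ τ])
      have hL1 := hL.closed (noLin_intCtx [.lolli σ τ])
      have hL2 := hL.closed (noLin_intCtx [σ, .lolli σ τ])
      have x0 : HasType (intCtx [σ, .lolli σ τ]) (.var 0) σ := .var rfl
      have x1 : HasType (intCtx [σ, .lolli σ τ]) (.var 1) (.lolli σ τ) := .var rfl
      have hC : HasType (intCtx [.lolli σ τ]) (.comp σ B (.comp σ (.var 0) A)) (.lolli σ τ) :=
        .comp (noLin_intCtx _) (hB.closed (noLin_intCtx _))
          (.comp (noLin_intCtx _) h0 (hA.closed (noLin_intCtx _)))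
      -- Extensionality is used twice, first for the function f acted on and then for its argument
      -- x. Beta turns the left side into B (f (A x)), where the induction hypotheses make A and B
      -- identities.
      refine .lolli_ext hext hL (HasType.idt _) ?_
      rw [hL.up_eq, Tm.idt_up]
      have b1 := ExtEq.beta (hL1.iapp h0)
      have e1 : (Tm.comp σ B (.comp σ (.var 0) A)).sub .var (inst1 (.var 0)) =
          .comp σ B (.comp σ (.var 0) A) := by
        simp only [Tm.comp_sub, Ty.sub_var, hA.sub_eq, hB.sub_eq]; rfl
      rw [e1] at b1
      refine .eqTrans (.ext .nil (hL1.iapp h0) hC b1) (.eqTrans ?_ (.eqSymm (.idt_app .nil h0)))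
      refine .lolli_ext hext hC h0 ?_
      have hC1 := hC.iup [σ]
      have e2 : (Tm.comp σ B (.comp σ (.var 0) A)).up 1 =
          .lam σ (.app B (.app (.lam σ (.app (.var 3) (.app A (.var 0)))) (.var 0))) := by
        rw [eC]
        simp only [Tm.up, Tm.ren, Ty.ren_id]
        rw [hA.ren_eq _ (by simp), hB.ren_eq _ (by simp)]; rfl
      change HasType _ ((Tm.comp σ B (.comp σ (.var 0) A)).up 1) _ at hC1
      rw [e2] at hC1 ⊢
      have b2 := ExtEq.beta (hC1.iapp x0)
      have e3 : (Tm.app B (.app (.lam σ (.app (.var 3) (.app A (.var 0)))) (.var 0))).sub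
          .var (inst1 (.var 0)) =
          .app B (.app (.lam σ (.app (.var 2) (.app A (.var 0)))) (.var 0)) := by
        simp only [Tm.sub, hA.sub_eq, hB.sub_eq, Ty.sub_var]; rfl
      rw [e3] at b2
      have hN3 : NoLin (Entry.off :: intCtx [σ, .lolli σ τ]) := by simp [NoLin, intCtx]
      have hD : HasType (intCtx [σ, .lolli σ τ]) (.lam σ (.app (.var 2) (.app A (.var 0))))
          (.lolli σ τ) :=
        .lam (.app (.right _ (Split.self (noLin_intCtx _))) (.ivar hN3 rfl)
          (.app (.right _ (Split.self (noLin_intCtx _))) (hA.closed hN3) (.lvar rfl hN3)))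
      have b3 := ExtEq.beta (hD.iapp x0)
      have e4 : (Tm.app (.var 2) (.app A (.var 0))).sub .var (inst1 (.var 0)) =
          .app (.var 1) (.app A (.var 0)) := by
        simp only [Tm.sub, hA.sub_eq]; rfl
      rw [e4] at b3
      have c1 : Proves T [σ, .lolli σ τ] [] [] (.eq τ (.app (.var 1) (.app A (.var 0)))
          (.app (.var 1) (.var 0))) :=
        .app_congr .nil x1 x1 (hA2.iapp x0) x0 (.refl .nil x1) (.eqTrans
          (.app_congr .nil hA2 (.iidt σ) x0 x0 ihA.eq_weaken (.refl .nil x0)) (.idt_app .nil x0))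
      have c2 : Proves T [σ, .lolli σ τ] [] [] (.eq τ (.app B (.app (.var 1) (.app A (.var 0))))
          (.app (.var 1) (.var 0))) :=
        .eqTrans (.app_congr .nil hB2 (.iidt τ) (x1.iapp (hA2.iapp x0)) (x1.iapp x0)
          ihB.eq_weaken c1) (.idt_app .nil (x1.iapp x0))
      exact .eqTrans (.ext .nil (hC1.iapp x0) (hB2.iapp (x1.iapp (hA2.iapp x0)))
        (b2.trans (.iapp (.refl hB2) b3))) c2
  | k, n, .bang σ, s => by
      have hA := act_idt_hasType σ s
      have ihA := Proves.act_idt hext σ s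
      simp only [act, Tm.idt_up]
      generalize act σ s s (fun i => .idt (s i)) = A at *
      simp only [Ty.sub]
      generalize σ.sub s = σ at *
      -- The positions are those of the unpacked intuitionistic variable and of the consumed
      -- variable of type !σ.
      have hN : NoLin (.int σ :: .off :: intCtx [.lolli σ σ]) := by simp [NoLin, intCtx]
      have hN' : NoLin (.int σ :: .off :: [] : Ctx S n) := by simp [NoLin]
      have k1 : ∀ x : Tm S n, HasType [] x (.lolli σ σ) →
          (Tm.lam (.bang σ) (.letB σ (.var 0) (.bang (.app (.var 2) (.var 0))))).sub
            .var (inst1 x) =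
          .lam (.bang σ) (.letB σ (.var 0) (.bang (.app x (.var 0)))) := fun x hx => by
        simp only [Tm.sub, Ty.sub_var, liftTm, inst1, hx.up_eq]
      have hI := HasType.idt σ
      have r1 := Proves.replace
        (w := .lam (.bang σ) (.letB σ (.var 0) (.bang (.app (.var 2) (.var 0))))) hA hI
        (.bangMap (noLin_intCtx _) (.ivar hN rfl))
        (by rw [k1 A hA]; exact .bangMap noLin_nil (hA.closed hN')) ihA
      rw [k1 A hA, k1 _ hI] at r1
      refine .eqTrans r1 (.ofExt (.bangMap noLin_nil (hI.closed hN')) (HasType.idt _) (.lam ?_))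
      exact .trans (.letB (.left _ .nil) (.refl (.bv _)) (.bang hN' (.idt_app (.ivar hN' rfl))))
        (.etaB (.bv _))
  | k, n, .pi σ, s => by
      have hA := act_idt_hasType σ (liftTy s)
      have ihA := Proves.act_idt hext σ (liftTy s)
      have hL := act_idt_hasType (.pi σ) s
      -- The bound variable is acted on by the identity, so below ∏ there is again an action on
      -- identities, now for the lifted family of types.
      have ec : (Fin.cases (.idt (.var 0)) (fun i => ((Tm.idt (s i)).up 1).tup) :
          Fin (k + 1) → Tm S (n + 1)) = fun i => .idt (liftTy s i) := by
        funext i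
        refine Fin.cases rfl (fun i => ?_) i
        simp only [Fin.cases_succ, Tm.idt_up]; rfl
      simp only [act, ec] at hL ⊢
      generalize act σ (liftTy s) (liftTy s) (fun i => .idt (liftTy s i)) = A at *
      simp only [Ty.sub] at hL ⊢
      generalize σ.sub (liftTy s) = σ at *
      have h0 : HasType (intCtx [.pi σ]) (.var 0) (.pi σ) := .var rfl
      have hL1 := hL.closed (noLin_intCtx [.pi σ])
      refine .lolli_ext hext hL (HasType.idt _) ?_
      rw [hL.up_eq, Tm.idt_up]
      have h1 : HasType (intCtx [(Ty.pi σ).wk]) (.tapp (.var 0) (.var 0)) σ := h0.tup_tapp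
      have hA1 := hA.closed (noLin_intCtx [(Ty.pi σ).wk])
      have hC : HasType (intCtx [.pi σ]) (.tlam (.app A (.tapp (.var 0) (.var 0)))) (.pi σ) :=
        .itlam (hA1.iapp h1)
      have b1 := ExtEq.beta (hL1.iapp h0)
      have e1 : (Tm.tlam (.app A (.tapp (.var 0) (.var 0)))).sub .var (inst1 (.var 0)) =
          .tlam (.app A (.tapp (.var 0) (.var 0))) := by
        simp only [Tm.sub, liftTy_var, hA.sub_eq]; rfl
      rw [e1] at b1
      refine .eqTrans (.ext .nil (hL1.iapp h0) hC b1) (.eqTrans ?_ (.eqSymm (.idt_app .nil h0)))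
      refine .pi_ext hext hC h0 ?_
      have b2 := ExtEq.tbeta hC.tup_tapp
      have e2 : ((Tm.app A (.tapp (.var 0) (.var 0))).ren (liftRen Fin.succ) id).sub
          (instTy (.var 0)) .var = .app A (.tapp (.var 0) (.var 0)) := by
        rw [Tm.sub_ren]
        have : (fun i => instTy (Ty.var 0 : S.Ty (n + 1)) (liftRen Fin.succ i)) = Ty.var := by
          funext i; exact Fin.cases rfl (fun _ => rfl) i
        rw [this]; exact Tm.sub_var _
      rw [e2] at b2
      exact .eqTrans (.ext .nil hC.tup_tapp (hA1.iapp h1) b2) (.eqTrans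
        (.app_congr .nil hA1 (.iidt σ) h1 h1 ihA.eq_weaken (.refl .nil h1)) (.idt_app .nil h1))

end

section

variable {S : Sig.{u, v}}

/-! ## Parametricity of the action of a type on maps -/

theorem Ty.sub_liftTy_instTy {K : TySig.{u}} {n k : ℕ} (σ : Ty K (k + 1)) (τ : Fin k → Ty K n)
    (A : Ty K n) :
    (σ.sub (liftTy τ)).sub (instTy A) = σ.sub (Fin.cases A τ : Fin (k + 1) → Ty K n) := by
  rw [Ty.sub_sub]
  congr 1; funext i
  exact Fin.cases rfl (fun i => Ty.wk_sub_instTy (τ i) A) i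

/-- The type `∏α, β. (α ⊸ β) → σ(α) ⊸ σ(β)`. -/
def functorTy {K : TySig.{u}} {n : ℕ} (σ : Ty K 1) : Ty K n :=
  .pi (.pi (.arr (.lolli (.var 1) (.var 0)) (.lolli (σ.at (.var 1)) (σ.at (.var 0)))))

theorem functorTy_sub {K : TySig.{u}} {n m : ℕ} (σ : Ty K 1) (s : Fin n → Ty K m) :
    (functorTy σ).sub s = functorTy σ := by
  simp only [functorTy, Ty.sub, Ty.arr, Ty.at_sub]; rfl

theorem Ty.at_var {K : TySig.{u}} {n : ℕ} (σ : Ty K 1) (i : Fin n) :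
    σ.at (.var i) = σ.ren (fun _ => i) := (Ty.ren_eq_sub _ _).symm

theorem Ty.at_var_zero {K : TySig.{u}} (σ : Ty K 1) : σ.at (.var 0) = σ := by
  have : (fun _ => .var 0 : Fin 1 → Ty K 1) = .var := by
    funext i; rw [Subsingleton.elim i 0]
  rw [Ty.at, this, Ty.sub_var]

section Rules

variable {T : Theory S} {n : ℕ} {Γ : List (S.Ty n)} {Θ : List (RDecl S n)} {Φ : List (Fm S n)}

/-- Relational parametricity of closed terms. -/
theorem Proves.parametric (hident : identityExtension S ⊆ T) {σ : S.Ty 0} {ρ : Fin 0 → RelE S n}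
    {τ : Fin 0 → S.Ty n} {t : Tm S n} (ht : HasType (intCtx Γ) t (σ.sub τ)) :
    Proves T Γ Θ [] (.rel (.interp 0 σ ρ) t t) := by
  -- There is only one empty family of relations, so it is in particular the family of identity
  -- relations, and identity extension applies.
  have : ρ = fun i => .eqr (τ i) := Subsingleton.elim _ _
  rw [this]
  exact .interp_eqr_intro hident .nil ht ht (.refl .nil ht)

theorem Proves.cut {φ ψ : Fm S n} (hΦ : Wf T Γ Θ Φ) (h : Proves T Γ Θ Φ φ)
    (h' : Proves T Γ Θ [φ] ψ) : Proves T Γ Θ Φ ψ :=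
  .impE (h'.impI.ofNil hΦ) h

/-- If `f` and `g` map `R`-related arguments to `R'`-related values, then `σ(f)` and `σ(g)` map
`σ[R]`-related arguments to `σ[R']`-related values. -/
theorem Proves.mapTm_parametric (hident : identityExtension S ⊆ T) {σ : S.Ty 1}
    (hσ : IndConstr σ) (hpos : ¬ σ.Occ false 0) {R R' : RelE S n} {A A' B B' : S.Ty n}
    {f g x y : Tm S n} (hR : IsRel T true Γ Θ R A A') (hR' : IsRel T true Γ Θ R' B B')
    (hf : HasType (intCtx Γ) f (.lolli A B)) (hg : HasType (intCtx Γ) g (.lolli A' B'))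
    (hfg : Proves T (A' :: A :: Γ) Θ [.rel (R.up 2) (.var 1) (.var 0)]
      (.rel (R'.up 2) (.app (f.up 2) (.var 1)) (.app (g.up 2) (.var 0))))
    (hΦ : Wf T Γ Θ Φ) (hx : HasType (intCtx Γ) x (σ.at A)) (hy : HasType (intCtx Γ) y (σ.at A'))
    (h : Proves T Γ Θ Φ (.rel (.interp 1 σ (fun _ => R)) x y)) :
    Proves T Γ Θ Φ (.rel (.interp 1 σ (fun _ => R')) (.app (mapTm σ A B f) x)
      (.app (mapTm σ A' B' g) y)) := by
  have hM : HasType (intCtx Γ) (functorTm σ) (functorTy σ) :=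
    functorTm_hasType hσ hpos (noLin_intCtx _)
  have hM0 : ∀ τ : Fin 0 → S.Ty n, HasType (intCtx Γ) (functorTm σ) ((functorTy σ).sub τ) :=
    fun τ => by rw [functorTy_sub]; exact hM
  let τ₀ : Fin 0 → S.Ty n := Fin.elim0
  let ρ₀ : Fin 0 → RelE S n := Fin.elim0
  have hρ₀ : ∀ i, IsRel T true Γ Θ (ρ₀ i) (τ₀ i) (τ₀ i) := fun i => i.elim0
  have hρ₁ : ∀ i, IsRel T true Γ Θ ((Fin.cases R ρ₀ : Fin 1 → RelE S n) i)
      ((Fin.cases A τ₀ : Fin 1 → S.Ty n) i) ((Fin.cases A' τ₀ : Fin 1 → S.Ty n) i) :=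
    fun i => Fin.cases hR hρ₀ i
  have hρ₂ : ∀ i, IsRel T true Γ Θ
      ((Fin.cases R' (Fin.cases R ρ₀ : Fin 1 → RelE S n) : Fin 2 → RelE S n) i)
      ((Fin.cases B (Fin.cases A τ₀ : Fin 1 → S.Ty n) : Fin 2 → S.Ty n) i)
      ((Fin.cases B' (Fin.cases A' τ₀ : Fin 1 → S.Ty n) : Fin 2 → S.Ty n) i) :=
    fun i => Fin.cases hR' hρ₁ i
  have t1 : ∀ C : S.Ty n, HasType (intCtx Γ) (.tapp (functorTm σ) C)
      ((Ty.pi (.arr (.lolli (.var 1) (.var 0)) (.lolli (σ.at (.var 1)) (σ.at (.var 0))))).sub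
        (Fin.cases C τ₀ : Fin 1 → S.Ty n)) := fun C => by
    rw [← Ty.sub_liftTy_instTy]; exact (hM0 τ₀).itapp C
  have t2 : ∀ C D : S.Ty n, HasType (intCtx Γ) (.tapp (.tapp (functorTm σ) C) D)
      ((Ty.arr (.lolli (.var 1) (.var 0)) (.lolli (σ.at (.var 1)) (σ.at (.var 0)))).sub
        (Fin.cases D (Fin.cases C τ₀ : Fin 1 → S.Ty n) : Fin 2 → S.Ty n)) := fun C D => by
    rw [← Ty.sub_liftTy_instTy]; exact (t1 C).itapp D
  -- Parametricity of `M_σ`, instantiated first with R for α and then with R' for β. As β is bound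
  -- last, it has index 0 and α has index 1.
  have p0 := Proves.parametric (Θ := Θ) (ρ := ρ₀) hident (hM0 τ₀)
  have p1 := Proves.interp_pi_elim hρ₀ hR .nil (hM0 τ₀) (hM0 τ₀) p0
  have p2 := Proves.interp_pi_elim hρ₁ hR' .nil (t1 A) (t1 A') p1
  have hf2 : ∀ i, IsRel T true (A' :: A :: Γ) Θ
      (((Fin.cases R' (Fin.cases R ρ₀ : Fin 1 → RelE S n) : Fin 2 → RelE S n) i).up 2)
      ((Fin.cases B (Fin.cases A τ₀ : Fin 1 → S.Ty n) : Fin 2 → S.Ty n) i)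
      ((Fin.cases B' (Fin.cases A' τ₀ : Fin 1 → S.Ty n) : Fin 2 → S.Ty n) i) :=
    fun i => (hρ₂ i).up [A', A]
  have hv1 : HasType (intCtx (A' :: A :: Γ)) (.var 1) A := .var rfl
  have hv0 : HasType (intCtx (A' :: A :: Γ)) (.var 0) A' := .var rfl
  -- The hypothesis on f and g, rephrased as membership in the interpretation of α ⊸ β.
  have q1 : Proves T Γ Θ [] (.rel (.interp 2 (.lolli (.var 1) (.var 0))
      (Fin.cases R' (Fin.cases R ρ₀ : Fin 1 → RelE S n))) f g) := by
    refine .interp_lolli_intro hρ₂ hf hg ?_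
    have hΨ : Wf T (A' :: A :: Γ) Θ [.rel (.interp 2 (.var 1) (fun i =>
        ((Fin.cases R' (Fin.cases R ρ₀ : Fin 1 → RelE S n) : Fin 2 → RelE S n) i).up 2))
        (.var 1) (.var 0)] :=
      .singleton (.rel (.ofAdm (.interp (.var 1) hf2)) hv1 hv0)
    exact .interp_var_intro 0 hf2 hΨ ((hf.iup [A', A]).iapp hv1) ((hg.iup [A', A]).iapp hv0)
      (.cut hΨ (.interp_var_elim 1 hf2 hΨ hv1 hv0 (.head hΨ)) hfg)
  have p3 := Proves.interp_lolli_elim hρ₂ .nil (t2 A B) (t2 A' B')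
    (HasType.ibang hf) (HasType.ibang hg) p2 (.interp_bang_intro hρ₂ hf hg q1)
  have e : ∀ (i : Fin 2) (s : Fin 2 → S.Ty n),
      (σ.ren (fun _ => i)).sub s = σ.at (s i) := fun i s => Ty.sub_ren _ _ _
  have hmf := mapTm_hasType hσ hpos (noLin_intCtx _) hf
  have hmg := mapTm_hasType hσ hpos (noLin_intCtx _) hg
  have hinj : ∀ i : Fin 2, Function.Injective (fun _ : Fin 1 => i) :=
    fun _ _ _ _ => Subsingleton.elim _ _
  -- Inside the type of `M_σ`, σ(α) and σ(β) are renamings of σ along the two maps from one variable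
  -- to two. These maps are injective, so the interpretations are identified with σ[R] and σ[R'].
  rw [Ty.at_var, Ty.at_var] at p3
  have r1 := Proves.interp_ren_intro (σ := σ) (hinj 1) hρ₂ hΦ (by rw [e]; exact hx)
    (by rw [e]; exact hy) h
  have p4 := Proves.interp_lolli_elim hρ₂ hΦ (by simp only [Ty.sub, e]; exact hmf)
    (by simp only [Ty.sub, e]; exact hmg) (by rw [e]; exact hx) (by rw [e]; exact hy)
    (p3.ofNil hΦ) r1
  exact Proves.interp_ren_elim (hinj 0) hρ₂ hΦ (by rw [e]; exact hmf.iapp hx)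
    (by rw [e]; exact hmg.iapp hy) p4

/-! ## The functor laws -/

/-- Positivity discharges the requirement for negative occurrences, and inductive construction the
one for occurrences below type constants. What is left asks for a single map A ⊸ B, the variable. -/
theorem act_var_hasType {σ : S.Ty 1} (hσ : IndConstr σ) (hpos : ¬ σ.Occ false 0) (A B : S.Ty n) :
    HasType (intCtx (.lolli A B :: Γ)) (act σ (fun _ => A) (fun _ => B) (fun _ => .var 0))
      (.lolli (σ.at A) (σ.at B)) :=
  act_hasType σ _ _ _ _ (noLin_intCtx _) (fun _ _ => .inl ⟨0, rfl, rfl⟩)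
    (fun i h => by rw [Subsingleton.elim i 0] at h; exact absurd h hpos)
    (fun i h => absurd h (hσ.not_occCon i))

/-- The term `M_σ τ τ' !f` is the action of `σ` on `f`. -/
theorem ExtEq.mapTm_act {σ : S.Ty 1} (hσ : IndConstr σ) (hpos : ¬ σ.Occ false 0) {A B : S.Ty n}
    {f : Tm S n} (hf : HasType (intCtx Γ) f (.lolli A B)) :
    ExtEq (intCtx Γ) (mapTm σ A B f) (act σ (fun _ => A) (fun _ => B) (fun _ => f))
      (.lolli (σ.at A) (σ.at B)) := by
  have hM : HasType (intCtx Γ) (functorTm σ) (functorTy σ) :=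
    functorTm_hasType hσ hpos (noLin_intCtx _)
  have e1 : ∀ C : S.Ty n, (Ty.pi (.arr (.lolli (.var 1) (.var 0))
      (.lolli (σ.at (.var 1)) (σ.at (.var 0)))) : S.Ty (n + 1)).sub (instTy C) =
      .pi (.arr (.lolli C.wk (.var 0)) (.lolli (σ.at C.wk) (σ.at (.var 0)))) := fun C => by
    simp only [Ty.sub, Ty.arr, Ty.at_sub]; rfl
  have e2 : ∀ C D : S.Ty n, (Ty.arr (.lolli C.wk (.var 0))
      (.lolli (σ.at C.wk) (σ.at (.var 0))) : S.Ty (n + 1)).sub (instTy D) =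
      .arr (.lolli C D) (.lolli (σ.at C) (σ.at D)) := fun C D => by
    simp only [Ty.sub, Ty.arr, Ty.at_sub, Ty.wk_sub_instTy]; rfl
  have h1 := hM.itapp A
  rw [e1] at h1
  have b1 := ExtEq.tbeta h1
  have s1 : (Tm.tlam (.ilam (.lolli (.var 1) (.var 0))
      (act σ (fun _ => .var 1) (fun _ => .var 0) (fun _ => .var 0))) : Tm S (n + 1)).sub
      (instTy A) .var = .tlam (.ilam (.lolli A.wk (.var 0))
      (act σ (fun _ => A.wk) (fun _ => .var 0) (fun _ => .var 0))) := by
    simp only [Tm.sub, Tm.ilam_sub, act_sub]; rfl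
  rw [s1] at b1
  have b2 := ExtEq.tapp B b1
  have h2 : HasType (intCtx Γ) (.tlam (.ilam (.lolli A.wk (.var 0))
      (act σ (fun _ => A.wk) (fun _ => .var 0) (fun _ => .var 0))))
      (.pi (.arr (.lolli A.wk (.var 0)) (.lolli (σ.at A.wk) (σ.at (.var 0))))) :=
    .itlam (.ilam (act_var_hasType hσ hpos _ _))
  have b3 := ExtEq.tbeta (h2.itapp B)
  have s2 : (Tm.ilam (.lolli A.wk (.var 0))
      (act σ (fun _ => A.wk) (fun _ => .var 0) (fun _ => .var 0)) : Tm S (n + 1)).sub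
      (instTy B) .var = .ilam (.lolli A B)
      (act σ (fun _ => A) (fun _ => B) (fun _ => .var 0)) := by
    simp only [Tm.ilam_sub, act_sub, Ty.sub, Ty.wk_sub_instTy]; rfl
  rw [s2] at b3
  have b4 := b2.trans b3
  rw [e2] at b4
  have b5 := ExtEq.ilam_app (act_var_hasType hσ hpos A B) hf
  rw [act_sub] at b5
  simp only [Ty.sub_var] at b5
  exact .trans (.iapp b4 (.refl hf.ibang)) b5

theorem Proves.mapTm_idt (hext : extensionality S ⊆ T) {σ : S.Ty 1} (hσ : IndConstr σ)
    (hpos : ¬ σ.Occ false 0) (A : S.Ty n) :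
    Proves T [] [] [] (.eq (.lolli (σ.at A) (σ.at A)) (mapTm σ A A (.idt A)) (.idt (σ.at A))) :=
  .eqTrans (.ext .nil (mapTm_hasType hσ hpos noLin_nil (.idt A)) (act_idt_hasType σ fun _ => A)
    (.mapTm_act (Γ := []) hσ hpos (HasType.idt A))) (.act_idt hext σ fun _ => A)

/-- The graph lemma: `σ[R]` is contained in the graph of `σ(h)` if `R` is the graph of `h`. -/
theorem Proves.graph (hext : extensionality S ⊆ T) (hident : identityExtension S ⊆ T)
    {σ : S.Ty 1} (hσ : IndConstr σ) (hpos : ¬ σ.Occ false 0) {A B : S.Ty n} {h x y : Tm S n}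
    (hh : HasType (intCtx Γ) h (.lolli A B)) (hΦ : Wf T Γ Θ Φ)
    (hx : HasType (intCtx Γ) x (σ.at A)) (hy : HasType (intCtx Γ) y (σ.at B))
    (hxy : Proves T Γ Θ Φ (.rel (.interp 1 σ (fun _ => .pull A B h (.idt B) (.eqr B))) x y)) :
    Proves T Γ Θ Φ (.eq (σ.at B) (.app (mapTm σ A B h) x) y) := by
  -- The graph of h is written as a reindexing of eq_B along (h, id), since reindexing preserves
  -- admissibility.
  have hR : IsRel T true Γ Θ (.pull A B h (.idt B) (.eqr B)) A B := .pull (.eqr B) hh (.iidt B)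
  have hmh := mapTm_hasType hσ hpos (noLin_intCtx _) hh
  have hmi := mapTm_hasType hσ hpos (noLin_intCtx Γ) (HasType.iidt B)
  have hR2 := hR.up [B, A]
  have hΨ : Wf T (B :: A :: Γ) Θ
      [.rel ((RelE.pull A B h (.idt B) (.eqr B)).up 2) (.var 1) (.var 0)] :=
    .singleton (.rel hR2.ofAdm (.var rfl) (.var rfl))
  -- The pair (h, id) carries the graph of h into eq_B: this is the definition of the graph.
  have p := Proves.mapTm_parametric hident hσ hpos hR (.eqr B) hh (.iidt B) (by
    have eE : (RelE.eqr B).up 2 = .eqr B := by rw [RelE.up, RelE.eqr_ren, Ty.ren_id]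
    have e : (RelE.pull A B h (.idt B) (.eqr B)).up 2 =
        .pull A B (h.up 2) ((Tm.idt B).up 2) ((RelE.eqr B).up 2) := by
      simp only [RelE.up, RelE.pull_ren, Ty.ren_id]; rfl
    rw [e] at hΨ ⊢
    rw [eE] at hΨ ⊢
    exact Proves.pull_elim (IsRel.eqr B).ofAdm (hh.iup [B, A]) ((HasType.iidt B).iup [B, A]) hΨ
      (.var rfl) (.var rfl) (.head hΨ)) hΦ hx hy hxy
  -- By identity extension σ[eq_B] is equality, so σ(h) x = σ(id) y; then σ(id) is removed.
  have p' := Proves.interp_eqr_elim (τ := fun _ => B) hident hΦ (hmh.iapp hx) (hmi.iapp hy) p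
  exact .eqTrans p' (.eqTrans (.app_congr hΦ hmi (.iidt _) hy hy
    ((Proves.mapTm_idt hext hσ hpos B).eq_weaken.ofNil hΦ) (.refl hΦ hy)) (.idt_app hΦ hy))

theorem ExtEq.comp_iapp {A B C : S.Ty n} {g f x : Tm S n}
    (hg : HasType (intCtx Γ) g (.lolli B C)) (hf : HasType (intCtx Γ) f (.lolli A B))
    (hx : HasType (intCtx Γ) x A) :
    ExtEq (intCtx Γ) (.app (.comp A g f) x) (.app g (.app f x)) C := by
  have h := ExtEq.beta ((HasType.comp (noLin_intCtx _) hg hf).iapp hx)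
  have e : ∀ t : Tm S n, (t.up 1).sub .var (inst1 x) = t := fun t => by
    rw [Tm.up, Tm.sub_ren]; exact t.sub_var
  simp only [Tm.sub, e] at h
  exact h

/-- The pair (f, g ∘ f) carries eq_A into the graph of g. By parametricity, σ(f) x and σ(g ∘ f) x
are then related by σ applied to that graph, and the graph lemma for g equates σ(g)(σ(f) x) with the
second. -/
theorem Proves.mapTm_comp (hext : extensionality S ⊆ T) (hident : identityExtension S ⊆ T)
    {σ : S.Ty 1} (hσ : IndConstr σ) (hpos : ¬ σ.Occ false 0) {A B C : S.Ty n} {f g : Tm S n}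
    (hf : HasType [] f (.lolli A B)) (hg : HasType [] g (.lolli B C)) :
    Proves T [] [] [] (.eq (.lolli (σ.at A) (σ.at C)) (mapTm σ A C (.comp A g f))
      (.comp (σ.at A) (mapTm σ B C g) (mapTm σ A B f))) := by
  have hc := HasType.comp noLin_nil hg hf
  have hmf := mapTm_hasType hσ hpos noLin_nil hf
  have hmg := mapTm_hasType hσ hpos noLin_nil hg
  have hmc := mapTm_hasType hσ hpos noLin_nil hc
  have hcm := HasType.comp noLin_nil hmg hmf
  refine .lolli_ext (Γ := []) hext hmc hcm ?_
  rw [hmc.up_eq, hcm.up_eq]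
  have hN : ∀ Γ : List (S.Ty n), NoLin (intCtx Γ) := noLin_intCtx
  have hx : HasType (intCtx [σ.at A]) (.var 0) (σ.at A) := .var rfl
  have hR' : IsRel T true [σ.at A] [] (.pull B C g (.idt C) (.eqr C)) B C :=
    .pull (.eqr C) (hg.closed (hN _)) (.iidt C)
  have p := Proves.mapTm_parametric (Θ := []) hident hσ hpos (.eqr A) hR' (hf.closed (hN _))
    (hc.closed (hN _)) (by
      have hA := IsRel.eqr (T := T) (Γ := [A, A, σ.at A]) (Θ := []) A
      have eE : ∀ D : S.Ty n, (RelE.eqr D).up 2 = .eqr D := fun D => by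
        rw [RelE.up, RelE.eqr_ren, Ty.ren_id]
      have e : (RelE.pull B C g (.idt C) (.eqr C)).up 2 = .pull B C g (.idt C) (.eqr C) := by
        rw [RelE.up, RelE.pull_ren]
        change RelE.pull _ _ (g.up 2) ((Tm.idt C).up 2) ((RelE.eqr C).up 2) = _
        rw [eE, hg.up_eq, Tm.idt_up, Ty.ren_id, Ty.ren_id]
      rw [e, eE, hf.up_eq, hc.up_eq]
      have h1 : HasType (intCtx [A, A, σ.at A]) (.var 1) A := .var rfl
      have h0 : HasType (intCtx [A, A, σ.at A]) (.var 0) A := .var rfl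
      have hΨ : Wf T [A, A, σ.at A] [] [.rel (.eqr A) (.var 1) (.var 0)] :=
        .singleton (.rel hA.ofAdm h1 h0)
      have hf2 := hf.closed (hN [A, A, σ.at A])
      have hg2 := hg.closed (hN [A, A, σ.at A])
      have hc2 := hc.closed (hN [A, A, σ.at A])
      have q := Proves.eqr_elim hΨ h1 h0 (.head hΨ)
      have q0 := hc2.iapp h0
      refine .pull_intro (IsRel.eqr C).ofAdm hg2 (.iidt C) hΨ (hf2.iapp h1) q0 (.eqr_intro hΨ
        (hg2.iapp (hf2.iapp h1)) ((HasType.iidt C).iapp q0) (.eqTrans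
          (.app_congr hΨ hg2 hg2 (hf2.iapp h1) (hf2.iapp h0) (.refl hΨ hg2)
            (.app_congr hΨ hf2 hf2 h1 h0 (.refl hΨ hf2) q)) (.eqSymm (.eqTrans
            (.idt_app hΨ q0) (.ext hΨ q0 (hg2.iapp (hf2.iapp h0)) (.comp_iapp hg2 hf2 h0)))))))
    -- The starting point: x is related to itself by σ[eq_A], again by identity extension.
    .nil hx hx (.interp_eqr_intro (τ := fun _ => A) hident .nil hx hx (.refl .nil hx))
  have hmf1 := hmf.closed (hN [σ.at A])
  have hmg1 := hmg.closed (hN [σ.at A])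
  have r := Proves.graph hext hident hσ hpos (hg.closed (hN _)) .nil (hmf1.iapp hx)
    ((hmc.closed (hN _)).iapp hx) p
  exact .eqTrans (.eqSymm r) (.eqSymm (.ext .nil ((hcm.closed (hN _)).iapp hx)
    (hmg1.iapp (hmf1.iapp hx)) (.comp_iapp hmg1 hmf1 hx)))

end Rules

end

section

variable {S : Sig.{u, v}}

/-! ## The algebra `in` and the maps `fold` -/

section Rules

variable {T : Theory S} {n : ℕ} {Γ : List (S.Ty n)} {Θ : List (RDecl S n)} {Φ : List (Fm S n)}

theorem mapTm_ren {m : ℕ} {σ : S.Ty 1} {A B : S.Ty n} {f : Tm S n} (a : Fin n → Fin m)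
    (r : ℕ → ℕ) : (mapTm σ A B f).ren a r = mapTm σ (A.ren a) (B.ren a) (f.ren a r) := by
  simp only [Tm.ren_eq_sub, Ty.ren_eq_sub, mapTm, functorTm, Tm.sub, Tm.ilam_sub, act_sub]; rfl

theorem mapTm_sub {m : ℕ} {σ : S.Ty 1} {A B : S.Ty n} {f : Tm S n} (a : Fin n → S.Ty m)
    (s : ℕ → Tm S m) : (mapTm σ A B f).sub a s = mapTm σ (A.sub a) (B.sub a) (f.sub a s) := by
  simp only [mapTm, functorTm, Tm.sub, Tm.ilam_sub, act_sub]; rfl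

theorem foldAt_sub {m : ℕ} {σ : S.Ty 1} {A : S.Ty n} {f : Tm S n} (a : Fin n → S.Ty m)
    (s : ℕ → Tm S m) : (foldAt σ A f).sub a s = foldAt σ (A.sub a) (f.sub a s) := by
  simp only [foldAt, foldTm, Tm.sub, Tm.ilam_sub, Ty.sub, Ty.at_sub, mu_sub]; rfl

/-- Elements of `μα.σ(α)` are natural with respect to maps of algebras. -/
theorem Proves.mu_natural (hext : extensionality S ⊆ T) (hident : identityExtension S ⊆ T)
    {σ : S.Ty 1} (hσ : IndConstr σ) (hpos : ¬ σ.Occ false 0) {A B : S.Ty n} {h f g u : Tm S n}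
    (hh : HasType (intCtx Γ) h (.lolli A B)) (hf : HasType (intCtx Γ) f (.lolli (σ.at A) A))
    (hg : HasType (intCtx Γ) g (.lolli (σ.at B) B)) (hu : HasType (intCtx Γ) u (mu σ))
    (he : Proves T (σ.at A :: Γ) Θ [] (.eq B (.app (h.up 1) (.app (f.up 1) (.var 0)))
      (.app (g.up 1) (.app (mapTm σ A B (h.up 1)) (.var 0))))) :
    Proves T Γ Θ [] (.eq B (.app h (.app (.tapp u A) (.bang f))) (.app (.tapp u B) (.bang g))) := by
  let τ₀ : Fin 0 → S.Ty n := Fin.elim0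
  let ρ₀ : Fin 0 → RelE S n := Fin.elim0
  have hρ₀ : ∀ i, IsRel T true Γ Θ (ρ₀ i) (τ₀ i) (τ₀ i) := fun i => i.elim0
  have hR : IsRel T true Γ Θ (.pull A B h (.idt B) (.eqr B)) A B := .pull (.eqr B) hh (.iidt B)
  have hu0 : HasType (intCtx Γ) u ((mu σ : S.Ty 0).sub τ₀) := by rw [mu_sub]; exact hu
  -- Although u may contain variables from `Γ`, its type is closed, which is all that parametricity
  -- needs. The variable α is then interpreted by the graph of h.
  have p0 := Proves.parametric (Θ := Θ) (ρ := ρ₀) hident hu0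
  have p1 := Proves.interp_pi_elim hρ₀ hR .nil hu0 hu0 p0
  have e1 : (Fin.cases (.pull A B h (.idt B) (.eqr B)) ρ₀ : Fin 1 → RelE S n) =
      fun _ => .pull A B h (.idt B) (.eqr B) := by
    funext i; exact Fin.cases rfl (fun i => i.elim0) i
  -- Over the single variable α, the type σ(α) is σ itself, so no comparison along a renaming is
  -- needed.
  rw [e1, Ty.at_var_zero] at p1
  have t1 : ∀ C : S.Ty n, HasType (intCtx Γ) (.tapp u C)
      ((Ty.arr (.lolli σ (.var 0)) (.var 0)).sub (fun _ => C)) := fun C => by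
    have := hu.itapp C
    simp only [Ty.sub, Ty.arr, Ty.at_sub] at this
    exact this
  have hρ : ∀ _ : Fin 1, IsRel T true Γ Θ (.pull A B h (.idt B) (.eqr B)) A B := fun _ => hR
  have hρ2 : ∀ _ : Fin 1, IsRel T true (σ.at B :: σ.at A :: Γ) Θ
      ((RelE.pull A B h (.idt B) (.eqr B)).up 2) A B := fun _ => hR.up [σ.at B, σ.at A]
  have h1 : HasType (intCtx (σ.at B :: σ.at A :: Γ)) (.var 1) (σ.at A) := .var rfl
  have h0 : HasType (intCtx (σ.at B :: σ.at A :: Γ)) (.var 0) (σ.at B) := .var rfl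
  have hh2 := hh.iup [σ.at B, σ.at A]
  have hf2 := hf.iup [σ.at B, σ.at A]
  have hg2 := hg.iup [σ.at B, σ.at A]
  simp only [List.length_cons, List.length_nil, Nat.zero_add, Nat.reduceAdd] at hh2 hf2 hg2
  have hm2 := mapTm_hasType hσ hpos (noLin_intCtx _) hh2
  have q : Proves T Γ Θ [] (.rel (.interp 1 (.lolli σ (.var 0))
      (fun _ => .pull A B h (.idt B) (.eqr B))) f g) := by
    refine .interp_lolli_intro hρ hf hg ?_
    have eR : (RelE.pull A B h (.idt B) (.eqr B)).up 2 = .pull A B (h.up 2) (.idt B) (.eqr B) := by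
      rw [RelE.up, RelE.pull_ren, RelE.eqr_ren]
      change RelE.pull _ _ (h.up 2) ((Tm.idt B).up 2) _ = _
      simp only [Tm.idt_up, Ty.ren_id]
    have hΨ : Wf T (σ.at B :: σ.at A :: Γ) Θ [.rel (.interp 1 σ
        (fun _ => (RelE.pull A B h (.idt B) (.eqr B)).up 2)) (.var 1) (.var 0)] :=
      .singleton (.rel (.ofAdm (.interp σ hρ2)) h1 h0)
    refine .interp_var_intro 0 hρ2 hΨ (hf2.iapp h1) (hg2.iapp h0) ?_
    rw [eR] at hΨ ⊢
    refine .pull_intro (IsRel.eqr B).ofAdm hh2 (.iidt B) hΨ (hf2.iapp h1) (hg2.iapp h0)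
      (.eqr_intro hΨ (hh2.iapp (hf2.iapp h1)) ((HasType.iidt B).iapp (hg2.iapp h0)) ?_)
    -- For arguments x and y related by σ applied to the graph of h, the graph lemma gives σ(h) x =
    -- y. Hence h (f x) = g (σ(h) x) = g y, so f and g are related at σ(α) ⊸ α.
    have r1 := Proves.graph hext hident hσ hpos hh2 hΨ h1 h0 (.head hΨ)
    have r2 := he.ren (varRen_up [σ.at B]) relRen_id
    simp only [List.map_nil, Fm.ren, Tm.ren, Ty.ren_id, mapTm_ren] at r2
    change Proves T _ _ _ (.eq B (.app ((h.up 1).up 1) (.app ((f.up 1).up 1) (.var 1)))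
      (.app ((g.up 1).up 1) (.app (mapTm σ A B ((h.up 1).up 1)) (.var 1)))) at r2
    simp only [Tm.up_up_one] at r2
    exact .eqTrans (r2.ofNil hΨ) (.eqTrans
      (.app_congr hΨ hg2 hg2 (hm2.iapp h1) h0 (.refl hΨ hg2) r1)
      (.eqSymm (.idt_app hΨ (hg2.iapp h0))))
  have p2 := Proves.interp_lolli_elim hρ .nil (t1 A) (t1 B) (HasType.ibang hf) (HasType.ibang hg)
    p1 (.interp_bang_intro hρ hf hg q)
  have tA : HasType (intCtx Γ) (.app (.tapp u A) (.bang f)) A :=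
    (t1 A).iapp (σ := .bang (.lolli (σ.at A) A)) hf.ibang
  have tB : HasType (intCtx Γ) (.app (.tapp u B) (.bang g)) B :=
    (t1 B).iapp (σ := .bang (.lolli (σ.at B) B)) hg.ibang
  have p3 := Proves.interp_var_elim 0 hρ .nil tA tB p2
  exact .eqTrans (.eqr_elim .nil (hh.iapp tA) ((HasType.iidt B).iapp tB)
    (.pull_elim (IsRel.eqr B).ofAdm hh (.iidt B) .nil tA tB p3)) (.idt_app .nil tB)

-- Computation rules for fold and `in`

theorem ilam_foldBody_hasType (σ : S.Ty 1) (A : S.Ty n) :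
    HasType (intCtx (.lolli (σ.at A) A :: Γ))
      (.lam (mu σ) (.app (.tapp (.var 0) A) (.bang (.var 1)))) (.lolli (mu σ) A) := by
  have hN : NoLin (.off :: intCtx (.lolli (σ.at A) A :: Γ)) := by
    have := noLin_intCtx (Ty.lolli (σ.at A) A :: Γ)
    simpa [NoLin] using this
  refine .lam (.app (.left _ (Split.self (noLin_intCtx _))) (σ := .bang (.lolli (σ.at A) A)) ?_
    (.bang hN (.ivar hN rfl)))
  have := HasType.tapp (S := S) (G := .lin (mu σ) :: intCtx (.lolli (σ.at A) A :: Γ))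
    (t := .var 0) A (.lvar rfl hN)
  simp only [Ty.arr, Ty.sub, Ty.at_sub] at this
  exact this

theorem HasType.mu_app {σ : S.Ty 1} {A : S.Ty n} {u f : Tm S n}
    (hu : HasType (intCtx Γ) u (mu σ)) (hf : HasType (intCtx Γ) f (.lolli (σ.at A) A)) :
    HasType (intCtx Γ) (.app (.tapp u A) (.bang f)) A := by
  have := hu.itapp A
  simp only [Ty.sub, Ty.arr, Ty.at_sub] at this
  exact this.iapp hf.ibang

theorem ExtEq.foldAt_app {σ : S.Ty 1} {A : S.Ty n} {f u : Tm S n}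
    (hf : HasType (intCtx Γ) f (.lolli (σ.at A) A)) (hu : HasType (intCtx Γ) u (mu σ)) :
    ExtEq (intCtx Γ) (.app (foldAt σ A f) u) (.app (.tapp u A) (.bang f)) A := by
  have h1 := (foldTm_hasType σ (noLin_intCtx Γ)).itapp A
  simp only [Ty.arr, Ty.sub, Ty.at_sub, mu_sub] at h1
  have b1 := ExtEq.tbeta h1
  have s1 : (Tm.ilam (.lolli (σ.at (.var 0)) (.var 0))
      (.lam (mu σ) (.app (.tapp (.var 0) (.var 0)) (.bang (.var 1)))) : Tm S (n + 1)).sub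
        (instTy A) .var = .ilam (.lolli (σ.at A) A)
      (.lam (mu σ) (.app (.tapp (.var 0) A) (.bang (.var 1)))) := by
    simp only [Tm.ilam_sub, Tm.sub, Ty.sub, Ty.at_sub, mu_sub]; rfl
  rw [s1] at b1
  have b2 := ExtEq.ilam_app (ilam_foldBody_hasType σ A) hf
  have s2 : (Tm.lam (mu σ) (.app (.tapp (.var 0) A) (.bang (.var 1)))).sub .var (inst1 f) =
      .lam (mu σ) (.app (.tapp (.var 0) A) (.bang (f.up 1))) := by
    simp only [Tm.sub, Ty.sub_var]; rfl
  rw [s2] at b2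
  have hN : NoLin (.off :: intCtx Γ) := by have := noLin_intCtx Γ; simpa [NoLin] using this
  have h3 : HasType (intCtx Γ) (.lam (mu σ) (.app (.tapp (.var 0) A) (.bang (f.up 1))))
      (.lolli (mu σ) A) := by
    refine .lam (.app (.left _ (Split.self (noLin_intCtx _))) (σ := .bang (.lolli (σ.at A) A)) ?_
      (.bang hN (hf.up (e := .off) (by simp))))
    have := HasType.tapp (S := S) (G := .lin (mu σ) :: intCtx Γ) (t := .var 0) A (.lvar rfl hN)
    simp only [Ty.arr, Ty.sub, Ty.at_sub] at this
    exact this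
  have b3 := ExtEq.beta (h3.iapp hu)
  have s3 : (Tm.app (.tapp (.var 0) A) (.bang (f.up 1))).sub .var (inst1 u) =
      .app (.tapp u A) (.bang f) := by
    simp only [Tm.sub, Ty.sub_var, Tm.up, Tm.sub_ren]
    exact congrArg (fun t => Tm.app (.tapp u A) (.bang t)) f.sub_var
  rw [s3] at b3
  exact .trans (.iapp (.trans (.iapp b1 (.refl hf.ibang)) b2) (.refl hu)) b3

theorem ExtEq.in_app {σ : S.Ty 1} (hσ : IndConstr σ) (hpos : ¬ σ.Occ false 0) {A : S.Ty n}
    {f z : Tm S n} (hf : HasType (intCtx Γ) f (.lolli (σ.at A) A))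
    (hz : HasType (intCtx Γ) z (σ.at (mu σ))) :
    ExtEq (intCtx Γ) (.app (.tapp (.app (inTm σ) z) A) (.bang f))
      (.app f (.app (mapTm σ (mu σ) A (foldAt σ A f)) z)) A := by
  have h1 := (inTm_hasType hσ hpos (noLin_intCtx Γ)).iapp hz
  have b1 := ExtEq.beta h1
  have s1 : (Tm.tlam (.ilam (.lolli (σ.at (.var 0)) (.var 0)) (.app (.var 0) (.app
      (mapTm σ (mu σ) (.var 0) (foldAt σ (.var 0) (.var 0))) (.var 1)))) : Tm S n).sub
        .var (inst1 z) = .tlam (.ilam (.lolli (σ.at (.var 0)) (.var 0)) (.app (.var 0) (.app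
      (mapTm σ (mu σ) (.var 0) (foldAt σ (.var 0) (.var 0))) (z.tup.up 1)))) := by
    simp only [Tm.sub, Tm.ilam_sub, mapTm_sub, foldAt_sub, liftTy_var, Ty.sub_var]; rfl
  rw [s1] at b1
  have b2 := ExtEq.tapp A b1
  -- Needed twice: below the type abstraction, with α as the carrier, and after instantiation, with
  -- A.
  have body : ∀ {m : ℕ} {Δ : List (S.Ty m)} {B : S.Ty m} {w : Tm S m},
      HasType (intCtx Δ) w (σ.at (mu σ)) → HasType (intCtx (.lolli (σ.at B) B :: Δ))
        (.app (.var 0) (.app (mapTm σ (mu σ) B (foldAt σ B (.var 0))) (w.up 1))) B := by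
    intro m Δ B w hw
    have h0 : HasType (intCtx (.lolli (σ.at B) B :: Δ)) (.var 0) (.lolli (σ.at B) B) := .var rfl
    exact h0.iapp ((mapTm_hasType hσ hpos (noLin_intCtx _)
      (foldAt_hasType σ (noLin_intCtx _) h0)).iapp (hw.iup [.lolli (σ.at B) B]))
  have hz1 : HasType (intCtx (Γ.map Ty.wk)) z.tup (σ.at (mu σ)) := by
    have := hz.tup
    rwa [Ty.wk, Ty.at_ren, mu_ren] at this
  have h2 : HasType (intCtx Γ) (.tlam (.ilam (.lolli (σ.at (.var 0)) (.var 0)) (.app (.var 0) (.app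
      (mapTm σ (mu σ) (.var 0) (foldAt σ (.var 0) (.var 0))) (z.tup.up 1))))) (mu σ) :=
    .itlam (.ilam (body hz1))
  have b3 := ExtEq.tbeta (h2.itapp A)
  have s3 : (Tm.ilam (.lolli (σ.at (.var 0)) (.var 0)) (.app (.var 0) (.app
      (mapTm σ (mu σ) (.var 0) (foldAt σ (.var 0) (.var 0))) (z.tup.up 1)))).sub
        (instTy A) .var = .ilam (.lolli (σ.at A) A) (.app (.var 0) (.app
      (mapTm σ (mu σ) A (foldAt σ A (.var 0))) (z.up 1))) := by
    have e : (z.tup.up 1).sub (instTy A) .var = z.up 1 := by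
      rw [Tm.up, Tm.tup, Tm.ren_ren, Tm.sub_ren, Tm.up, Tm.ren_eq_sub]; rfl
    simp only [Tm.ilam_sub, Tm.sub, mapTm_sub, foldAt_sub, Ty.sub, Ty.at_sub, mu_sub, liftTm_var, e]
    rfl
  rw [s3] at b3
  have b4 := b2.trans b3
  simp only [Ty.sub, Ty.arr, Ty.at_sub] at b4
  have b5 := ExtEq.ilam_app (body hz) hf
  have s5 : (Tm.app (.var 0) (.app (mapTm σ (mu σ) A (foldAt σ A (.var 0))) (z.up 1))).sub
      .var (inst1 f) = .app f (.app (mapTm σ (mu σ) A (foldAt σ A f)) z) := by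
    have e : (z.up 1).sub .var (inst1 f) = z := by rw [Tm.up, Tm.sub_ren]; exact z.sub_var
    simp only [Tm.sub, mapTm_sub, foldAt_sub, Ty.sub_var, e]; rfl
  rw [s5] at b5
  exact .trans (.iapp b4 (.refl hf.ibang)) b5

/-- Unfolding fold exposes (in z) A !f, and unfolding `in` produces the recursive call. Both are
beta computations, so this half of initiality already holds for external equality. -/
theorem ExtEq.foldAt_in {σ : S.Ty 1} (hσ : IndConstr σ) (hpos : ¬ σ.Occ false 0) {A : S.Ty n}
    {f z : Tm S n} (hf : HasType (intCtx Γ) f (.lolli (σ.at A) A))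
    (hz : HasType (intCtx Γ) z (σ.at (mu σ))) :
    ExtEq (intCtx Γ) (.app (foldAt σ A f) (.app (inTm σ) z))
      (.app f (.app (mapTm σ (mu σ) A (foldAt σ A f)) z)) A :=
  .trans (.foldAt_app hf ((inTm_hasType hσ hpos (noLin_intCtx _)).iapp hz))
    (.in_app hσ hpos hf hz)

/-- Extensionality only turns the pointwise computation rule into an equation between composites. -/
theorem foldAt_isAlgMap (hext : extensionality S ⊆ T) {σ : S.Ty 1} (hσ : IndConstr σ)
    (hpos : ¬ σ.Occ false 0) {A : S.Ty n} {f : Tm S n} (hf : HasType [] f (.lolli (σ.at A) A)) :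
    IsAlgMap T σ A f (foldAt σ A f) := by
  have hF := foldAt_hasType σ noLin_nil hf
  have hI := inTm_hasType (n := n) hσ hpos noLin_nil
  have hm := mapTm_hasType hσ hpos noLin_nil hF
  have h1 := HasType.comp noLin_nil hF hI
  have h2 := HasType.comp noLin_nil hf hm
  refine ⟨hF, .lolli_ext (Γ := []) hext h1 h2 ?_⟩
  rw [h1.up_eq, h2.up_eq]
  have hN := noLin_intCtx [σ.at (mu σ : S.Ty n)]
  have hx : HasType (intCtx [σ.at (mu σ : S.Ty n)]) (.var 0) (σ.at (mu σ)) := .var rfl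
  exact .ext .nil ((h1.closed hN).iapp hx) ((h2.closed hN).iapp hx)
    (.trans (.comp_iapp (hF.closed hN) (hI.closed hN) hx) (.trans
      (.foldAt_in hσ hpos (hf.closed hN) hx)
      (.symm (.comp_iapp (hf.closed hN) (hm.closed hN) hx))))

-- Uniqueness of maps out of the algebra `in`

/-- Applied to α and !v, the left side is fold α !v (u μ !in). As fold α !v is a map of algebras
from `in` to v, naturality of u gives u α !v, the value of the right side. -/
theorem Proves.mu_in (hext : extensionality S ⊆ T) (hident : identityExtension S ⊆ T)
    {σ : S.Ty 1} (hσ : IndConstr σ) (hpos : ¬ σ.Occ false 0) {u : Tm S n}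
    (hu : HasType (intCtx Γ) u (mu σ)) :
    Proves T Γ Θ [] (.eq (mu σ) (.app (.tapp u (mu σ)) (.bang (inTm σ))) u) := by
  have hI0 : ∀ m : ℕ, HasType [] (inTm σ : Tm S m) (.lolli (σ.at (mu σ)) (mu σ)) :=
    fun m => inTm_hasType hσ hpos noLin_nil
  have hI : ∀ {m : ℕ} (Γ : List (S.Ty m)),
      HasType (intCtx Γ) (inTm σ) (.lolli (σ.at (mu σ)) (mu σ)) :=
    fun Γ => inTm_hasType hσ hpos (noLin_intCtx Γ)
  have h1 := hu.mu_app (hI Γ)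
  -- An element of μα.σ(α) expects an argument of type !(σ(α) ⊸ α). Only with `arr_ext` does it
  -- suffice to test on arguments !v, to which naturality applies.
  refine .pi_ext hext h1 hu (.arr_ext hext hident h1.tup_tapp hu.tup_tapp ?_)
  have e1 : (Tm.app (.tapp u (mu σ)) (.bang (inTm σ))).tup =
      .app (.tapp u.tup (mu σ)) (.bang (inTm σ)) := by
    have : (inTm σ : Tm S n).tup = inTm σ := by
      simp only [Tm.tup, inTm, Tm.ren_eq_sub, Tm.sub, Tm.ilam_sub, mapTm_sub, foldAt_sub, Ty.sub,
        Ty.at_sub, mu_sub]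
      rfl
    simp only [Tm.tup] at this
    simp only [Tm.tup, Tm.ren, mu_ren, this]
  rw [e1]
  have hu1 : HasType (intCtx (Γ.map Ty.wk)) u.tup (mu σ) := by
    have := hu.tup
    rwa [Ty.wk, mu_ren] at this
  have hu2 := hu1.iup [.lolli (σ.at (.var 0)) (.var 0)]
  have hv : HasType (intCtx (.lolli (σ.at (.var 0)) (.var 0) :: Γ.map Ty.wk)) (.var 0)
      (.lolli (σ.at (.var 0)) (.var 0)) := .var rfl
  have e2 : ∀ t : Tm S (n + 1), (Tm.tapp (.app (.tapp t (mu σ)) (.bang (inTm σ))) (.var 0)).up 1 =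
      .tapp (.app (.tapp (t.up 1) (mu σ)) (.bang (inTm σ))) (.var 0) := fun t => by
    have := (hI0 (n + 1)).up_eq 1
    simp only [Tm.up] at this
    simp only [Tm.up, Tm.ren, mu_ren, this]; rfl
  rw [e2]
  have hF := foldAt_hasType σ (noLin_intCtx _) hv
  have q := Proves.mu_natural (Θ := Θ.map RDecl.wk) hext hident hσ hpos hF (hI _) hv hu2 (by
    have hz : HasType (intCtx (σ.at (mu σ) :: .lolli (σ.at (.var 0)) (.var 0) :: Γ.map Ty.wk))
      (.var 0) (σ.at (mu σ)) := .var rfl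
    have hv2 := hv.iup [σ.at (mu σ)]
    have eF : (foldAt σ (.var 0) (.var 0) : Tm S (n + 1)).up 1 = foldAt σ (.var 0) (.var 1) := by
      simp only [Tm.up, Tm.ren_eq_sub, foldAt_sub]; rfl
    rw [eF, (hI0 (n + 1)).up_eq]
    have hF2 := foldAt_hasType σ (noLin_intCtx _) hv2
    exact .ext .nil (hF2.iapp ((hI _).iapp hz))
      (hv2.iapp ((mapTm_hasType hσ hpos (noLin_intCtx _) hF2).iapp hz))
      (.foldAt_in hσ hpos hv2 hz))
  have hw := hu2.mu_app (hI _)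
  exact .eqTrans (.eqSymm (.ext .nil (hF.iapp hw) (hw.mu_app hv) (.foldAt_app hv hw))) q

/-- Write u as u μ !in. Then h u = h (u μ !in) = u τ !f by naturality along h, and the last term is
fold τ !f u. -/
theorem IsAlgMap.eq_foldAt (hext : extensionality S ⊆ T) (hident : identityExtension S ⊆ T)
    {σ : S.Ty 1} (hσ : IndConstr σ) (hpos : ¬ σ.Occ false 0) {A : S.Ty n} {f h : Tm S n}
    (hf : HasType [] f (.lolli (σ.at A) A)) (hh : IsAlgMap T σ A f h) :
    Proves T [] [] [] (.eq (.lolli (mu σ) A) h (foldAt σ A f)) := by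
  obtain ⟨hh, he⟩ := hh
  have hF := foldAt_hasType σ noLin_nil hf
  have hI := inTm_hasType (n := n) hσ hpos noLin_nil
  have hm := mapTm_hasType hσ hpos noLin_nil hh
  refine .lolli_ext (Γ := []) hext hh hF ?_
  rw [hh.up_eq, hF.up_eq]
  have hN : ∀ Γ : List (S.Ty n), NoLin (intCtx Γ) := noLin_intCtx
  have hx : HasType (intCtx [(mu σ : S.Ty n)]) (.var 0) (mu σ) := .var rfl
  have hz : HasType (intCtx [σ.at (mu σ), (mu σ : S.Ty n)]) (.var 0) (σ.at (mu σ)) := .var rfl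
  have hh1 := hh.closed (hN [mu σ])
  have hI1 := hI.closed (hN [mu σ])
  have hf1 := hf.closed (hN [mu σ])
  have hh2 := hh.closed (hN [σ.at (mu σ), mu σ])
  have hI2 := hI.closed (hN [σ.at (mu σ), mu σ])
  have hf2 := hf.closed (hN [σ.at (mu σ), mu σ])
  have hm2 := hm.closed (hN [σ.at (mu σ), mu σ])
  have c1 := HasType.comp (hN _) hh2 hI2
  have c2 := HasType.comp (hN _) hf2 hm2
  -- Naturality asks for h (in z) = f (σ(h) z) with z a variable; this is the provable equality of
  -- the two composites, applied to z.
  have q := Proves.mu_natural (T := T) (Θ := []) hext hident hσ hpos hh1 hI1 hf1 hx (by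
    rw [hh.up_eq, hI.up_eq, hf.up_eq]
    exact .eqTrans (.eqSymm (.ext .nil (c1.iapp hz) (hh2.iapp (hI2.iapp hz))
      (.comp_iapp hh2 hI2 hz))) (.eqTrans
      (.app_congr .nil c1 c2 hz hz he.eq_weaken (.refl .nil hz))
      (.ext .nil (c2.iapp hz) (hf2.iapp (hm2.iapp hz)) (.comp_iapp hf2 hm2 hz))))
  have hw := hx.mu_app hI1
  exact .eqTrans (.app_congr .nil hh1 hh1 hx hw (.refl .nil hh1)
    (.eqSymm (.mu_in hext hident hσ hpos hx))) (.eqTrans q (.eqSymm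
      (.ext .nil ((hF.closed (hN _)).iapp hx) (hx.mu_app hf1) (.foldAt_app hf1 hx))))

end Rules

end

section

variable {S : Sig.{u, v}}

/-! ## Initiality -/

theorem isFunctorial {T : Theory S} (hext : extensionality S ⊆ T)
    (hident : identityExtension S ⊆ T) {σ : S.Ty 1} (hσ : IndConstr σ) (hpos : ¬ σ.Occ false 0)
    (n : ℕ) : IsFunctorial T n hσ hpos := by
  refine ⟨fun A => Quotient.sound (Proves.mapTm_idt hext hσ hpos A.ty), ?_⟩
  rintro A B C ⟨f⟩ ⟨g⟩
  exact Quotient.sound (Proves.mapTm_comp hext hident hσ hpos f.2 g.2)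

open CategoryTheory in
-- Structure maps and morphisms are classes of closed terms. Choosing representatives turns equality
-- of classes into provable equality and reduces the claim to the two facts about fold. The
-- `Nonempty` makes the goal a proposition, so that representatives can be chosen.
theorem muAlgebra_existsUnique_hom {T : Theory S} (hext : extensionality S ⊆ T)
    (hident : identityExtension S ⊆ T) {σ : S.Ty 1} (hσ : IndConstr σ) (hpos : ¬ σ.Occ false 0)
    {n : ℕ} (hfun : IsFunctorial T n hσ hpos)
    (B : Endofunctor.Algebra (typeFunctor T n hσ hpos hfun)) :
    Nonempty (Unique (muAlgebra T n hσ hpos hfun ⟶ B)) := by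
  obtain ⟨⟨A⟩, s⟩ := B
  obtain ⟨⟨f, hf⟩, rfl⟩ := Quotient.exists_rep s
  have hF := foldAt_isAlgMap hext hσ hpos hf
  -- The square for a morphism of algebras has f ∘ σ(h) on its left side and h ∘ in on its right,
  -- the opposite of `IsAlgMap`; hence the symmetry here and below.
  refine ⟨⟨⟨⟨LinHom.mk T (foldAt σ A f) hF.1, Quotient.sound hF.2.eqSymm⟩⟩, ?_⟩⟩
  rintro ⟨h, hh⟩
  obtain ⟨⟨h, ht⟩, rfl⟩ := Quotient.exists_rep h
  refine Endofunctor.Algebra.Hom.ext (Quotient.sound ?_)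
  exact IsAlgMap.eq_foldAt hext hident hσ hpos hf ⟨ht, .eqSymm (Quotient.exact hh)⟩

end

end LAPL

-- The main theorem

theorem mainTheorem7 {S : LAPL.Sig.{u, v}} (T : LAPL.Theory S)
    (hext : LAPL.extensionality S ⊆ T) (hident : LAPL.identityExtension S ⊆ T)
    {σ : S.Ty 1} (hσ : LAPL.IndConstr σ) (hpos : ¬ σ.Occ false 0) (n : ℕ) :
    (∃ hfun : LAPL.IsFunctorial T n hσ hpos,
      Nonempty (CategoryTheory.Limits.IsInitial (LAPL.muAlgebra T n hσ hpos hfun))) ∧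
    ∀ (τ : S.Ty n) (f : LAPL.Tm S n), LAPL.HasType [] f (.lolli (σ.at τ) τ) →
      LAPL.IsAlgMap T σ τ f (LAPL.foldAt σ τ f) ∧
      ∀ h : LAPL.Tm S n, LAPL.IsAlgMap T σ τ f h →
        LAPL.Proves T [] [] [] (.eq (.lolli (LAPL.mu σ) τ) h (LAPL.foldAt σ τ f)) := by
  have hfun := LAPL.isFunctorial hext hident hσ hpos n
  refine ⟨⟨hfun, ⟨?_⟩⟩, fun τ f hf => ⟨LAPL.foldAt_isAlgMap hext hσ hpos hf,
    fun h hh => hh.eq_foldAt hext hident hσ hpos hf⟩⟩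
  have : ∀ B, Unique (LAPL.muAlgebra T n hσ hpos hfun ⟶ B) := fun B =>
    Classical.choice (LAPL.muAlgebra_existsUnique_hom hext hident hσ hpos hfun B)
  exact CategoryTheory.Limits.IsInitial.ofUnique _
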